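/- Let $d\in\mathbb N$, $m\in\mathbb R$, $0\le\rho\le 1$. Write $\langle x\rangle=(1+|x|^2)^{1/2}$, let $\langle\cdot,\cdot\rangle$ denote the Euclidean inner product or the bilinear distributional pairing, and put $(u,v)=\langle u,\overline v\rangle$. Let $\Gamma_\rho^m(\mathbb R^{2d})$ be the Shubin class of all $a\in C^\infty(\mathbb R^{2d})$ such that for all multi-indices $\alpha,\beta\in\mathbb N^d$ there is $C_{\alpha\beta}$ with $$|\partial_x^\alpha\partial_\xi^\beta a(x,\xi)|\le C_{\alpha\beta}\,\langle(x,\xi)\rangle^{m-\rho|\alpha+\beta|},\qquad x,\xi\in\mathbb R^d .$$ For $a\in\Gamma_\rho^m(\mathbb R^{2d})$ the Schwartz kernel of the Weyl operator $a^w(x,D)f(x)=(2\pi)^{-d}\iint e^{i\langle x-y,\xi\rangle}a(\tfrac{x+y}2,\xi)f(y)\,dy\,d\xi$ is the tempered distribution $K_a(x,y)=(2\pi)^{-d}\int e^{i\langle x-y,\xi\rangle}a(\tfrac{x+y}{2},\xi)\,d\xi$ on $\mathbb R^{2d}$ (a partial inverse Fourier transform in $\mathscr S'$), that is, for $\varphi\in\mathscr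 S(\mathbb R^{2d})$, $$\langle K_a,\varphi\rangle=(2\pi)^{-d}\int_{\mathbb R^{2d}}a(p,\xi)\Big(\int_{\mathbb R^d}e^{i\langle u,\xi\rangle}\varphi(p+\tfrac u2,p-\tfrac u2)\,du\Big)dp\,d\xi .$$ For $u\in\mathscr S'(\mathbb R^{2d})$, $g\in\mathscr S(\mathbb R^{2d})\setminus\{0\}$ and $z=(z_1,z_2),\zeta=(\zeta_1,\zeta_2)\in\mathbb R^{2d}$ let $$\mathcal T_gu(z,\zeta)=(2\pi)^{-d}(u,T_zM_\zeta g),\quad T_zM_\zeta g(y)=e^{i\langle y-z,\zeta\rangle}g(y-z),\qquad \mathcal T_g^\Delta u(z,\zeta)=e^{-\frac i2\langle\zeta_1-\zeta_2,z_1-z_2\rangle}\,\mathcal T_gu(z,\zeta).$$ Proposition. Let $K\in\mathscr S'(\mathbb R^{2d})$. Then $K$ is the Schwartz kernel $K_a$ of $a^w(x,D)$ for some $a\in\Gamma_\rho^m(\mathbb R^{2d})$ if and only if for every $g\in\mathscr S(\mathbb R^{2d})\setminus\{0\}$, and equivalently for some $g\in\mathscr S(\mathbb R^{2d})\setminus\{0\}$,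 the following holds: for all $\alpha,\beta\in\mathbb N^d$ and $N\in\mathbb N$ there is a constant $C$ such that for all $z_1,z_2,\zeta_1,\zeta_2\in\mathbb R^d$ $$\big|(\partial_{z_1}+\partial_{z_2})^\alpha(\partial_{\zeta_1}-\partial_{\zeta_2})^\beta\,\mathcal T_g^\Delta K(z_1,z_2,\zeta_1,\zeta_2)\big|\le C\,\langle(z_1+z_2,\zeta_1-\zeta_2)\rangle^{m-\rho|\alpha+\beta|}\,\langle(z_1-z_2,\zeta_1+\zeta_2)\rangle^{-N}.$$ -/

import Mathlib

open scoped SchwartzMap ContDiff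

namespace Shubin

/-- `ℝᵈ` with its Euclidean structure. The space `ℝ²ᵈ` is written `Rn d × Rn d`; its inner product
and its Japanese bracket are the Euclidean ones, given by `dot` and `bracket` below, and its
measure is Lebesgue measure. -/
abbrev Rn (d : ℕ) := EuclideanSpace ℝ (Fin d)

/-- The Euclidean inner product on `ℝ²ᵈ`. -/
noncomputable def dot {d : ℕ} (x y : Rn d × Rn d) : ℝ :=
  inner ℝ x.1 y.1 + inner ℝ x.2 y.2

/-- The Japanese bracket `⟨(x, y)⟩ = (1 + |x|² + |y|²)^(1/2)` on `ℝ²ᵈ`. -/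
noncomputable def bracket {d : ℕ} (x y : Rn d) : ℝ :=
  Real.sqrt (1 + ‖x‖ ^ 2 + ‖y‖ ^ 2)

/-- The standard basis vectors of `ℝᵈ`. -/
noncomputable def basisVec {d : ℕ} (j : Fin d) : Rn d := EuclideanSpace.single j 1

/-- The length `|α|` of a multi-index. -/
def multiLength {d : ℕ} (α : Fin d → ℕ) : ℕ := ∑ j, α j

/-- For vectors `v₁, …, v_d` and a multi-index `α`, the iterated directional derivative
`∂_{v₁}^{α₁} ⋯ ∂_{v_d}^{α_d} F`. -/
noncomputable def multiDeriv {d : ℕ} {W : Type*} [AddCommGroup W] [Module ℝ W]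
    (v : Fin d → W) (α : Fin d → ℕ) (F : W → ℂ) : W → ℂ :=
  (List.finRange d).foldr (fun j G => (fun H p => lineDeriv ℝ H p (v j))^[α j] G) F

/-- The Shubin class `Γ_ρ^m(ℝ²ᵈ)`: smooth functions with
`|∂_x^α ∂_ξ^β a(x, ξ)| ≤ C_{αβ} ⟨(x, ξ)⟩^(m - ρ |α + β|)`. -/
def IsShubinSymbol {d : ℕ} (ρ m : ℝ) (a : Rn d × Rn d → ℂ) : Prop :=
  ContDiff ℝ ∞ a ∧ ∀ α β : Fin d → ℕ, ∃ C : ℝ, ∀ p : Rn d × Rn d,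
    ‖multiDeriv (fun j => (basisVec j, 0)) α (multiDeriv (fun j => (0, basisVec j)) β a) p‖ ≤
      C * bracket p.1 p.2 ^ (m - ρ * (multiLength (α + β) : ℝ))

/-- `K` is the Schwartz kernel
`K_a(x, y) = (2π)^(-d) ∫ e^{i⟨x - y, ξ⟩} a((x + y)/2, ξ) dξ`
of the Weyl operator `a^w(x, D)`, in the sense of tempered distributions: the `ξ`-integral is a
partial inverse Fourier transform, which acts on the test function `φ`. In the coordinates
`x = p + u/2`, `y = p - u/2` (with Jacobian of modulus one),
`⟨K_a, φ⟩ = (2π)^(-d) ∬ a(p, ξ) (∫ e^{i⟨u, ξ⟩} φ(p + u/2, p - u/2) du) dp dξ`,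
where the inner integral is a Schwartz function of `(p, ξ)`. -/
def IsWeylKernel {d : ℕ} (a : Rn d × Rn d → ℂ) (K : 𝓢'(Rn d × Rn d, ℂ)) : Prop :=
  ∀ φ : 𝓢(Rn d × Rn d, ℂ),
    K φ = (((2 * Real.pi) ^ d : ℝ) : ℂ)⁻¹ *
      ∫ q : Rn d × Rn d, a q *
        ∫ u : Rn d, Complex.exp (Complex.I * ((inner ℝ u q.2 : ℝ) : ℂ)) *
          φ (q.1 + (1 / 2 : ℝ) • u, q.1 - (1 / 2 : ℝ) • u)

/-- Modulation `M_ζ g(y) = e^{i⟨y, ζ⟩} g(y)` on Schwartz functions. -/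
noncomputable def modulate {d : ℕ} (ζ : Rn d × Rn d) (g : 𝓢(Rn d × Rn d, ℂ)) :
    𝓢(Rn d × Rn d, ℂ) :=
  SchwartzMap.smulLeftCLM ℂ (fun y => Complex.exp (Complex.I * (dot y ζ : ℂ))) g

/-- Translation `T_z g(y) = g(y - z)` on Schwartz functions. -/
noncomputable def translate {d : ℕ} (z : Rn d × Rn d) (g : 𝓢(Rn d × Rn d, ℂ)) :
    𝓢(Rn d × Rn d, ℂ) :=
  SchwartzMap.compSubConstCLM ℂ z g

/-- Complex conjugation on Schwartz functions. -/
noncomputable def conjugate {d : ℕ} (g : 𝓢(Rn d × Rn d, ℂ)) : 𝓢(Rn d × Rn d, ℂ) :=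
  SchwartzMap.postcompCLM (Complex.conjCLE : ℂ →L[ℝ] ℂ) g

/-- The transform `T_g u(z, ζ) = (2π)^(-2d/2) (u, T_z M_ζ g)` of `u ∈ 𝓢'(ℝ²ᵈ)`, where
`(u, v) = ⟨u, conj v⟩`. -/
noncomputable def fbi {d : ℕ} (g : 𝓢(Rn d × Rn d, ℂ)) (u : 𝓢'(Rn d × Rn d, ℂ)) :
    (Rn d × Rn d) × (Rn d × Rn d) → ℂ :=
  fun p => (((2 * Real.pi) ^ d : ℝ) : ℂ)⁻¹ * u (conjugate (translate p.1 (modulate p.2 g)))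

/-- The phase-corrected transform
`T_g^Δ u(z₁, z₂, ζ₁, ζ₂) = e^{-(i/2)⟨ζ₁ - ζ₂, z₁ - z₂⟩} T_g u(z₁, z₂, ζ₁, ζ₂)`. -/
noncomputable def fbiDelta {d : ℕ} (g : 𝓢(Rn d × Rn d, ℂ)) (u : 𝓢'(Rn d × Rn d, ℂ)) :
    (Rn d × Rn d) × (Rn d × Rn d) → ℂ :=
  fun p => Complex.exp (-(Complex.I / 2) * ((inner ℝ (p.2.1 - p.2.2) (p.1.1 - p.1.2) : ℝ) : ℂ)) *
    fbi g u p

/-- The estimates, for all multi-indices `α`, `β` and all `N ∈ ℕ`,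
`|(∂_{z₁} + ∂_{z₂})^α (∂_{ζ₁} - ∂_{ζ₂})^β T_g^Δ K(z₁, z₂, ζ₁, ζ₂)|
  ≤ C ⟨(z₁ + z₂, ζ₁ - ζ₂)⟩^(m - ρ |α + β|) ⟨(z₁ - z₂, ζ₁ + ζ₂)⟩^(-N)`. -/
def KernelEstimates {d : ℕ} (ρ m : ℝ) (g : 𝓢(Rn d × Rn d, ℂ)) (K : 𝓢'(Rn d × Rn d, ℂ)) : Prop :=
  ∀ (α β : Fin d → ℕ) (N : ℕ), ∃ C : ℝ, ∀ z₁ z₂ ζ₁ ζ₂ : Rn d,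
    ‖multiDeriv (fun j => ((basisVec j, basisVec j), (0, 0))) α
        (multiDeriv (fun j => ((0, 0), (basisVec j, -basisVec j))) β (fbiDelta g K))
        ((z₁, z₂), (ζ₁, ζ₂))‖ ≤
      C * bracket (z₁ + z₂) (ζ₁ - ζ₂) ^ (m - ρ * (multiLength (α + β) : ℝ)) *
        bracket (z₁ - z₂) (ζ₁ + ζ₂) ^ (-(N : ℝ))

/-- Characters `t ↦ e^{it}` of `ℝ` have temperate growth. -/
theorem hasTemperateGrowth_expI :
    (fun t : ℝ => Complex.exp (Complex.I * (t : ℂ))).HasTemperateGrowth := by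
  have key : ∀ n : ℕ, iteratedDeriv n (fun t : ℝ => Complex.exp (Complex.I * (t : ℂ))) =
      fun t : ℝ => Complex.I ^ n * Complex.exp (Complex.I * (t : ℂ)) := by
    intro n
    induction n with
    | zero => simp
    | succ n ih =>
      rw [iteratedDeriv_succ, ih]
      funext t
      have h : HasDerivAt (fun t : ℝ => Complex.I * (t : ℂ)) (Complex.I * 1) t :=
        (Complex.ofRealCLM.hasDerivAt).const_mul Complex.I
      have h2 := (h.cexp).const_mul (Complex.I ^ n)
      rw [h2.deriv]
      ring
  have smooth : ContDiff ℝ ∞ (fun t : ℝ => Complex.exp (Complex.I * (t : ℂ))) :=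
    (contDiff_const.mul Complex.ofRealCLM.contDiff).cexp
  refine ⟨smooth, fun n => ⟨0, 1, fun t => ?_⟩⟩
  rw [norm_iteratedFDeriv_eq_norm_iteratedDeriv, key]
  simp [Complex.norm_exp]

theorem hasTemperateGrowth_modulation {d : ℕ} (ζ : Rn d × Rn d) :
    (fun y : Rn d × Rn d => Complex.exp (Complex.I * (dot y ζ : ℂ))).HasTemperateGrowth := by
  have h : (fun y : Rn d × Rn d => dot y ζ).HasTemperateGrowth := by
    have e : (fun y : Rn d × Rn d => dot y ζ) =
        ((innerSL ℝ ζ.1).comp (ContinuousLinearMap.fst ℝ (Rn d) (Rn d)) +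
          (innerSL ℝ ζ.2).comp (ContinuousLinearMap.snd ℝ (Rn d) (Rn d)) :
            Rn d × Rn d →L[ℝ] ℝ) := by
      funext y
      simp [dot, real_inner_comm]
    rw [e]
    exact ContinuousLinearMap.hasTemperateGrowth _
  exact hasTemperateGrowth_expI.comp h

/-- The values of `conj (T_z M_ζ g)`. -/
theorem conjugate_translate_modulate_apply {d : ℕ} (z ζ y : Rn d × Rn d)
    (g : 𝓢(Rn d × Rn d, ℂ)) :
    conjugate (translate z (modulate ζ g)) y =
      (starRingEnd ℂ) (Complex.exp (Complex.I * (dot (y - z) ζ : ℂ)) * g (y - z)) := by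
  simp [conjugate, translate, modulate, hasTemperateGrowth_modulation]

end Shubin

/-! Everything is transported from the kernel `K` to its Weyl symbol. The map `W = weylMap d`, a
linear change of variables followed by a partial Fourier transform, is a bijection of Schwartz
space, continuous in both directions. Let `A = weylSymbol K`, so that `A (W φ) = (2π)^d K φ`. Then
`K` is the kernel of `a` exactly when `A` is integration against `a` (`isWeylKernel_iff`).

Under `W` the conjugated time-frequency shifts of `g` become, up to the phase `e^{i⟨Q₂, V₂⟩}`, the
shifts `T_Q M_V H` of the window `H = W (conj g)`. Here `Q = ((z₁ + z₂)/2, (ζ₁ - ζ₂)/2)` and `V =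
(-(ζ₁ + ζ₂), z₁ - z₂)` (`weylMap_conjugate`). The phase correction in `fbiDelta` cancels precisely
that phase. Hence the kernel estimates say that `F(Q, V) = A(T_Q M_V H)` satisfies `|∂_Q^γ F| ≤ C
⟨Q⟩^(m - ρ|γ|) ⟨V⟩^(-N)` (`kernelEstimates_iff`).

If `A` is integration against a symbol `a`, then `F(Q, V) = ∫ e^{i⟨R, V⟩} a(Q + R) H(R) dR`.
Derivatives in `Q` fall on `a`, Peetre's inequality moves the weight from `Q + R` to `Q`, and
integration by parts in `R` gives any decay in `V` (`stftEstimates_of_isShubinSymbol`).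

Conversely, with `c = (2π)^(2d) ∫ |H|²`, the symbol is recovered by the inversion formula `a(q) =
c⁻¹ ∬ F(q - R, V) e^{-i⟨R, V⟩} conj H(R) dV dR`. Its derivatives fall on `F`, so the estimates with
`N = 2d + 1` put `a` in the Shubin class. That `a` represents `A` is checked against a test function
`φ`: for fixed `V` a symmetry of correlations replaces translates of `M_V H` by translates of `φ`
inside `A` (`integral_correlation_mul_apply`), and the remaining `V`-integral is Fourier inversion
at the origin (`integral_symbol_mul`). The analytic input is that a tempered distribution commutes
with absolutely convergent integrals of Schwartz functions
(`IntegrableFamily.integral_apply_eq_zero`). -/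

set_option maxSynthPendingDepth 3


namespace Shubin

open MeasureTheory

/-! ### Tempered distributions and integrals of Schwartz functions. -/

section Exchange

variable {E : Type*} [NormedAddCommGroup E] [NormedSpace ℝ E]

/-- The weighted `n`-th derivative `y ↦ ‖y‖ ^ k • D ^ n φ y` of a Schwartz function, as a bounded
continuous function. -/
noncomputable def jetCLM (k n : ℕ) :
    𝓢(E, ℂ) →L[ℂ] BoundedContinuousFunction E (E [×n]→L[ℝ] ℂ) :=
  SchwartzMap.mkCLMtoNormedSpace (σ := RingHom.id ℂ)
    (fun φ => BoundedContinuousFunction.ofNormedAddCommGroup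
      (fun y => (‖y‖ ^ k) • iteratedFDeriv ℝ n φ y)
      ((continuous_norm.pow k).smul ((φ.smooth ⊤).continuous_iteratedFDeriv
        (by exact_mod_cast le_top)))
      (SchwartzMap.seminorm ℂ k n φ) (fun y => by
        rw [norm_smul, norm_pow, norm_norm]
        exact SchwartzMap.le_seminorm ℂ k n φ y))
    (fun f g => by
      ext1 y
      simp only [BoundedContinuousFunction.coe_ofNormedAddCommGroup,
        BoundedContinuousFunction.coe_add, Pi.add_apply]
      rw [← smul_add, ← iteratedFDeriv_add_apply (f.smooth n).contDiffAt (g.smooth n).contDiffAt]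
      rfl)
    (fun a f => by
      ext1 y
      simp only [BoundedContinuousFunction.coe_ofNormedAddCommGroup,
        BoundedContinuousFunction.coe_smul, RingHom.id_apply]
      rw [smul_comm, ← iteratedFDeriv_const_smul_apply (f.smooth n).contDiffAt]
      rfl)
    ⟨{(k, n)}, 1, zero_le_one, fun f => by
      simp only [Finset.sup_singleton, SchwartzMap.schwartzSeminormFamily_apply, one_mul]
      exact BoundedContinuousFunction.norm_ofNormedAddCommGroup_le _ (apply_nonneg _ _) _⟩

theorem jetCLM_apply (k n : ℕ) (φ : 𝓢(E, ℂ)) (y : E) :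
    jetCLM k n φ y = (‖y‖ ^ k) • iteratedFDeriv ℝ n φ y := rfl

theorem norm_jetCLM_le (k n : ℕ) (φ : 𝓢(E, ℂ)) :
    ‖jetCLM k n φ‖ ≤ SchwartzMap.seminorm ℂ k n φ :=
  BoundedContinuousFunction.norm_ofNormedAddCommGroup_le _ (apply_nonneg _ _) fun y => by
    rw [norm_smul, norm_pow, norm_norm]
    exact SchwartzMap.le_seminorm ℂ k n φ y

theorem seminorm_le_norm_jetCLM (k n : ℕ) (φ : 𝓢(E, ℂ)) :
    SchwartzMap.seminorm ℂ k n φ ≤ ‖jetCLM k n φ‖ := by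
  refine SchwartzMap.seminorm_le_bound ℂ k n φ (norm_nonneg _) fun y => ?_
  have := (jetCLM k n φ).norm_coe_le_norm y
  rwa [jetCLM_apply, norm_smul, norm_pow, norm_norm] at this

/-- A continuous functional on Schwartz space is controlled by finitely many jets. -/
theorem exists_jet_factorization (A : 𝓢(E, ℂ) →L[ℂ] ℂ) :
    ∃ (s : Finset (ℕ × ℕ))
      (L : (∀ i : s, BoundedContinuousFunction E (E [×i.1.2]→L[ℝ] ℂ)) →L[ℂ] ℂ),
      ∀ φ, A φ = L (fun i => jetCLM i.1.1 i.1.2 φ) := by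
  obtain ⟨s, C, -, hC⟩ := Seminorm.bound_of_continuous (schwartz_withSeminorms ℂ E ℂ)
    (A.toSeminorm) A.continuous.norm
  let J : 𝓢(E, ℂ) →ₗ[ℂ] (∀ i : s, BoundedContinuousFunction E (E [×i.1.2]→L[ℝ] ℂ)) :=
    LinearMap.pi fun i => (jetCLM i.1.1 i.1.2).toLinearMap
  have hJ : ∀ φ, ‖A φ‖ ≤ C * ‖J φ‖ := by
    intro φ
    refine (hC φ).trans ?_
    change (C : ℝ) * (s.sup (schwartzSeminormFamily ℂ E ℂ)) φ ≤ _
    refine mul_le_mul_of_nonneg_left ?_ C.2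
    refine Seminorm.finset_sup_apply_le (norm_nonneg _) fun i hi => ?_
    exact (seminorm_le_norm_jetCLM i.1 i.2 φ).trans (norm_le_pi_norm (J φ) ⟨i, hi⟩)
  -- The bound `hJ` lets `A` descend to a bounded functional on the range of `J`, and Hahn–Banach
  -- extends it to the whole product of Banach spaces, where the Bochner integral is available.
  have hker : LinearMap.ker J ≤ LinearMap.ker A.toLinearMap := by
    intro φ hφ
    have h := hJ φ
    rw [LinearMap.mem_ker.1 hφ, norm_zero, mul_zero] at h
    exact norm_le_zero_iff.1 h
  let f₀ : LinearMap.range J →ₗ[ℂ] ℂ :=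
    ((LinearMap.ker J).liftQ A.toLinearMap hker).comp J.quotKerEquivRange.symm.toLinearMap
  have hf₀ : ∀ φ (h : J φ ∈ LinearMap.range J), f₀ ⟨J φ, h⟩ = A φ := by
    intro φ h
    simp [f₀, LinearMap.quotKerEquivRange_symm_apply_image]
  let f : LinearMap.range J →L[ℂ] ℂ := f₀.mkContinuous C (by
    rintro ⟨_, φ, rfl⟩
    exact (congrArg norm (hf₀ φ ⟨φ, rfl⟩)).trans_le (hJ φ))
  obtain ⟨L, hL, -⟩ := exists_extension_norm_eq (LinearMap.range J) f
  refine ⟨s, L, fun φ => ?_⟩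
  exact ((hL ⟨J φ, φ, rfl⟩).trans (hf₀ φ ⟨φ, rfl⟩)).symm

variable {X : Type*} [TopologicalSpace X] [SecondCountableTopology X] [MeasurableSpace X]
  [OpensMeasurableSpace X] {μ : Measure X}

/-- A family of Schwartz functions that depends continuously on a parameter and has integrable
seminorms. -/
structure IntegrableFamily (Φ : X → 𝓢(E, ℂ)) (μ : Measure X) : Prop where
  cont : Continuous Φ
  bound : ∀ k n : ℕ, ∃ g : X → ℝ, Integrable g μ ∧ ∀ x, SchwartzMap.seminorm ℂ k n (Φ x) ≤ g x

theorem IntegrableFamily.integrable_jet {Φ : X → 𝓢(E, ℂ)} (h : IntegrableFamily Φ μ) (k n : ℕ) :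
    Integrable (fun x => jetCLM k n (Φ x)) μ := by
  obtain ⟨g, hg, hΦ⟩ := h.bound k n
  refine hg.mono' ((jetCLM k n).continuous.comp h.cont).aestronglyMeasurable
    (Filter.Eventually.of_forall fun x => (norm_jetCLM_le k n _).trans (hΦ x))

theorem IntegrableFamily.integrable_iteratedFDeriv {Φ : X → 𝓢(E, ℂ)} (h : IntegrableFamily Φ μ)
    (n : ℕ) (y : E) : Integrable (fun x => iteratedFDeriv ℝ n (Φ x) y) μ := by
  have := ((BoundedContinuousFunction.evalCLM ℝ y).integrable_comp (h.integrable_jet 0 n))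
  simpa [jetCLM_apply] using this

/-- The vanishing integral may be differentiated in `y` under the integral sign, the next seminorm
being the majorant; the derivative of the zero function is zero. -/
theorem IntegrableFamily.integral_iteratedFDeriv_eq_zero {Φ : X → 𝓢(E, ℂ)}
    (h : IntegrableFamily Φ μ) (h0 : ∀ y, ∫ x, Φ x y ∂μ = 0) (n : ℕ) (y : E) :
    ∫ x, iteratedFDeriv ℝ n (Φ x) y ∂μ = 0 := by
  induction n generalizing y with
  | zero =>
    have := (continuousMultilinearCurryFin0 ℝ E ℂ).symm.toContinuousLinearEquiv.integral_comp_comm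
      (μ := μ) (fun x => Φ x y)
    rw [h0, map_zero] at this
    simpa [iteratedFDeriv_zero_eq_comp, Function.comp_def] using this
  | succ n ih =>
    obtain ⟨g, hg, hΦ⟩ := h.bound 0 (n + 1)
    let c := (continuousMultilinearCurryLeftEquiv ℝ (fun _ : Fin (n + 1) => E) ℂ)
    have hc : ∀ x z, fderiv ℝ (iteratedFDeriv ℝ n (Φ x)) z =
        c (iteratedFDeriv ℝ (n + 1) (Φ x) z) := fun x z => by
      rw [fderiv_iteratedFDeriv]; rfl
    have hint : ∀ z, Integrable (fun x => fderiv ℝ (iteratedFDeriv ℝ n (Φ x)) z) μ := fun z => by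
      simp_rw [hc]
      exact c.toContinuousLinearEquiv.toContinuousLinearMap.integrable_comp
        (h.integrable_iteratedFDeriv (n + 1) z)
    have key := hasFDerivAt_integral_of_dominated_of_fderiv_le (𝕜 := ℝ) (μ := μ) (s := Set.univ)
      (F := fun z x => iteratedFDeriv ℝ n (Φ x) z) (x₀ := y) (bound := g)
      (F' := fun z x => fderiv ℝ (iteratedFDeriv ℝ n (Φ x)) z) Filter.univ_mem
      (Filter.Eventually.of_forall fun z => (h.integrable_iteratedFDeriv n z).1)
      (h.integrable_iteratedFDeriv n y) (hint y).1
      (Filter.Eventually.of_forall fun x z _ => by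
        rw [hc, LinearIsometryEquiv.norm_map]
        exact (SchwartzMap.norm_iteratedFDeriv_le_seminorm ℂ (Φ x) (n + 1) z).trans (hΦ x)) hg
      (Filter.Eventually.of_forall fun x z _ => by
        exact ((((Φ x).smooth ⊤).differentiable_iteratedFDeriv
          (by exact_mod_cast WithTop.coe_lt_top _)) z).hasFDerivAt)
    simp_rw [ih] at key
    have h1 := key.unique (hasFDerivAt_const 0 y)
    simp_rw [hc] at h1
    have h2 := c.toContinuousLinearEquiv.integral_comp_comm (μ := μ)
      (fun x => iteratedFDeriv ℝ (n + 1) (Φ x) y)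
    have h3 : c (∫ x, iteratedFDeriv ℝ (n + 1) (Φ x) y ∂μ) = 0 := h2.symm.trans h1
    simpa using h3

theorem IntegrableFamily.integrable_apply {Φ : X → 𝓢(E, ℂ)} (h : IntegrableFamily Φ μ)
    (A : 𝓢(E, ℂ) →L[ℂ] ℂ) : Integrable (fun x => A (Φ x)) μ := by
  obtain ⟨s, L, hL⟩ := exists_jet_factorization A
  simp_rw [hL]
  exact L.integrable_comp (Integrable.of_eval fun i => h.integrable_jet i.1.1 i.1.2)

/-- If all pointwise integrals of an integrable family of Schwartz functions vanish, then so does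
the integral of its image under any tempered distribution. -/
theorem IntegrableFamily.integral_apply_eq_zero {Φ : X → 𝓢(E, ℂ)} (h : IntegrableFamily Φ μ)
    (h0 : ∀ y, ∫ x, Φ x y ∂μ = 0) (A : 𝓢(E, ℂ) →L[ℂ] ℂ) : ∫ x, A (Φ x) ∂μ = 0 := by
  obtain ⟨s, L, hL⟩ := exists_jet_factorization A
  simp_rw [hL]
  have hint : Integrable (fun x (i : s) => jetCLM i.1.1 i.1.2 (Φ x)) μ :=
    Integrable.of_eval fun i => h.integrable_jet i.1.1 i.1.2
  rw [L.integral_comp_comm hint]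
  -- It is enough that the integral of jets vanishes, which is tested componentwise and pointwise.
  -- No Schwartz-valued integral is needed; equalities of integrals follow by applying the result to
  -- a difference of families.
  suffices ∫ x, (fun i : s => jetCLM i.1.1 i.1.2 (Φ x)) ∂μ = 0 by rw [this, map_zero]
  funext i
  rw [eval_integral (f := fun x (i : s) => jetCLM i.1.1 i.1.2 (Φ x))
    (fun i => h.integrable_jet i.1.1 i.1.2)]
  ext1 y
  have h1 := (BoundedContinuousFunction.evalCLM (β := E [×i.1.2]→L[ℝ] ℂ) ℝ y).integral_comp_comm
    (h.integrable_jet i.1.1 i.1.2)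
  refine h1.symm.trans ?_
  simp only [BoundedContinuousFunction.evalCLM_apply, jetCLM_apply]
  rw [integral_smul, h.integral_iteratedFDeriv_eq_zero h0, smul_zero]
  rfl

end Exchange

end Shubin

namespace Shubin

open MeasureTheory

/-! ### Smoothness from directional derivatives. -/

section Smoothness

variable {E : Type*} [NormedAddCommGroup E] [NormedSpace ℝ E]
  {G : Type*} [NormedAddCommGroup G] [NormedSpace ℝ G]

/-- A function whose directional derivatives are given by a continuous field of linear maps is
Fréchet differentiable. -/
theorem hasFDerivAt_of_hasLineDerivAt {f : E → G} {f' : E → E →L[ℝ] G} (hf' : Continuous f')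
    (h : ∀ x v, HasLineDerivAt ℝ f (f' x v) x v) (x : E) : HasFDerivAt f (f' x) x := by
  rw [hasFDerivAt_iff_isLittleO_nhds_zero, Asymptotics.isLittleO_iff]
  intro ε hε
  obtain ⟨δ, hδ, hb⟩ := Metric.continuousAt_iff.1 hf'.continuousAt ε hε
  filter_upwards [Metric.ball_mem_nhds (0 : E) hδ] with v hv
  rw [mem_ball_zero_iff] at hv
  have hd : ∀ t : ℝ, HasDerivAt (fun t : ℝ => f (x + t • v) - t • f' x v)
      (f' (x + t • v) v - f' x v) t := fun t => by
    have h1 : HasDerivAt (fun s : ℝ => f (x + t • v + s • v)) (f' (x + t • v) v) (t - t) := by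
      rw [sub_self]; exact h (x + t • v) v
    have h2 := h1.comp_sub_const t t
    have h3 : (fun s : ℝ => f (x + t • v + (s - t) • v)) = fun s => f (x + s • v) := by
      funext s; congr 1; module
    rw [h3] at h2
    exact h2.sub (by simpa using (hasDerivAt_id t).smul_const (f' x v))
  -- Mean value inequality on `[0, 1]` for `t ↦ f (x + t v) - t f' x v`, whose derivative is at most
  -- `ε ‖v‖` by continuity of `f'` at `x`.
  have key := norm_image_sub_le_of_norm_deriv_le_segment_01'
    (fun t _ => (hd t).hasDerivWithinAt) (C := ε * ‖v‖) (fun t ht => by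
      rw [← sub_apply]
      refine (ContinuousLinearMap.le_opNorm _ _).trans ?_
      gcongr
      rw [← dist_eq_norm]
      refine (hb ?_).le
      rw [dist_eq_norm, add_sub_cancel_left, norm_smul, Real.norm_of_nonneg ht.1]
      nlinarith [norm_nonneg v, ht.2])
  convert key using 2
  simp
  abel

/-- The family is closed under differentiation, so the induction on the order runs over all words at
once: if every `a (j :: w)` is `C^n`, then so is the derivative of `a w`. -/
theorem contDiff_of_hasLineDerivAt [FiniteDimensional ℝ E] {ι : Type*} [Fintype ι]
    (b : Module.Basis ι ℝ E) (a : List ι → E → G) (hc : ∀ w, Continuous (a w))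
    (hd : ∀ w x v, HasLineDerivAt ℝ (a w) (∑ j, b.repr v j • a (j :: w) x) x v) (w : List ι) :
    ContDiff ℝ ∞ (a w) := by
  rw [contDiff_infty]
  intro n
  induction n generalizing w with
  | zero => exact contDiff_zero.2 (hc w)
  | succ n ih =>
    let f' : E → E →L[ℝ] G := fun x =>
      ∑ j, (LinearMap.toContinuousLinearMap (b.coord j)).smulRight (a (j :: w) x)
    have hf'n : ContDiff ℝ n f' := ContDiff.sum fun j _ =>
      (ContinuousLinearMap.smulRightL ℝ E G
        (LinearMap.toContinuousLinearMap (b.coord j))).contDiff.comp (ih (j :: w))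
    have := contDiff_succ_iff_hasFDerivAt (𝕜 := ℝ) (n := n) (f := a w)
    push_cast
    refine contDiff_succ_iff_hasFDerivAt.2 ⟨f', hf'n, ?_⟩
    refine hasFDerivAt_of_hasLineDerivAt hf'n.continuous fun x v => ?_
    convert hd w x v using 1
    simp [f']

end Smoothness

/-! ### Translations on Schwartz space. -/

section Translation

variable {E : Type*} [NormedAddCommGroup E] [NormedSpace ℝ E]

theorem iteratedFDeriv_compSubConstCLM (φ : 𝓢(E, ℂ)) (n : ℕ) (x y : E) :
    iteratedFDeriv ℝ n (SchwartzMap.compSubConstCLM ℂ x φ) y = iteratedFDeriv ℝ n φ (y - x) := by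
  rw [← iteratedFDeriv_comp_sub]
  rfl

/-- The seminorm of Schwartz functions that controls `(1 + ‖y‖) ^ k * ‖D ^ n φ y‖`. -/
noncomputable def weightedSeminorm (k n : ℕ) (φ : 𝓢(E, ℂ)) : ℝ :=
  2 ^ k * ((Finset.Iic (k, n)).sup fun m => SchwartzMap.seminorm ℂ m.1 m.2) φ

theorem weightedSeminorm_nonneg (k n : ℕ) (φ : 𝓢(E, ℂ)) : 0 ≤ weightedSeminorm k n φ := by
  unfold weightedSeminorm
  positivity

theorem one_add_norm_pow_mul_le (k n : ℕ) (φ : 𝓢(E, ℂ)) (y : E) :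
    (1 + ‖y‖) ^ k * ‖iteratedFDeriv ℝ n φ y‖ ≤ weightedSeminorm k n φ :=
  SchwartzMap.one_add_le_sup_seminorm_apply (𝕜 := ℂ) (m := (k, n)) le_rfl le_rfl φ y

theorem norm_le_one_add_mul {E : Type*} [NormedAddCommGroup E] (x y z : E) (h : ‖y - z‖ ≤ ‖x‖) : ‖y‖ ≤ (1 + ‖x‖) * (1 + ‖z‖) := by
  have := norm_add_le (y - z) z
  rw [sub_add_cancel] at this
  nlinarith [norm_nonneg x, norm_nonneg z]

/-- Translation costs only polynomial growth in `x`, which rapidly decaying coefficients absorb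
later. -/
theorem seminorm_compSubConstCLM_le (k n : ℕ) (φ : 𝓢(E, ℂ)) (x : E) :
    SchwartzMap.seminorm ℂ k n (SchwartzMap.compSubConstCLM ℂ x φ) ≤
      (1 + ‖x‖) ^ k * weightedSeminorm k n φ := by
  refine SchwartzMap.seminorm_le_bound ℂ k n _
    (mul_nonneg (by positivity) (weightedSeminorm_nonneg _ _ _)) fun y => ?_
  rw [iteratedFDeriv_compSubConstCLM]
  calc ‖y‖ ^ k * ‖iteratedFDeriv ℝ n φ (y - x)‖
      ≤ ((1 + ‖x‖) * (1 + ‖y - x‖)) ^ k * ‖iteratedFDeriv ℝ n φ (y - x)‖ := by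
        gcongr
        exact norm_le_one_add_mul x y (y - x) (by simp)
    _ = (1 + ‖x‖) ^ k * ((1 + ‖y - x‖) ^ k * ‖iteratedFDeriv ℝ n φ (y - x)‖) := by
        rw [mul_pow, mul_assoc]
    _ ≤ _ := by
        gcongr
        exact one_add_norm_pow_mul_le k n φ _

theorem seminorm_compSubConstCLM_sub_le (k n : ℕ) (φ : 𝓢(E, ℂ)) (x : E) :
    SchwartzMap.seminorm ℂ k n (SchwartzMap.compSubConstCLM ℂ x φ - φ) ≤
      (1 + ‖x‖) ^ k * weightedSeminorm k (n + 1) φ * ‖x‖ := by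
  refine SchwartzMap.seminorm_le_bound ℂ k n _
    (mul_nonneg (mul_nonneg (by positivity) (weightedSeminorm_nonneg _ _ _)) (norm_nonneg _))
    fun y => ?_
  have h1 : iteratedFDeriv ℝ n (SchwartzMap.compSubConstCLM ℂ x φ - φ) y =
      iteratedFDeriv ℝ n φ (y - x) - iteratedFDeriv ℝ n φ y := by
    rw [← iteratedFDeriv_compSubConstCLM,
      ← iteratedFDeriv_sub_apply ((SchwartzMap.compSubConstCLM ℂ x φ).smooth n).contDiffAt
        (φ.smooth n).contDiffAt]
    rfl
  have h2 : ‖y‖ ^ k * ‖iteratedFDeriv ℝ n φ (y - x) - iteratedFDeriv ℝ n φ y‖ =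
      ‖(‖y‖ ^ k) • iteratedFDeriv ℝ n φ (y - x) - (‖y‖ ^ k) • iteratedFDeriv ℝ n φ y‖ := by
    rw [← smul_sub, norm_smul, norm_pow, norm_norm]
  have hdiff : Differentiable ℝ (iteratedFDeriv ℝ n φ) :=
    (φ.smooth ⊤).differentiable_iteratedFDeriv (by exact_mod_cast WithTop.coe_lt_top _)
  rw [h1, h2]
  -- Mean value inequality along the segment from `y` to `y - x`. Its points stay within `‖x‖` of
  -- `y`, so the weight `‖y‖ ^ k` is comparable with the weight at the intermediate point.
  have key := (convex_segment (𝕜 := ℝ) y (y - x)).norm_image_sub_le_of_norm_hasFDerivWithin_le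
    (f := fun z => (‖y‖ ^ k) • iteratedFDeriv ℝ n φ z)
    (f' := fun z => (‖y‖ ^ k) • fderiv ℝ (iteratedFDeriv ℝ n φ) z)
    (C := (1 + ‖x‖) ^ k * weightedSeminorm k (n + 1) φ)
    (fun z _ => ((hdiff z).hasFDerivAt.fun_const_smul _).hasFDerivWithinAt)
    (fun z hz => ?_) (left_mem_segment ℝ y (y - x)) (right_mem_segment ℝ y (y - x))
  · simpa using key
  · rw [norm_smul, norm_pow, norm_norm, norm_fderiv_iteratedFDeriv]
    have hz' : ‖y - z‖ ≤ ‖x‖ := by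
      rw [segment_eq_image'] at hz
      obtain ⟨θ, hθ, rfl⟩ := hz
      have : y - (y + θ • (y - x - y)) = θ • x := by module
      simp only [this, norm_smul, Real.norm_of_nonneg hθ.1]
      nlinarith [norm_nonneg x, hθ.2]
    calc ‖y‖ ^ k * ‖iteratedFDeriv ℝ (n + 1) φ z‖
        ≤ ((1 + ‖x‖) * (1 + ‖z‖)) ^ k * ‖iteratedFDeriv ℝ (n + 1) φ z‖ := by
          gcongr
          exact norm_le_one_add_mul x y z hz'
      _ = (1 + ‖x‖) ^ k * ((1 + ‖z‖) ^ k * ‖iteratedFDeriv ℝ (n + 1) φ z‖) := by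
          rw [mul_pow, mul_assoc]
      _ ≤ _ := by
          gcongr
          exact one_add_norm_pow_mul_le k (n + 1) φ _

theorem continuous_compSubConstCLM (φ : 𝓢(E, ℂ)) :
    Continuous fun x => SchwartzMap.compSubConstCLM ℂ x φ := by
  have h0 : Filter.Tendsto (fun x => SchwartzMap.compSubConstCLM ℂ x φ) (nhds 0) (nhds φ) := by
    rw [(schwartz_withSeminorms ℂ E ℂ).tendsto_nhds]
    rintro ⟨k, n⟩ ε hε
    have hc : Filter.Tendsto
        (fun x : E => (1 + ‖x‖) ^ k * weightedSeminorm k (n + 1) φ * ‖x‖) (nhds 0) (nhds 0) := by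
      have : Continuous fun x : E => (1 + ‖x‖) ^ k * weightedSeminorm k (n + 1) φ * ‖x‖ := by
        fun_prop
      simpa using this.tendsto 0
    filter_upwards [hc.eventually (gt_mem_nhds hε)] with x hx
    exact (seminorm_compSubConstCLM_sub_le k n φ x).trans_lt hx
  rw [continuous_iff_continuousAt]
  intro x₀
  have h1 : (fun x => SchwartzMap.compSubConstCLM ℂ x φ) =
      fun x => SchwartzMap.compSubConstCLM ℂ x₀ (SchwartzMap.compSubConstCLM ℂ (x - x₀) φ) := by
    funext x
    ext y
    simp only [SchwartzMap.compSubConstCLM_apply]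
    congr 1
    abel
  have h2 : Filter.Tendsto (fun x => x - x₀) (nhds x₀) (nhds 0) := by
    simpa using (continuous_id.sub continuous_const).tendsto (f := fun x => x - x₀) x₀
  have h3 := ((SchwartzMap.compSubConstCLM ℂ x₀).continuous.tendsto φ).comp (h0.comp h2)
  unfold ContinuousAt
  rw [h1]
  simpa [Function.comp_def] using h3

open scoped LineDeriv

/-- By the fundamental theorem of calculus, with `A` taken inside the integral, the difference
quotient is the average over `s ∈ [0, 1]` of a continuous function of `s t`; it converges as `t →
0`. -/
theorem hasLineDerivAt_apply_compSubConstCLM (A : 𝓢(E, ℂ) →L[ℂ] ℂ) (φ : 𝓢(E, ℂ)) (x h : E) :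
    HasLineDerivAt ℝ (fun x => A (SchwartzMap.compSubConstCLM ℂ x φ))
      (A (SchwartzMap.compSubConstCLM ℂ x (-∂_{h} φ))) x h := by
  set ψ : 𝓢(E, ℂ) := -∂_{h} φ with hψ
  have hcont : ∀ χ : 𝓢(E, ℂ), Continuous fun z => A (SchwartzMap.compSubConstCLM ℂ z χ) :=
    fun χ => A.continuous.comp (continuous_compSubConstCLM χ)
  have key : ∀ t : ℝ, A (SchwartzMap.compSubConstCLM ℂ (x + t • h) φ) -
      A (SchwartzMap.compSubConstCLM ℂ x φ) =
      t • ∫ s in (0 : ℝ)..1, A (SchwartzMap.compSubConstCLM ℂ (x + (s * t) • h) ψ) := by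
    intro t
    let c : 𝓢(E, ℂ) := SchwartzMap.compSubConstCLM ℂ (x + t • h) φ -
      SchwartzMap.compSubConstCLM ℂ x φ
    -- The difference of the two sides of the fundamental theorem, as a family in `s`: its pointwise
    -- integrals over `(0, 1]` vanish, so the exchange principle applies.
    let Φ : ℝ → 𝓢(E, ℂ) := fun s =>
      c - (t : ℂ) • SchwartzMap.compSubConstCLM ℂ (x + (s * t) • h) ψ
    have hΦ : IntegrableFamily Φ (volume.restrict (Set.Ioc (0 : ℝ) 1)) := by
      have hc : Continuous fun s : ℝ => SchwartzMap.compSubConstCLM ℂ (x + (s * t) • h) ψ :=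
        (continuous_compSubConstCLM ψ).comp
          (by fun_prop : Continuous fun s : ℝ => x + (s * t) • h)
      refine ⟨continuous_const.sub (hc.fun_const_smul _), fun k n => ?_⟩
      refine ⟨fun s => SchwartzMap.seminorm ℂ k n c + |t| *
        ((1 + ‖x + (s * t) • h‖) ^ k * weightedSeminorm k n ψ), ?_, fun s => ?_⟩
      · exact Continuous.integrableOn_Ioc (by fun_prop)
      · refine (map_sub_le_add _ _ _).trans ?_
        rw [map_smul_eq_mul]
        simp only [Complex.norm_real, Real.norm_eq_abs]
        gcongr
        exact seminorm_compSubConstCLM_le k n ψ _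
    have h0 : ∀ y, ∫ s in Set.Ioc (0 : ℝ) 1, Φ s y = 0 := by
      intro y
      rw [← intervalIntegral.integral_of_le zero_le_one]
      have hd : ∀ s ∈ Set.uIcc (0 : ℝ) 1, HasDerivAt
          (fun s : ℝ => s • c y - φ (y - (x + (s * t) • h))) (Φ s y) s := by
        intro s _
        have e1 : HasDerivAt (fun s : ℝ => y - (x + (s * t) • h)) (-(t • h)) s := by
          have e0 : HasDerivAt (fun s : ℝ => (s * t) • h) (t • h) s := by
            simpa using ((hasDerivAt_id s).mul_const t).smul_const h
          simpa using (e0.const_add x).const_sub y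
        have e2 := (SchwartzMap.hasFDerivAt φ (y - (x + (s * t) • h))).comp_hasDerivAt s e1
        have e3 : HasDerivAt (fun s : ℝ => s • c y) (c y) s := by
          simpa using (hasDerivAt_id s).smul_const (c y)
        have e4 : Φ s y = c y - fderiv ℝ φ (y - (x + (s * t) • h)) (-(t • h)) := by
          change c y - (t : ℂ) • -(∂_{h} φ (y - (x + (s * t) • h))) = _
          simp [SchwartzMap.lineDerivOp_apply_eq_fderiv]
        rw [e4]
        exact e3.sub e2
      rw [intervalIntegral.integral_eq_sub_of_hasDerivAt hd]
      · have hc : c y = φ (y - (x + t • h)) - φ (y - x) := rfl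
        simp [hc]
      · have hc : Continuous fun s : ℝ => c y - (t : ℂ) • ψ (y - (x + (s * t) • h)) := by
          fun_prop
        exact hc.intervalIntegrable _ _
    have h1 := hΦ.integral_apply_eq_zero h0 A
    simp only [Φ, map_sub, map_smul, c] at h1
    rw [← intervalIntegral.integral_of_le zero_le_one, intervalIntegral.integral_sub,
      intervalIntegral.integral_const, intervalIntegral.integral_smul, sub_zero, one_smul,
      sub_eq_zero] at h1
    · rw [h1]; simp
    · exact intervalIntegrable_const
    · exact (((hcont ψ).comp (by fun_prop : Continuous fun s : ℝ => x + (s * t) • h)).const_smul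
        (t : ℂ)).intervalIntegrable _ _
  have hG : Continuous fun t : ℝ =>
      ∫ s in (0 : ℝ)..1, A (SchwartzMap.compSubConstCLM ℂ (x + (s * t) • h) ψ) := by
    apply intervalIntegral.continuous_parametric_intervalIntegral_of_continuous'
    exact (hcont ψ).comp (by fun_prop : Continuous fun p : ℝ × ℝ => x + (p.2 * p.1) • h)
  rw [hasLineDerivAt_iff_tendsto_slope_zero]
  have hlim := hG.tendsto 0
  simp only [mul_zero, zero_smul, add_zero, intervalIntegral.integral_const, sub_zero,
    one_smul] at hlim
  refine (hlim.mono_left nhdsWithin_le_nhds).congr' ?_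
  filter_upwards [self_mem_nhdsWithin] with t ht
  rw [key, smul_smul, inv_mul_cancel₀ ht, one_smul]

/-- Iterated negative directional derivatives of a Schwartz function along a word. -/
noncomputable def wordDeriv {ι : Type*} (v : ι → E) (w : List ι) (φ : 𝓢(E, ℂ)) : 𝓢(E, ℂ) :=
  w.foldr (fun j ψ => -∂_{v j} ψ) φ

theorem lineDerivOp_eq_sum_repr {ι : Type*} [Fintype ι] (b : Module.Basis ι ℝ E) (φ : 𝓢(E, ℂ))
    (h : E) : ∂_{h} φ = ∑ j, b.repr h j • ∂_{b j} φ := by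
  ext y
  simp only [SchwartzMap.lineDerivOp_apply_eq_fderiv, sum_apply,
    smul_apply]
  conv_lhs => rw [← b.sum_repr h, map_sum]
  simp only [map_smul]

theorem contDiff_apply_compSubConstCLM [FiniteDimensional ℝ E] (A : 𝓢(E, ℂ) →L[ℂ] ℂ)
    (φ : 𝓢(E, ℂ)) : ContDiff ℝ ∞ (fun x => A (SchwartzMap.compSubConstCLM ℂ x φ)) := by
  let b := Module.finBasis ℝ E
  refine contDiff_of_hasLineDerivAt b
    (fun w x => A (SchwartzMap.compSubConstCLM ℂ x (wordDeriv b w φ)))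
    (fun w => A.continuous.comp (continuous_compSubConstCLM _)) (fun w x v => ?_) []
  convert hasLineDerivAt_apply_compSubConstCLM A (wordDeriv b w φ) x v using 1
  rw [lineDerivOp_eq_sum_repr b]
  simp only [wordDeriv, List.foldr_cons, map_neg, map_sum, smul_neg, Finset.sum_neg_distrib]
  congr 1
  refine Finset.sum_congr rfl fun j _ => ?_
  have : ∀ (c : ℝ) (ψ : 𝓢(E, ℂ)), c • ψ = (c : ℂ) • ψ := fun c ψ => by ext; simp
  rw [this, map_smul, map_smul]
  simp

end Translation

end Shubin

namespace Shubin

open MeasureTheory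

/-! ### Fourier inversion and modulations. -/

section Fourier

open scoped FourierTransform

variable {V : Type*} [NormedAddCommGroup V] [InnerProductSpace ℝ V] [FiniteDimensional ℝ V]
  [MeasurableSpace V] [BorelSpace V]

/-- The oscillating exponential `e^{it}`. -/
noncomputable def expI (t : ℝ) : ℂ := Complex.exp (Complex.I * (t : ℂ))

theorem norm_expI (t : ℝ) : ‖expI t‖ = 1 := by
  simp [expI, Complex.norm_exp]

theorem expI_add (s t : ℝ) : expI (s + t) = expI s * expI t := by
  simp [expI, mul_add, Complex.exp_add]

theorem expI_zero : expI 0 = 1 := by simp [expI]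

theorem continuous_expI : Continuous expI := by
  unfold expI
  fun_prop

theorem conj_expI (t : ℝ) : (starRingEnd ℂ) (expI t) = expI (-t) := by
  simp [expI, ← Complex.exp_conj]

theorem fourierChar_eq_expI (t : ℝ) : (Real.fourierChar t : ℂ) = expI (2 * Real.pi * t) := by
  rw [Real.fourierChar_apply, expI]
  congr 1
  push_cast
  ring

theorem fourierInv_eq_integral_expI (f : V → ℂ) (ξ : V) :
    𝓕⁻ f ξ = ∫ x, expI (inner ℝ x ((2 * Real.pi) • ξ)) * f x := by
  rw [Real.fourierInv_eq]
  refine integral_congr_ae (Filter.Eventually.of_forall fun x => ?_)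
  simp only [Circle.smul_def, smul_eq_mul, fourierChar_eq_expI, inner_smul_right]

theorem fourier_eq_integral_expI (f : V → ℂ) (ξ : V) :
    𝓕 f ξ = ∫ x, expI (-inner ℝ x ((2 * Real.pi) • ξ)) * f x := by
  rw [Real.fourier_eq]
  refine integral_congr_ae (Filter.Eventually.of_forall fun x => ?_)
  simp only [Circle.smul_def, smul_eq_mul, fourierChar_eq_expI, inner_smul_right, mul_neg]

theorem two_pi_pow_ne_zero (n : ℕ) : (((2 * Real.pi) ^ n : ℝ) : ℂ) ≠ 0 := by
  have := Real.pi_pos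
  exact_mod_cast (by positivity : (2 * Real.pi) ^ n ≠ 0)

/-- Fourier inversion with the unnormalized kernel `e^{i⟨x, ξ⟩}`. -/
theorem integral_integral_expI {f : V → ℂ} (hc : Continuous f) (hf : Integrable f)
    (hf' : Integrable fun ξ : V => ∫ x, expI (inner ℝ x ξ) * f x) (y : V) :
    ∫ ξ : V, expI (-inner ℝ y ξ) * ∫ x, expI (inner ℝ x ξ) * f x =
      ((2 * Real.pi) ^ Module.finrank ℝ V : ℝ) * f y := by
  have hpi := Real.pi_pos
  have h2 : (2 * Real.pi) ≠ 0 := by positivity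
  have hinv : 𝓕⁻ f = fun ξ => ∫ x, expI (inner ℝ x ((2 * Real.pi) • ξ)) * f x := by
    funext ξ; exact fourierInv_eq_integral_expI f ξ
  have hint : Integrable (𝓕⁻ f) := by
    rw [hinv]
    exact (integrable_comp_smul_iff volume
      (fun ξ : V => ∫ x, expI (inner ℝ x ξ) * f x) h2).2 hf'
  have hint' : Integrable (𝓕 f) := by
    have h1 := hint.comp_neg
    simp_rw [Real.fourierInv_eq_fourier_neg, neg_neg] at h1
    exact h1
  have h := congrFun (hc.fourier_fourierInv_eq hf hint') y
  rw [fourier_eq_integral_expI, hinv] at h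
  -- Passing from the kernel `e^{2πi⟨x, ξ⟩}` to `e^{i⟨x, ξ⟩}` rescales `ξ` by `2π`; the Jacobian is
  -- the factor in the statement.
  have hs := Measure.integral_comp_smul volume
    (fun ξ : V => expI (-inner ℝ y ξ) * ∫ x, expI (inner ℝ x ξ) * f x) (2 * Real.pi)
  have h3 : ∫ ξ : V, expI (-inner ℝ y ((2 * Real.pi) • ξ)) *
      ∫ x, expI (inner ℝ x ((2 * Real.pi) • ξ)) * f x = f y := by
    rw [← h]
    refine integral_congr_ae (Filter.Eventually.of_forall fun ξ => ?_)
    simp only [inner_smul_right, real_inner_comm]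
  rw [h3, abs_of_pos (by positivity)] at hs
  rw [hs, Complex.real_smul, ← mul_assoc, ← Complex.ofReal_mul, mul_inv_cancel₀ (by positivity)]
  simp

end Fourier

variable {d : ℕ}

theorem finrank_Rn (d : ℕ) : Module.finrank ℝ (Rn d) = d := by simp [Rn]

/-- The identification of `ℝ²ᵈ` with its Euclidean version. -/
noncomputable def toProd (d : ℕ) : WithLp 2 (Rn d × Rn d) ≃L[ℝ] Rn d × Rn d :=
  WithLp.prodContinuousLinearEquiv 2 ℝ (Rn d) (Rn d)

/-- The product `Rn d × Rn d` carries the sup norm, so Fourier analysis on phase space is done on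
its Euclidean version and carried over by this identity. -/
theorem inner_eq_dot (x y : WithLp 2 (Rn d × Rn d)) :
    inner ℝ x y = dot (toProd d x) (toProd d y) := rfl

theorem measurePreserving_toProd (d : ℕ) :
    MeasurePreserving (toProd d) volume volume :=
  WithLp.volume_preserving_ofLp (Rn d) (Rn d)

theorem integral_comp_toProd (f : Rn d × Rn d → ℂ) :
    ∫ x, f (toProd d x) = ∫ x, f x :=
  (measurePreserving_toProd d).integral_comp
    (toProd d).toHomeomorph.measurableEmbedding f

theorem integrable_comp_toProd {f : Rn d × Rn d → ℂ} :
    Integrable (fun x => f (toProd d x)) ↔ Integrable f :=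
  (measurePreserving_toProd d).integrable_comp_emb (toProd d).toHomeomorph.measurableEmbedding

/-- Fourier inversion at the origin of `ℝ²ᵈ`. -/
theorem integral_integral_expI_dot {f : Rn d × Rn d → ℂ} (hc : Continuous f) (hf : Integrable f)
    (hf' : Integrable fun ξ : Rn d × Rn d => ∫ x, expI (dot x ξ) * f x) :
    ∫ ξ : Rn d × Rn d, ∫ x, expI (dot x ξ) * f x = ((2 * Real.pi) ^ (2 * d) : ℝ) * f 0 := by
  have hF : ∀ ξ : WithLp 2 (Rn d × Rn d), (∫ x, expI (inner ℝ x ξ) * f (toProd d x)) =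
      ∫ x, expI (dot x (toProd d ξ)) * f x := fun ξ => by
    simp_rw [inner_eq_dot]
    exact integral_comp_toProd (fun x => expI (dot x (toProd d ξ)) * f x)
  have h := integral_integral_expI (V := WithLp 2 (Rn d × Rn d)) (f := fun x => f (toProd d x))
    (hc.comp (toProd d).continuous) (integrable_comp_toProd.2 hf)
    (by simp_rw [hF]; exact integrable_comp_toProd.2 hf') 0
  simp_rw [hF, inner_zero_left, neg_zero, expI_zero, one_mul] at h
  rw [integral_comp_toProd (fun ξ => ∫ x, expI (dot x ξ) * f x)] at h
  rw [h, (toProd d).toLinearEquiv.finrank_eq, Module.finrank_prod, finrank_Rn, map_zero,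
    ← two_mul d]

-- The Fourier transform turns modulation by `ζ` into translation by `(2π)⁻¹ ζ`, so the claim
-- reduces to continuity of translations.
open scoped FourierTransform in
theorem continuous_apply_modulate (A : 𝓢(Rn d × Rn d, ℂ) →L[ℂ] ℂ) (φ : 𝓢(Rn d × Rn d, ℂ)) :
    Continuous fun ζ => A (modulate ζ φ) := by
  let e := toProd d
  let φ' : 𝓢(WithLp 2 (Rn d × Rn d), ℂ) := SchwartzMap.compCLMOfContinuousLinearEquiv ℂ e φ
  let A' : 𝓢(WithLp 2 (Rn d × Rn d), ℂ) →L[ℂ] ℂ :=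
    (A.comp (SchwartzMap.compCLMOfContinuousLinearEquiv ℂ e.symm)).comp
      (FourierTransform.fourierInvCLM ℂ 𝓢(WithLp 2 (Rn d × Rn d), ℂ))
  have key : ∀ ζ, A (modulate ζ φ) =
      A' (SchwartzMap.compSubConstCLM ℂ ((2 * Real.pi)⁻¹ • e.symm ζ) (𝓕 φ')) := by
    intro ζ
    have h1 : SchwartzMap.compSubConstCLM ℂ ((2 * Real.pi)⁻¹ • e.symm ζ) (𝓕 φ') =
        𝓕 (SchwartzMap.compCLMOfContinuousLinearEquiv ℂ e (modulate ζ φ)) := by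
      ext ξ
      rw [SchwartzMap.compSubConstCLM_apply, SchwartzMap.fourier_coe, SchwartzMap.fourier_coe,
        fourier_eq_integral_expI, fourier_eq_integral_expI]
      refine integral_congr_ae (Filter.Eventually.of_forall fun x => ?_)
      have hpi := Real.pi_pos
      have h2 : modulate ζ φ (e x) = expI (dot (e x) ζ) * φ (e x) := by
        simp [modulate, hasTemperateGrowth_modulation, expI]
      have h3 : dot (e x) ζ = inner ℝ x (e.symm ζ) := by
        rw [inner_eq_dot]
        exact congrArg _ (e.apply_symm_apply ζ).symm
      change _ = _ * modulate ζ φ (e x)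
      rw [h2, h3, ← mul_assoc, ← expI_add]
      change _ * φ (e x) = _
      congr 2
      rw [smul_sub, smul_smul, mul_inv_cancel₀ (by positivity), one_smul, inner_sub_right]
      ring
    rw [h1]
    simp only [A', ContinuousLinearMap.comp_apply, FourierTransform.fourierInvCLM_apply,
      FourierTransform.fourierInv_fourier_eq]
    congr 1
  simp_rw [key]
  exact (A'.continuous.comp (continuous_compSubConstCLM (𝓕 φ'))).comp
    (continuous_const_smul _ |>.comp e.symm.continuous)

end Shubin

namespace Shubin

/-! ### Iterated directional derivatives along words. -/

section DirDeriv

variable {W : Type*} [NormedAddCommGroup W] [NormedSpace ℝ W]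

/-- Iterated directional derivatives along a list of vectors. -/
noncomputable def dirDeriv (l : List W) (F : W → ℂ) : W → ℂ :=
  l.foldr (fun v G p => lineDeriv ℝ G p v) F

theorem dirDeriv_nil (F : W → ℂ) : dirDeriv [] F = F := rfl

theorem dirDeriv_cons (v : W) (l : List W) (F : W → ℂ) :
    dirDeriv (v :: l) F = fun p => lineDeriv ℝ (dirDeriv l F) p v := rfl

theorem dirDeriv_append (l l' : List W) (F : W → ℂ) :
    dirDeriv (l ++ l') F = dirDeriv l (dirDeriv l' F) := List.foldr_append

theorem dirDeriv_replicate (n : ℕ) (v : W) (F : W → ℂ) :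
    dirDeriv (List.replicate n v) F = (fun (H : W → ℂ) p => lineDeriv ℝ H p v)^[n] F := by
  induction n with
  | zero => rfl
  | succ n ih => rw [List.replicate_succ, dirDeriv_cons, ih, Function.iterate_succ_apply']

/-- The word in which the letter `v j` occurs `α j` times. -/
def multiWord {d : ℕ} {X : Type*} (v : Fin d → X) (α : Fin d → ℕ) : List X :=
  (List.finRange d).flatMap fun j => List.replicate (α j) (v j)

theorem multiDeriv_eq_dirDeriv {d : ℕ} (v : Fin d → W) (α : Fin d → ℕ) (F : W → ℂ) :
    multiDeriv v α F = dirDeriv (multiWord v α) F := by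
  unfold multiDeriv multiWord
  induction List.finRange d with
  | nil => rfl
  | cons j l ih =>
    rw [List.foldr_cons, ih, List.flatMap_cons, dirDeriv_append, dirDeriv_replicate]

theorem lineDeriv_eq_fderiv_of_contDiff {F : W → ℂ} (hF : ContDiff ℝ ∞ F) (v : W) :
    (fun p => lineDeriv ℝ F p v) = fun p => fderiv ℝ F p v := by
  funext p
  exact (hF.differentiable (by simp) p).lineDeriv_eq_fderiv

theorem contDiff_lineDeriv {F : W → ℂ} (hF : ContDiff ℝ ∞ F) (v : W) :
    ContDiff ℝ ∞ (fun p => lineDeriv ℝ F p v) := by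
  rw [lineDeriv_eq_fderiv_of_contDiff hF]
  exact (hF.fderiv_right (m := ∞) (by simp)).clm_apply contDiff_const

theorem contDiff_dirDeriv {F : W → ℂ} (hF : ContDiff ℝ ∞ F) (l : List W) :
    ContDiff ℝ ∞ (dirDeriv l F) := by
  induction l with
  | nil => exact hF
  | cons v l ih => exact contDiff_lineDeriv ih v

theorem lineDeriv_comm {F : W → ℂ} (hF : ContDiff ℝ ∞ F) (u v : W) :
    (fun p => lineDeriv ℝ (fun q => lineDeriv ℝ F q u) p v) =
      fun p => lineDeriv ℝ (fun q => lineDeriv ℝ F q v) p u := by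
  rw [lineDeriv_eq_fderiv_of_contDiff (contDiff_lineDeriv hF u),
    lineDeriv_eq_fderiv_of_contDiff (contDiff_lineDeriv hF v),
    lineDeriv_eq_fderiv_of_contDiff hF, lineDeriv_eq_fderiv_of_contDiff hF]
  funext p
  have hd : DifferentiableAt ℝ (fderiv ℝ F) p :=
    (hF.fderiv_right (m := ∞) (by simp)).differentiable (by simp) p
  have h : ∀ w, fderiv ℝ (fun q => fderiv ℝ F q w) p = (fderiv ℝ (fderiv ℝ F) p).flip w := by
    intro w
    rw [fderiv_clm_apply hd (differentiableAt_const w)]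
    simp
  rw [h, h]
  exact (hF.contDiffAt.isSymmSndFDerivAt (by
    rw [minSmoothness_of_isRCLikeNormedField]
    exact WithTop.coe_le_coe.2 (le_top : (2 : ℕ∞) ≤ ⊤))) v u

theorem dirDeriv_perm {l l' : List W} (h : l.Perm l') {F : W → ℂ} (hF : ContDiff ℝ ∞ F) :
    dirDeriv l F = dirDeriv l' F := by
  induction h with
  | nil => rfl
  | cons v _ ih => rw [dirDeriv_cons, dirDeriv_cons, ih]
  | swap u v l => exact lineDeriv_comm (contDiff_dirDeriv hF l) u v
  | trans _ _ ih₁ ih₂ => rw [ih₁, ih₂]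

/-- Bounds for all directional derivatives along basis vectors bound the full derivative. -/
theorem exists_norm_iteratedFDeriv_le [FiniteDimensional ℝ W] {ι : Type*} [Fintype ι]
    (b : Module.Basis ι ℝ W) {T : Type*} (g : T → W → ℝ) (n : ℕ) (F : T → W → ℂ)
    (hF : ∀ t, ContDiff ℝ ∞ (F t))
    (h : ∀ l : List ι, l.length = n →
      ∃ C, ∀ t x, ‖dirDeriv (l.map b) (F t) x‖ ≤ C * g t x) :
    ∃ C, ∀ t x, ‖iteratedFDeriv ℝ n (F t) x‖ ≤ C * g t x := by
  induction n generalizing F with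
  | zero =>
    obtain ⟨C, hC⟩ := h [] rfl
    exact ⟨C, fun t x => by simpa [dirDeriv_nil] using hC t x⟩
  | succ n ih =>
    have hG : ∀ j : ι, ∃ C, ∀ t x,
        ‖iteratedFDeriv ℝ n (fun p => lineDeriv ℝ (F t) p (b j)) x‖ ≤ C * g t x := by
      intro j
      refine ih _ (fun t => contDiff_lineDeriv (hF t) _) fun l hl => ?_
      -- The last letter of a word acts first, so `j` is appended at the end to obtain the
      -- derivatives of `∂_j F`.
      obtain ⟨C, hC⟩ := h (l ++ [j]) (by simp [hl])
      refine ⟨C, fun t x => ?_⟩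
      have := hC t x
      rwa [List.map_append, dirDeriv_append] at this
    choose C hC using hG
    let L : ι → ℂ →L[ℝ] (W →L[ℝ] ℂ) := fun j =>
      ContinuousLinearMap.smulRightL ℝ W ℂ (LinearMap.toContinuousLinearMap (b.coord j))
    refine ⟨∑ j, ‖L j‖ * C j, fun t x => ?_⟩
    have hfd : fderiv ℝ (F t) = fun y => ∑ j, (L j ∘ fun p => lineDeriv ℝ (F t) p (b j)) y := by
      funext y
      ext v
      conv_lhs => rw [← b.sum_repr v, map_sum]
      simp only [map_smul, sum_apply, Function.comp_apply]
      refine Finset.sum_congr rfl fun j _ => ?_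
      rw [congrFun (lineDeriv_eq_fderiv_of_contDiff (hF t) (b j)) y]
      simp [L]
    rw [← norm_iteratedFDeriv_fderiv, hfd, iteratedFDeriv_sum]
    · rw [Finset.sum_apply, Finset.sum_mul]
      refine (norm_sum_le _ _).trans (Finset.sum_le_sum fun j _ => ?_)
      refine ((L j).norm_iteratedFDeriv_comp_left
        (contDiff_lineDeriv (hF t) (b j)).contDiffAt (by exact_mod_cast le_top)).trans ?_
      rw [mul_assoc]
      exact mul_le_mul_of_nonneg_left (hC j t x) (norm_nonneg _)
    · exact fun j _ => (L j).contDiff.comp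
        ((contDiff_lineDeriv (hF t) (b j)).of_le (by exact_mod_cast le_top))

end DirDeriv

/-! ### Words and multi-indices on phase space. -/

section PhaseSpace

variable {d : ℕ}

/-- The standard basis of `ℝ²ᵈ`. -/
noncomputable def phaseBasis (d : ℕ) : Module.Basis (Fin d ⊕ Fin d) ℝ (Rn d × Rn d) :=
  (EuclideanSpace.basisFun (Fin d) ℝ).toBasis.prod (EuclideanSpace.basisFun (Fin d) ℝ).toBasis

theorem phaseBasis_inl (j : Fin d) : phaseBasis d (Sum.inl j) = (basisVec j, 0) := by
  simp [phaseBasis, basisVec]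

theorem phaseBasis_inr (j : Fin d) : phaseBasis d (Sum.inr j) = (0, basisVec j) := by
  simp [phaseBasis, basisVec]

/-- The word of basis directions with multiplicities `α` and `β`. -/
def phaseWord (α β : Fin d → ℕ) : List (Fin d ⊕ Fin d) :=
  multiWord Sum.inl α ++ multiWord Sum.inr β

theorem map_multiWord {X Y : Type*} (f : X → Y) (v : Fin d → X) (α : Fin d → ℕ) :
    (multiWord v α).map f = multiWord (fun j => f (v j)) α := by
  simp [multiWord, List.map_flatMap]

theorem length_multiWord {X : Type*} (v : Fin d → X) (α : Fin d → ℕ) :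
    (multiWord v α).length = multiLength α := by
  simp [multiWord, List.length_flatMap, multiLength, Fin.sum_univ_def]

theorem length_phaseWord (α β : Fin d → ℕ) : (phaseWord α β).length = multiLength (α + β) := by
  simp [phaseWord, length_multiWord, multiLength, Finset.sum_add_distrib]

theorem multiDeriv_multiDeriv_eq (α β : Fin d → ℕ) (F : Rn d × Rn d → ℂ) :
    multiDeriv (fun j => (basisVec j, 0)) α (multiDeriv (fun j => (0, basisVec j)) β F) =
      dirDeriv ((phaseWord α β).map (phaseBasis d)) F := by
  rw [multiDeriv_eq_dirDeriv, multiDeriv_eq_dirDeriv, ← dirDeriv_append, phaseWord,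
    List.map_append, map_multiWord, map_multiWord]
  simp_rw [phaseBasis_inl, phaseBasis_inr]

theorem count_multiWord {X : Type*} [DecidableEq X] (v : Fin d → X) (α : Fin d → ℕ) (x : X) :
    (multiWord v α).count x = ∑ j, if v j = x then α j else 0 := by
  simp [multiWord, List.count_flatMap, List.count_replicate, Fin.sum_univ_def, Function.comp_def]

theorem exists_perm_multiWord {X : Type*} [DecidableEq X] {v w : Fin d → X}
    (hv : v.Injective) (hw : w.Injective) (hvw : ∀ i j, v i ≠ w j)
    (hcover : ∀ x, (∃ j, v j = x) ∨ ∃ j, w j = x) (l : List X) :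
    ∃ α β : Fin d → ℕ, l.Perm (multiWord v α ++ multiWord w β) := by
  refine ⟨fun j => l.count (v j), fun j => l.count (w j), ?_⟩
  rw [List.perm_iff_count]
  intro x
  rcases hcover x with ⟨j, rfl⟩ | ⟨j, rfl⟩
  · simp [count_multiWord, hv.eq_iff, (hvw _ _).symm]
  · simp [count_multiWord, hw.eq_iff, hvw]

theorem exists_perm_phaseWord (l : List (Fin d ⊕ Fin d)) :
    ∃ α β : Fin d → ℕ, l.Perm (phaseWord α β) :=
  exists_perm_multiWord Sum.inl_injective Sum.inr_injective (by simp) (by simp) l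

/-- Directional derivatives of smooth functions commute, so a word may be sorted. The estimates
depend only on its length, hence can be proved for words, which suit induction better. -/
theorem exists_multiDeriv_eq_dirDeriv (l : List (Fin d ⊕ Fin d)) :
    ∃ α β : Fin d → ℕ, multiLength (α + β) = l.length ∧
      ∀ F : Rn d × Rn d → ℂ, ContDiff ℝ ∞ F →
        dirDeriv (l.map (phaseBasis d)) F = multiDeriv (fun j => (basisVec j, 0)) α
          (multiDeriv (fun j => (0, basisVec j)) β F) := by
  obtain ⟨α, β, h⟩ := exists_perm_phaseWord l
  refine ⟨α, β, by rw [← length_phaseWord, h.length_eq], fun F hF => ?_⟩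
  rw [multiDeriv_multiDeriv_eq]
  exact dirDeriv_perm (h.map _) hF

end PhaseSpace

end Shubin

namespace Shubin

open MeasureTheory
open scoped LineDeriv

/-! ### The partial Fourier transform on Schwartz space. -/

section PartialFourier

variable {d : ℕ}

theorem hasDerivAt_expI (t : ℝ) : HasDerivAt expI (Complex.I * expI t) t := by
  have h : HasDerivAt (fun t : ℝ => Complex.I * (t : ℂ)) (Complex.I * 1) t :=
    (Complex.ofRealCLM.hasDerivAt).const_mul Complex.I
  have h2 := h.cexp
  rw [mul_one, mul_comm] at h2
  exact h2

/-- The partial Fourier integral `∫ e^{i⟨u, ξ⟩} φ(p, u) du`. -/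
noncomputable def partialFourier (φ : 𝓢(Rn d × Rn d, ℂ)) (x : Rn d × Rn d) : ℂ :=
  ∫ u : Rn d, expI (inner ℝ u x.2) * φ (x.1, u)

/-- The exponent `d + 1` exceeds the dimension, so this majorant is integrable in `u`, uniformly in
`p`. -/
theorem norm_slice_le (φ : 𝓢(Rn d × Rn d, ℂ)) (p u : Rn d) :
    ‖φ (p, u)‖ ≤ weightedSeminorm (d + 1) 0 φ * (1 + ‖u‖) ^ (-((d + 1 : ℕ) : ℝ)) := by
  have h := one_add_norm_pow_mul_le (d + 1) 0 φ (p, u)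
  rw [norm_iteratedFDeriv_zero] at h
  have hu : 0 < 1 + ‖u‖ := by positivity
  rw [Real.rpow_neg hu.le, Real.rpow_natCast, ← div_eq_mul_inv, le_div_iff₀ (by positivity),
    mul_comm]
  refine le_trans ?_ h
  gcongr
  exact norm_snd_le (p, u)

theorem integrable_slice_bound (d : ℕ) :
    Integrable fun u : Rn d => (1 + ‖u‖) ^ (-((d + 1 : ℕ) : ℝ)) :=
  integrable_one_add_norm (by rw [finrank_Rn]; push_cast; linarith)

theorem norm_expI_mul (t : ℝ) (z : ℂ) : ‖expI t * z‖ = ‖z‖ := by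
  rw [norm_mul, norm_expI, one_mul]

theorem continuous_slice (φ : 𝓢(Rn d × Rn d, ℂ)) (x : Rn d × Rn d) :
    Continuous fun u : Rn d => expI (inner ℝ u x.2) * φ (x.1, u) :=
  (continuous_expI.comp (by fun_prop)).mul (by fun_prop)

theorem integrable_slice (φ : 𝓢(Rn d × Rn d, ℂ)) (x : Rn d × Rn d) :
    Integrable fun u : Rn d => expI (inner ℝ u x.2) * φ (x.1, u) :=
  ((integrable_slice_bound d).const_mul _).mono' (continuous_slice φ x).aestronglyMeasurable
    (Filter.Eventually.of_forall fun u => by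
      rw [norm_expI_mul]
      exact norm_slice_le φ x.1 u)

theorem norm_partialFourier_le (φ : 𝓢(Rn d × Rn d, ℂ)) (x : Rn d × Rn d) :
    ‖partialFourier φ x‖ ≤ (∫ u : Rn d, (1 + ‖u‖) ^ (-((d + 1 : ℕ) : ℝ))) *
      weightedSeminorm (d + 1) 0 φ := by
  rw [mul_comm, ← integral_const_mul]
  refine norm_integral_le_of_norm_le ((integrable_slice_bound d).const_mul _)
    (Filter.Eventually.of_forall fun u => ?_)
  rw [norm_expI_mul]
  exact norm_slice_le φ x.1 u

theorem continuous_partialFourier (φ : 𝓢(Rn d × Rn d, ℂ)) : Continuous (partialFourier φ) := by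
  refine continuous_of_dominated (bound := fun u : Rn d =>
    weightedSeminorm (d + 1) 0 φ * (1 + ‖u‖) ^ (-((d + 1 : ℕ) : ℝ)))
    (fun x => (continuous_slice φ x).aestronglyMeasurable)
    (fun x => Filter.Eventually.of_forall fun u => ?_) ((integrable_slice_bound d).const_mul _)
    (Filter.Eventually.of_forall fun u => ?_)
  · rw [norm_expI_mul]
    exact norm_slice_le φ x.1 u
  · exact (continuous_expI.comp (by fun_prop)).mul (by fun_prop)

theorem partialFourier_add (φ ψ : 𝓢(Rn d × Rn d, ℂ)) (x : Rn d × Rn d) :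
    partialFourier (φ + ψ) x = partialFourier φ x + partialFourier ψ x := by
  unfold partialFourier
  rw [← integral_add (integrable_slice φ x) (integrable_slice ψ x)]
  simp [mul_add]

theorem partialFourier_smul (c : ℂ) (φ : 𝓢(Rn d × Rn d, ℂ)) (x : Rn d × Rn d) :
    partialFourier (c • φ) x = c * partialFourier φ x := by
  unfold partialFourier
  rw [← integral_const_mul]
  refine integral_congr_ae (Filter.Eventually.of_forall fun u => ?_)
  simp only [smul_apply, smul_eq_mul]
  ring

/-- Multiplication by the linear function `i ℓ`. -/
noncomputable def mulI (ℓ : Rn d × Rn d →L[ℝ] ℝ) : 𝓢(Rn d × Rn d, ℂ) →L[ℂ] 𝓢(Rn d × Rn d, ℂ) :=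
  SchwartzMap.smulLeftCLM ℂ (fun y => Complex.I * (ℓ y : ℂ))

theorem mulI_apply (ℓ : Rn d × Rn d →L[ℝ] ℝ) (φ : 𝓢(Rn d × Rn d, ℂ)) (y : Rn d × Rn d) :
    mulI ℓ φ y = Complex.I * (ℓ y : ℂ) * φ y := by
  have : (fun y : Rn d × Rn d => Complex.I * (ℓ y : ℂ)) =
      (Complex.I • (Complex.ofRealCLM.comp ℓ) : Rn d × Rn d →L[ℝ] ℂ) := by
    funext y; simp
  rw [mulI, SchwartzMap.smulLeftCLM_apply_apply, smul_eq_mul]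
  rw [this]
  exact ContinuousLinearMap.hasTemperateGrowth _

/-- The operator on Schwartz functions that corresponds to `∂_h` under the partial Fourier
transform. -/
noncomputable def fourierDeriv (h : Rn d × Rn d) :
    𝓢(Rn d × Rn d, ℂ) →L[ℂ] 𝓢(Rn d × Rn d, ℂ) :=
  LineDeriv.lineDerivOpCLM ℂ 𝓢(Rn d × Rn d, ℂ) (h.1, (0 : Rn d)) +
    mulI ((innerSL ℝ h.2).comp (ContinuousLinearMap.snd ℝ (Rn d) (Rn d)))

theorem fourierDeriv_apply (h : Rn d × Rn d) (φ : 𝓢(Rn d × Rn d, ℂ)) (y : Rn d × Rn d) :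
    fourierDeriv h φ y = fderiv ℝ φ y (h.1, 0) + Complex.I * (inner ℝ h.2 y.2 : ℝ) * φ y := by
  simp [fourierDeriv, mulI_apply, SchwartzMap.lineDerivOp_apply_eq_fderiv]

/-- A derivative in `p` falls on `φ` and a derivative in `ξ` brings down a factor `i u`; the slice
bound for `fourierDeriv h φ` dominates uniformly in `t`. -/
theorem hasLineDerivAt_partialFourier (φ : 𝓢(Rn d × Rn d, ℂ)) (x h : Rn d × Rn d) :
    HasLineDerivAt ℝ (partialFourier φ) (partialFourier (fourierDeriv h φ) x) x h := by
  have hd : ∀ (u : Rn d) (t : ℝ), HasDerivAt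
      (fun t : ℝ => expI (inner ℝ u (x + t • h).2) * φ ((x + t • h).1, u))
      (expI (inner ℝ u (x + t • h).2) * fourierDeriv h φ ((x + t • h).1, u)) t := by
    intro u t
    have e1 : HasDerivAt (fun t : ℝ => inner ℝ u (x + t • h).2) (inner ℝ u h.2) t := by
      have : (fun t : ℝ => inner ℝ u (x + t • h).2) =
          fun t : ℝ => inner ℝ u x.2 + t * inner ℝ u h.2 := by
        funext t; simp [inner_add_right, inner_smul_right]
      rw [this]
      simpa using ((hasDerivAt_id t).mul_const (inner ℝ u h.2 : ℝ)).const_add (inner ℝ u x.2)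
    have e2 : HasDerivAt (fun t : ℝ => (((x + t • h).1, u) : Rn d × Rn d)) (h.1, 0) t := by
      have : HasDerivAt (fun t : ℝ => (x + t • h).1) h.1 t := by
        simpa using ((hasDerivAt_id t).smul_const h.1).const_add x.1
      exact this.prodMk (hasDerivAt_const t u)
    have e3 := ((hasDerivAt_expI _).scomp t e1).mul
      ((SchwartzMap.hasFDerivAt φ ((x + t • h).1, u)).comp_hasDerivAt t e2)
    have e4 : expI (inner ℝ u (x + t • h).2) * fourierDeriv h φ ((x + t • h).1, u) =
        (inner ℝ u h.2 : ℝ) • (Complex.I * expI (inner ℝ u (x + t • h).2)) *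
          φ ((x + t • h).1, u) + expI (inner ℝ u (x + t • h).2) *
            fderiv ℝ φ ((x + t • h).1, u) (h.1, 0) := by
      rw [fourierDeriv_apply, real_inner_comm u h.2, Complex.real_smul]
      ring
    rw [e4]
    exact e3
  have key := hasDerivAt_integral_of_dominated_loc_of_deriv_le (𝕜 := ℝ) (μ := (volume : Measure (Rn d)))
    (F := fun t u => expI (inner ℝ u (x + t • h).2) * φ ((x + t • h).1, u)) (x₀ := (0 : ℝ))
    (F' := fun t u => expI (inner ℝ u (x + t • h).2) * fourierDeriv h φ ((x + t • h).1, u))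
    (bound := fun u => weightedSeminorm (d + 1) 0 (fourierDeriv h φ) *
      (1 + ‖u‖) ^ (-((d + 1 : ℕ) : ℝ))) Filter.univ_mem
    (Filter.Eventually.of_forall fun t => (continuous_slice φ (x + t • h)).aestronglyMeasurable)
    (integrable_slice φ _) (continuous_slice (fourierDeriv h φ) _).aestronglyMeasurable
    (Filter.Eventually.of_forall fun u t _ => by
      rw [norm_expI_mul]
      exact norm_slice_le _ _ u) ((integrable_slice_bound d).const_mul _)
    (Filter.Eventually.of_forall fun u t _ => hd u t)
  have h2 := key.2
  simp only [zero_smul, add_zero] at h2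
  exact h2

/-- The operator on Schwartz functions that corresponds to iterated derivatives under the partial
Fourier transform. -/
noncomputable def fourierWord (w : List (Fin d ⊕ Fin d)) :
    𝓢(Rn d × Rn d, ℂ) →L[ℂ] 𝓢(Rn d × Rn d, ℂ) :=
  w.foldr (fun j L => (fourierDeriv (phaseBasis d j)).comp L) (ContinuousLinearMap.id ℂ _)

theorem partialFourier_sum {ι : Type*} (s : Finset ι) (c : ι → ℝ) (φ : ι → 𝓢(Rn d × Rn d, ℂ))
    (x : Rn d × Rn d) :
    partialFourier (∑ j ∈ s, (c j : ℂ) • φ j) x = ∑ j ∈ s, c j • partialFourier (φ j) x := by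
  let L : 𝓢(Rn d × Rn d, ℂ) →ₗ[ℂ] ℂ :=
    { toFun := fun φ => partialFourier φ x
      map_add' := fun φ ψ => partialFourier_add φ ψ x
      map_smul' := fun c φ => partialFourier_smul c φ x }
  change L _ = _
  rw [map_sum]
  refine Finset.sum_congr rfl fun j _ => ?_
  rw [map_smul]
  rfl

theorem fourierDeriv_eq_sum (h : Rn d × Rn d) (φ : 𝓢(Rn d × Rn d, ℂ)) :
    fourierDeriv h φ = ∑ j, (((phaseBasis d).repr h j : ℝ) : ℂ) • fourierDeriv (phaseBasis d j) φ := by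
  ext y
  let L : Rn d × Rn d →ₗ[ℝ] ℂ :=
    { toFun := fun h => fderiv ℝ φ y (h.1, 0) + Complex.I * (inner ℝ h.2 y.2 : ℝ) * φ y
      map_add' := fun h k => by
        have : ((h + k).1, (0 : Rn d)) = (h.1, 0) + (k.1, 0) := by simp
        rw [this, map_add]
        simp only [Prod.snd_add, inner_add_left, Complex.ofReal_add]
        ring
      map_smul' := fun c h => by
        have : ((c • h).1, (0 : Rn d)) = c • (h.1, 0) := by simp
        rw [this, map_smul]
        simp only [Prod.smul_snd, real_inner_smul_left, Complex.ofReal_mul, RingHom.id_apply,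
          Complex.real_smul]
        ring }
  rw [sum_apply]
  simp only [smul_apply, fourierDeriv_apply]
  change L h = ∑ j, _ • L (phaseBasis d j)
  conv_lhs => rw [← (phaseBasis d).sum_repr h, map_sum]
  simp

theorem contDiff_partialFourier (φ : 𝓢(Rn d × Rn d, ℂ)) : ContDiff ℝ ∞ (partialFourier φ) := by
  refine contDiff_of_hasLineDerivAt (phaseBasis d) (fun w => partialFourier (fourierWord w φ))
    (fun w => continuous_partialFourier _) (fun w x v => ?_) []
  rw [show ∑ j, (phaseBasis d).repr v j • partialFourier (fourierWord (j :: w) φ) x =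
    partialFourier (fourierDeriv v (fourierWord w φ)) x by
      rw [fourierDeriv_eq_sum, partialFourier_sum]; rfl]
  exact hasLineDerivAt_partialFourier _ x v

theorem dirDeriv_partialFourier (w : List (Fin d ⊕ Fin d)) (φ : 𝓢(Rn d × Rn d, ℂ)) :
    dirDeriv (w.map (phaseBasis d)) (partialFourier φ) = partialFourier (fourierWord w φ) := by
  induction w with
  | nil => rfl
  | cons j w ih =>
    rw [List.map_cons, dirDeriv_cons, ih]
    funext x
    exact (hasLineDerivAt_partialFourier _ x _).lineDeriv

theorem partialFourier_mulI_fst (ℓ : Rn d →L[ℝ] ℝ) (φ : 𝓢(Rn d × Rn d, ℂ)) (x : Rn d × Rn d) :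
    partialFourier (mulI (ℓ.comp (ContinuousLinearMap.fst ℝ (Rn d) (Rn d))) φ) x =
      Complex.I * (ℓ x.1 : ℂ) * partialFourier φ x := by
  unfold partialFourier
  rw [← integral_const_mul]
  refine integral_congr_ae (Filter.Eventually.of_forall fun u => ?_)
  simp only [mulI_apply, ContinuousLinearMap.comp_apply, ContinuousLinearMap.coe_fst']
  ring

theorem integral_eq_zero_of_hasLineDerivAt {g g' : Rn d → ℂ} {v : Rn d} (hg : Integrable g)
    (hg' : Integrable g') (h : ∀ u, HasLineDerivAt ℝ g (g' u) u v) : ∫ u, g' u = 0 := by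
  have key := integral_bilinear_hasLineDerivAt_right_eq_neg_left_of_integrable
    (μ := (volume : Measure (Rn d))) (B := ContinuousLinearMap.mul ℝ ℂ) (f := fun _ => 1)
    (f' := fun _ => 0) (g := g) (v := v) (g' := g')
    (by simp) (by simpa using hg') (by simpa using hg)
    (fun u _ => by simpa [HasLineDerivAt] using hasDerivAt_const (0 : ℝ) (1 : ℂ))
    (fun u _ => h u)
  simpa using key

/-- Integration by parts in `u`: the derivative of the whole integrand in the direction `h` has
integral zero. -/
theorem partialFourier_lineDeriv_snd (h : Rn d) (φ : 𝓢(Rn d × Rn d, ℂ)) (x : Rn d × Rn d) :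
    partialFourier (∂_{((0 : Rn d), h)} φ) x =
      -(Complex.I * (inner ℝ h x.2 : ℝ) * partialFourier φ x) := by
  have hd : ∀ u, HasLineDerivAt ℝ (fun u => expI (inner ℝ u x.2) * φ (x.1, u))
      (Complex.I * (inner ℝ h x.2 : ℝ) * (expI (inner ℝ u x.2) * φ (x.1, u)) +
        expI (inner ℝ u x.2) * (∂_{((0 : Rn d), h)} φ) (x.1, u)) u h := by
    intro u
    have e1 : HasDerivAt (fun t : ℝ => inner ℝ (u + t • h) x.2) (inner ℝ h x.2) 0 := by
      have : (fun t : ℝ => inner ℝ (u + t • h) x.2) =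
          fun t : ℝ => inner ℝ u x.2 + t * inner ℝ h x.2 := by
        funext t; simp [inner_add_left, real_inner_smul_left]
      rw [this]
      simpa using ((hasDerivAt_id (0 : ℝ)).mul_const (inner ℝ h x.2 : ℝ)).const_add (inner ℝ u x.2)
    have e2 : HasDerivAt (fun t : ℝ => ((x.1, u + t • h) : Rn d × Rn d)) (0, h) 0 := by
      have : HasDerivAt (fun t : ℝ => u + t • h) h 0 := by
        simpa using ((hasDerivAt_id (0 : ℝ)).smul_const h).const_add u
      exact (hasDerivAt_const 0 x.1).prodMk this
    have e3 := ((hasDerivAt_expI _).scomp 0 e1).mul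
      ((SchwartzMap.hasFDerivAt φ (x.1, u + (0 : ℝ) • h)).comp_hasDerivAt 0 e2)
    have e4 : Complex.I * (inner ℝ h x.2 : ℝ) * (expI (inner ℝ u x.2) * φ (x.1, u)) +
        expI (inner ℝ u x.2) * (∂_{((0 : Rn d), h)} φ) (x.1, u) =
        (inner ℝ h x.2 : ℝ) • (Complex.I * expI (inner ℝ (u + (0 : ℝ) • h) x.2)) *
          φ (x.1, u + (0 : ℝ) • h) + expI (inner ℝ (u + (0 : ℝ) • h) x.2) *
            fderiv ℝ φ (x.1, u + (0 : ℝ) • h) (0, h) := by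
      rw [SchwartzMap.lineDerivOp_apply_eq_fderiv, Complex.real_smul, zero_smul, add_zero]
      ring
    rw [e4]
    exact e3
  have hi1 := (integrable_slice φ x).const_mul (Complex.I * (inner ℝ h x.2 : ℝ))
  have hi2 := integrable_slice (∂_{((0 : Rn d), h)} φ) x
  have key := integral_eq_zero_of_hasLineDerivAt (integrable_slice φ x) (hi1.add hi2) hd
  simp only [Pi.add_apply] at key
  rw [integral_add hi1 hi2, integral_const_mul] at key
  exact eq_neg_of_add_eq_zero_right key

theorem seminorm_sum_apply {M ι : Type*} [AddCommGroup M] [Module ℂ M] (s : Finset ι)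
    (q : ι → Seminorm ℂ M) (x : M) : (∑ j ∈ s, q j) x = ∑ j ∈ s, q j x := by
  simp

theorem continuous_seminorm_sum {M ι : Type*} [AddCommGroup M] [Module ℂ M] [TopologicalSpace M]
    (s : Finset ι) (q : ι → Seminorm ℂ M) (hq : ∀ j ∈ s, Continuous (q j)) :
    Continuous (∑ j ∈ s, q j : Seminorm ℂ M) := by
  have : ⇑(∑ j ∈ s, q j : Seminorm ℂ M) = fun x => ∑ j ∈ s, q j x :=
    funext (seminorm_sum_apply s q)
  rw [this]
  exact continuous_finsetSum _ hq

/-- Multiplying the transform by a coordinate amounts, up to a unimodular factor, to transforming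
`p_j φ` or `∂_{u_j} φ`. Each power of `‖x‖` thus costs one continuous operator on `φ`, and the
induction starts from the sup bound. -/
theorem exists_continuous_seminorm_partialFourier (k : ℕ) :
    ∃ q : Seminorm ℂ 𝓢(Rn d × Rn d, ℂ), Continuous q ∧
      ∀ φ x, ‖x‖ ^ k * ‖partialFourier φ x‖ ≤ q φ := by
  induction k with
  | zero =>
    let c : NNReal := ⟨∫ u : Rn d, (1 + ‖u‖) ^ (-((d + 1 : ℕ) : ℝ)),
      integral_nonneg fun u => by positivity⟩
    let p := ∑ i ∈ Finset.Iic (d + 1, 0), schwartzSeminormFamily ℂ (Rn d × Rn d) ℂ i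
    have hp : Continuous p := continuous_seminorm_sum _ _ fun i _ =>
      (schwartz_withSeminorms ℂ (Rn d × Rn d) ℂ).continuous_seminorm i
    refine ⟨(c * 2 ^ (d + 1)) • p, hp.const_smul (c * 2 ^ (d + 1)), fun φ x => ?_⟩
    rw [pow_zero, one_mul]
    refine (norm_partialFourier_le φ x).trans ?_
    change (c : ℝ) * (2 ^ (d + 1) * _) ≤ ((c * 2 ^ (d + 1) : NNReal) : ℝ) * p φ
    push_cast
    rw [mul_assoc]
    gcongr
    exact Seminorm.finset_sup_le_sum _ _ φ
  | succ k ih =>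
    obtain ⟨q, hq, hb⟩ := ih
    let N : Fin d ⊕ Fin d → 𝓢(Rn d × Rn d, ℂ) →L[ℂ] 𝓢(Rn d × Rn d, ℂ) := Sum.elim
      (fun j => mulI ((EuclideanSpace.proj j).comp (ContinuousLinearMap.fst ℝ (Rn d) (Rn d))))
      (fun j => LineDeriv.lineDerivOpCLM ℂ 𝓢(Rn d × Rn d, ℂ) ((0 : Rn d), basisVec j))
    refine ⟨∑ j, q.comp (N j).toLinearMap,
      continuous_seminorm_sum _ _ fun j _ => hq.comp (N j).continuous, fun φ x => ?_⟩
    · have hx : ‖x‖ ≤ (∑ j, |x.1 j|) + ∑ j, |x.2 j| := by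
        have h1 : ∀ y : Rn d, ‖y‖ ≤ ∑ j, |y j| := fun y => by
          conv_lhs => rw [← (EuclideanSpace.basisFun (Fin d) ℝ).sum_repr y]
          refine (norm_sum_le _ _).trans_eq (Finset.sum_congr rfl fun j _ => ?_)
          simp [norm_smul]
        have h2 : ∀ y : Rn d, 0 ≤ ∑ j, |y j| := fun y => Finset.sum_nonneg fun j _ => abs_nonneg _
        rw [Prod.norm_def]
        refine max_le ?_ ?_
        · linarith [h1 x.1, h2 x.2]
        · linarith [h1 x.2, h2 x.1]
      have e1 : ∀ j, |x.1 j| * ‖partialFourier φ x‖ = ‖partialFourier (N (Sum.inl j) φ) x‖ := by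
        intro j
        simp only [N, Sum.elim_inl, partialFourier_mulI_fst]
        simp
      have e2 : ∀ j, |x.2 j| * ‖partialFourier φ x‖ = ‖partialFourier (N (Sum.inr j) φ) x‖ := by
        intro j
        simp only [N, Sum.elim_inr, LineDeriv.lineDerivOpCLM_apply, partialFourier_lineDeriv_snd]
        simp [basisVec, EuclideanSpace.inner_single_left]
      calc ‖x‖ ^ (k + 1) * ‖partialFourier φ x‖
          = ‖x‖ ^ k * (‖x‖ * ‖partialFourier φ x‖) := by ring
        _ ≤ ‖x‖ ^ k * (((∑ j, |x.1 j|) + ∑ j, |x.2 j|) * ‖partialFourier φ x‖) := by gcongr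
        _ = ∑ j, ‖x‖ ^ k * ‖partialFourier (N j φ) x‖ := by
            rw [add_mul, Finset.sum_mul, Finset.sum_mul, Fintype.sum_sum_type, mul_add,
              Finset.mul_sum, Finset.mul_sum]
            simp_rw [e1, e2]
        _ ≤ _ := by
            rw [seminorm_sum_apply]
            exact Finset.sum_le_sum fun j _ => hb _ _

theorem exists_bound_partialFourier (k n : ℕ) :
    ∃ (s : Finset (ℕ × ℕ)) (C : ℝ), 0 ≤ C ∧ ∀ (φ : 𝓢(Rn d × Rn d, ℂ)) (x : Rn d × Rn d),
      ‖x‖ ^ k * ‖iteratedFDeriv ℝ n (partialFourier φ) x‖ ≤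
        C * s.sup (schwartzSeminormFamily ℂ (Rn d × Rn d) ℂ) φ := by
  obtain ⟨q, hq, hb⟩ := exists_continuous_seminorm_partialFourier (d := d) k
  -- The test function is taken as the parameter, which makes `C` uniform in `φ`; the weight is the
  -- sum over all words of length `n`, so each single word is bounded with constant `1`.
  obtain ⟨C, hC⟩ := exists_norm_iteratedFDeriv_le (phaseBasis d)
    (T := 𝓢(Rn d × Rn d, ℂ)) (fun φ x => ∑ w : Fin n → Fin d ⊕ Fin d,
      ‖partialFourier (fourierWord (List.ofFn w) φ) x‖) n partialFourier
    contDiff_partialFourier (fun l hl => ⟨1, fun φ x => by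
      subst hl
      rw [one_mul, dirDeriv_partialFourier]
      conv_lhs => rw [← List.ofFn_get l]
      exact Finset.single_le_sum (f := fun w : Fin l.length → Fin d ⊕ Fin d =>
        ‖partialFourier (fourierWord (List.ofFn w) φ) x‖) (fun w _ => norm_nonneg _)
        (Finset.mem_univ l.get)⟩)
  let Q : Seminorm ℂ 𝓢(Rn d × Rn d, ℂ) :=
    ∑ w : Fin n → Fin d ⊕ Fin d, q.comp (fourierWord (List.ofFn w)).toLinearMap
  have hQ : ∀ φ, Q φ = ∑ w : Fin n → Fin d ⊕ Fin d, q (fourierWord (List.ofFn w) φ) := fun φ => by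
    simp [Q, Seminorm.comp_apply]
  have hQc : Continuous Q :=
    continuous_seminorm_sum _ _ fun w _ => hq.comp (fourierWord (List.ofFn w)).continuous
  obtain ⟨s, B, -, hB⟩ :=
    Seminorm.bound_of_continuous (schwartz_withSeminorms ℂ (Rn d × Rn d) ℂ) Q hQc
  refine ⟨s, |C| * B, by positivity, fun φ x => ?_⟩
  calc ‖x‖ ^ k * ‖iteratedFDeriv ℝ n (partialFourier φ) x‖
      ≤ ‖x‖ ^ k * (|C| * ∑ w : Fin n → Fin d ⊕ Fin d,
          ‖partialFourier (fourierWord (List.ofFn w) φ) x‖) := by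
        gcongr
        refine (hC φ x).trans ?_
        gcongr
        exact le_abs_self C
    _ = |C| * ∑ w : Fin n → Fin d ⊕ Fin d,
          ‖x‖ ^ k * ‖partialFourier (fourierWord (List.ofFn w) φ) x‖ := by
        rw [← Finset.mul_sum]; ring
    _ ≤ |C| * Q φ := by
        rw [hQ]
        gcongr
        exact hb _ _
    _ ≤ |C| * (B * s.sup (schwartzSeminormFamily ℂ (Rn d × Rn d) ℂ) φ) := by
        gcongr
        exact hB φ
    _ = _ := by ring

/-- The partial Fourier transform of Schwartz functions. -/
noncomputable def partialFourierCLM (d : ℕ) : 𝓢(Rn d × Rn d, ℂ) →L[ℂ] 𝓢(Rn d × Rn d, ℂ) :=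
  SchwartzMap.mkCLM (σ := RingHom.id ℂ) partialFourier partialFourier_add partialFourier_smul
    contDiff_partialFourier fun n => exists_bound_partialFourier n.1 n.2

theorem partialFourierCLM_apply (φ : 𝓢(Rn d × Rn d, ℂ)) (x : Rn d × Rn d) :
    partialFourierCLM d φ x = ∫ u : Rn d, expI (inner ℝ u x.2) * φ (x.1, u) := rfl

end PartialFourier

end Shubin

namespace Shubin

open MeasureTheory

/-! ### Weyl symbols and covariance under time-frequency shifts. -/

section Weyl

variable {d : ℕ}

/-- Reflection in the second variable. -/
noncomputable def reflectSnd (d : ℕ) : 𝓢(Rn d × Rn d, ℂ) →L[ℂ] 𝓢(Rn d × Rn d, ℂ) :=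
  SchwartzMap.compCLMOfContinuousLinearEquiv ℂ
    ((ContinuousLinearEquiv.refl ℝ (Rn d)).prodCongr (ContinuousLinearEquiv.neg ℝ))

theorem reflectSnd_apply (φ : 𝓢(Rn d × Rn d, ℂ)) (x : Rn d × Rn d) :
    reflectSnd d φ x = φ (x.1, -x.2) := rfl

/-- Fourier inversion in the second variable, the reflection turning `e^{i⟨u, ξ⟩}` into the inverse
kernel. It yields both injectivity and a right inverse. -/
theorem partialFourierCLM_reflectSnd_partialFourierCLM (φ : 𝓢(Rn d × Rn d, ℂ)) :
    partialFourierCLM d (reflectSnd d (partialFourierCLM d φ)) =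
      (((2 * Real.pi) ^ d : ℝ) : ℂ) • φ := by
  ext x
  rw [partialFourierCLM_apply]
  simp_rw [reflectSnd_apply, partialFourierCLM_apply]
  have hc : Continuous fun u : Rn d => φ (x.1, u) := by fun_prop
  have hi : Integrable fun u : Rn d => φ (x.1, u) := by
    simpa [expI_zero] using integrable_slice φ (x.1, 0)
  have hi' : Integrable fun ξ : Rn d => ∫ u, expI (inner ℝ u ξ) * φ (x.1, u) :=
    by simpa [expI_zero, partialFourierCLM_apply] using
      integrable_slice (partialFourierCLM d φ) (x.1, 0)
  have h := integral_integral_expI hc hi hi' x.2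
  rw [finrank_Rn] at h
  have h2 := integral_neg_eq_self
    (fun ξ : Rn d => expI (inner ℝ ξ x.2) * ∫ u, expI (inner ℝ u (-ξ)) * φ (x.1, u)) volume
  rw [← h2]
  simp only [inner_neg_left, neg_neg]
  simp_rw [real_inner_comm x.2 _] at h ⊢
  exact h

/-- The inverse of the partial Fourier transform. -/
noncomputable def partialFourierInvCLM (d : ℕ) : 𝓢(Rn d × Rn d, ℂ) →L[ℂ] 𝓢(Rn d × Rn d, ℂ) :=
  (((2 * Real.pi) ^ d : ℝ) : ℂ)⁻¹ • (reflectSnd d).comp (partialFourierCLM d)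

theorem partialFourierCLM_partialFourierInvCLM (φ : 𝓢(Rn d × Rn d, ℂ)) :
    partialFourierCLM d (partialFourierInvCLM d φ) = φ := by
  simp only [partialFourierInvCLM, smul_apply, ContinuousLinearMap.comp_apply,
    map_smul, partialFourierCLM_reflectSnd_partialFourierCLM]
  rw [smul_smul, inv_mul_cancel₀ (two_pi_pow_ne_zero d), one_smul]

theorem partialFourierCLM_injective : Function.Injective (partialFourierCLM d) := by
  intro φ ψ h
  have h2 := congrArg (fun χ => partialFourierCLM d (reflectSnd d χ)) h
  simp only [partialFourierCLM_reflectSnd_partialFourierCLM] at h2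
  exact smul_right_injective _ (two_pi_pow_ne_zero d) h2

/-- The coordinate change `(p, u) ↦ (p + u / 2, p - u / 2)`. -/
noncomputable def weylCoord (d : ℕ) : (Rn d × Rn d) ≃L[ℝ] Rn d × Rn d :=
  ContinuousLinearEquiv.equivOfInverse
    ((ContinuousLinearMap.fst ℝ (Rn d) (Rn d) +
        (1 / 2 : ℝ) • ContinuousLinearMap.snd ℝ (Rn d) (Rn d)).prod
      (ContinuousLinearMap.fst ℝ (Rn d) (Rn d) -
        (1 / 2 : ℝ) • ContinuousLinearMap.snd ℝ (Rn d) (Rn d)))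
    (((1 / 2 : ℝ) • (ContinuousLinearMap.fst ℝ (Rn d) (Rn d) +
        ContinuousLinearMap.snd ℝ (Rn d) (Rn d))).prod
      (ContinuousLinearMap.fst ℝ (Rn d) (Rn d) - ContinuousLinearMap.snd ℝ (Rn d) (Rn d)))
    (fun x => by ext1 <;> simp <;> module) (fun x => by ext1 <;> simp <;> module)

/-- The map `φ ↦ ∫ e^{i⟨u, ξ⟩} φ(p + u / 2, p - u / 2) du` on Schwartz functions. -/
noncomputable def weylMap (d : ℕ) : 𝓢(Rn d × Rn d, ℂ) →L[ℂ] 𝓢(Rn d × Rn d, ℂ) :=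
  (partialFourierCLM d).comp (SchwartzMap.compCLMOfContinuousLinearEquiv ℂ (weylCoord d))

theorem weylMap_apply (φ : 𝓢(Rn d × Rn d, ℂ)) (q : Rn d × Rn d) :
    weylMap d φ q = ∫ u : Rn d, expI (inner ℝ u q.2) *
      φ (q.1 + (1 / 2 : ℝ) • u, q.1 - (1 / 2 : ℝ) • u) := rfl

/-- The inverse of `weylMap`. -/
noncomputable def weylInv (d : ℕ) : 𝓢(Rn d × Rn d, ℂ) →L[ℂ] 𝓢(Rn d × Rn d, ℂ) :=
  (SchwartzMap.compCLMOfContinuousLinearEquiv ℂ (weylCoord d).symm).comp (partialFourierInvCLM d)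

theorem weylMap_weylInv (φ : 𝓢(Rn d × Rn d, ℂ)) : weylMap d (weylInv d φ) = φ := by
  have h : SchwartzMap.compCLMOfContinuousLinearEquiv ℂ (weylCoord d)
      (SchwartzMap.compCLMOfContinuousLinearEquiv ℂ (weylCoord d).symm
        (partialFourierInvCLM d φ)) = partialFourierInvCLM d φ := by
    ext x
    simp
  simp only [weylMap, weylInv, ContinuousLinearMap.comp_apply, h,
    partialFourierCLM_partialFourierInvCLM]

theorem weylMap_injective : Function.Injective (weylMap d) := by
  intro φ ψ h
  have h2 := partialFourierCLM_injective h
  ext x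
  have h3 := DFunLike.congr_fun h2 ((weylCoord d).symm x)
  simpa using h3

theorem weylInv_weylMap (φ : 𝓢(Rn d × Rn d, ℂ)) : weylInv d (weylMap d φ) = φ :=
  weylMap_injective (weylMap_weylInv _)

/-- The Weyl symbol of a kernel, as a functional on Schwartz functions. -/
noncomputable def weylSymbol (K : 𝓢(Rn d × Rn d, ℂ) →L[ℂ] ℂ) : 𝓢(Rn d × Rn d, ℂ) →L[ℂ] ℂ :=
  (((2 * Real.pi) ^ d : ℝ) : ℂ) • K.comp (weylInv d)

theorem weylSymbol_weylMap (K : 𝓢(Rn d × Rn d, ℂ) →L[ℂ] ℂ) (φ : 𝓢(Rn d × Rn d, ℂ)) :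
    weylSymbol K (weylMap d φ) = (((2 * Real.pi) ^ d : ℝ) : ℂ) * K φ := by
  simp [weylSymbol, weylInv_weylMap]

/-- Every Schwartz function is `weylMap d φ` for some `φ`, so testing `K` against `φ` is the same as
testing its symbol against arbitrary functions. -/
theorem isWeylKernel_iff (a : Rn d × Rn d → ℂ) (K : 𝓢'(Rn d × Rn d, ℂ)) :
    IsWeylKernel a K ↔ ∀ ψ, weylSymbol K ψ = ∫ q, a q * ψ q := by
  have h0 := two_pi_pow_ne_zero d
  constructor
  · intro h ψ
    have h1 := h (weylInv d ψ)
    have h2 := weylSymbol_weylMap K (weylInv d ψ)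
    rw [weylMap_weylInv] at h2
    rw [h2]
    refine (congrArg _ h1).trans ?_
    rw [← mul_assoc, mul_inv_cancel₀ h0, one_mul]
    refine integral_congr_ae (Filter.Eventually.of_forall fun q => ?_)
    refine congrArg (a q * ·) ?_
    conv_rhs => rw [← weylMap_weylInv ψ]
    rfl
  · intro h φ
    rw [eq_inv_mul_iff_mul_eq₀ h0]
    exact (weylSymbol_weylMap K φ).symm.trans (h (weylMap d φ))

theorem continuous_dot : Continuous fun p : (Rn d × Rn d) × (Rn d × Rn d) => dot p.1 p.2 := by
  unfold dot
  fun_prop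

theorem modulate_apply (ζ : Rn d × Rn d) (φ : 𝓢(Rn d × Rn d, ℂ)) (y : Rn d × Rn d) :
    modulate ζ φ y = expI (dot y ζ) * φ y := by
  simp [modulate, hasTemperateGrowth_modulation, expI]

theorem translate_apply (z : Rn d × Rn d) (φ : 𝓢(Rn d × Rn d, ℂ)) (y : Rn d × Rn d) :
    translate z φ y = φ (y - z) := rfl

/-- The short-time Fourier transform `A(T_Q M_V H)` of a functional. -/
noncomputable def stft (A : 𝓢(Rn d × Rn d, ℂ) →L[ℂ] ℂ) (H : 𝓢(Rn d × Rn d, ℂ))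
    (Q V : Rn d × Rn d) : ℂ := A (translate Q (modulate V H))

/-- The affine parametrization of `(z, ζ)` by `(Q, V)`. -/
noncomputable def fbiPoint (Q V : Rn d × Rn d) : (Rn d × Rn d) × (Rn d × Rn d) :=
  ((Q.1 + (1 / 2 : ℝ) • V.2, Q.1 - (1 / 2 : ℝ) • V.2),
    (Q.2 - (1 / 2 : ℝ) • V.1, -Q.2 - (1 / 2 : ℝ) • V.1))

/-- Covariance: `fbiPoint` is chosen so that the midpoint of `z₁, z₂` and half of `ζ₁ - ζ₂` become a
translation, while `z₁ - z₂` and `-(ζ₁ + ζ₂)` become a modulation. -/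
theorem weylMap_conjugate (g : 𝓢(Rn d × Rn d, ℂ)) (Q V : Rn d × Rn d) :
    weylMap d (conjugate (translate (fbiPoint Q V).1 (modulate (fbiPoint Q V).2 g))) =
      expI (inner ℝ Q.2 V.2) • translate Q (modulate V (weylMap d (conjugate g))) := by
  ext q
  have hconj : ∀ y, conjugate g y = (starRingEnd ℂ) (g y) := fun y => by simp [conjugate]
  rw [smul_apply, translate_apply, modulate_apply, weylMap_apply, weylMap_apply, smul_eq_mul,
    ← mul_assoc, ← expI_add, ← integral_const_mul]
  -- Shifting `u` by `V.2 = z₁ - z₂` aligns the arguments of `g`; the leftover factor `e^{i⟨V.2,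
  -- q.2⟩}` supplies half of the modulation and the scalar phase.
  rw [← integral_add_right_eq_self _ V.2]
  refine integral_congr_ae (Filter.Eventually.of_forall fun u => ?_)
  simp only
  rw [conjugate_translate_modulate_apply, hconj, map_mul]
  change _ * ((starRingEnd ℂ) (expI _) * _) = _
  rw [conj_expI, ← mul_assoc, ← mul_assoc, ← expI_add, ← expI_add]
  refine congrArg₂ (· * ·) (congrArg expI ?_) (congrArg (fun y => (starRingEnd ℂ) (g y)) ?_)
  · simp only [fbiPoint, dot, Prod.fst_sub, Prod.snd_sub]
    simp only [inner_sub_left, inner_add_left, inner_sub_right, inner_neg_right,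
      real_inner_smul_left, inner_smul_right]
    rw [real_inner_comm Q.2 V.2, real_inner_comm q.2 V.2]
    ring
  · simp only [fbiPoint]
    refine Prod.ext ?_ ?_ <;> simp only [Prod.fst_sub, Prod.snd_sub] <;> module

/-- At `fbiPoint Q V` the phase `½⟨ζ₁ - ζ₂, z₁ - z₂⟩` equals `⟨Q₂, V₂⟩`, so the correction removes
the covariance phase. One factor `(2π)^(-d)` is the normalization of `fbi`, the other that of
`weylSymbol`. -/
theorem fbiDelta_fbiPoint (g : 𝓢(Rn d × Rn d, ℂ)) (K : 𝓢'(Rn d × Rn d, ℂ)) (Q V : Rn d × Rn d) :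
    fbiDelta g K (fbiPoint Q V) = ((((2 * Real.pi) ^ d : ℝ) : ℂ)⁻¹) ^ 2 *
      stft (weylSymbol K) (weylMap d (conjugate g)) Q V := by
  have h0 := two_pi_pow_ne_zero d
  have h1 := weylSymbol_weylMap K
    (conjugate (translate (fbiPoint Q V).1 (modulate (fbiPoint Q V).2 g)))
  rw [weylMap_conjugate, map_smul, smul_eq_mul] at h1
  have h2 : fbi g K (fbiPoint Q V) = ((((2 * Real.pi) ^ d : ℝ) : ℂ)⁻¹) ^ 2 *
      (expI (inner ℝ Q.2 V.2) * stft (weylSymbol K) (weylMap d (conjugate g)) Q V) := by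
    unfold stft
    rw [h1, fbi, sq, mul_assoc, inv_mul_cancel_left₀ h0]
    rfl
  have h3 : Complex.exp (-(Complex.I / 2) * ((inner ℝ ((fbiPoint Q V).2.1 - (fbiPoint Q V).2.2)
      ((fbiPoint Q V).1.1 - (fbiPoint Q V).1.2) : ℝ) : ℂ)) = expI (-inner ℝ Q.2 V.2) := by
    rw [expI]
    congr 1
    have e1 : (fbiPoint Q V).2.1 - (fbiPoint Q V).2.2 = (2 : ℝ) • Q.2 := by
      simp only [fbiPoint]; module
    have e2 : (fbiPoint Q V).1.1 - (fbiPoint Q V).1.2 = V.2 := by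
      simp only [fbiPoint]; module
    rw [e1, e2, real_inner_smul_left]
    push_cast
    ring
  rw [fbiDelta, h3, h2, mul_left_comm, ← mul_assoc (expI _), ← expI_add, neg_add_cancel, expI_zero,
    one_mul]

/-- Kernel estimates in the coordinates `(Q, V)`. -/
def StftEstimates (ρ m : ℝ) (F : Rn d × Rn d → Rn d × Rn d → ℂ) : Prop :=
  ∀ (α β : Fin d → ℕ) (N : ℕ), ∃ C : ℝ, ∀ Q V : Rn d × Rn d,
    ‖multiDeriv (fun j => (basisVec j, 0)) α (multiDeriv (fun j => (0, basisVec j)) β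
      (fun Q => F Q V)) Q‖ ≤
      C * bracket Q.1 Q.2 ^ (m - ρ * (multiLength (α + β) : ℝ)) * bracket V.1 V.2 ^ (-(N : ℝ))

/-- A line derivative sees only the restriction to a line, and lines map to lines; no
differentiability of `F` is required. -/
theorem dirDeriv_comp_affine {W W' : Type*} [NormedAddCommGroup W] [NormedSpace ℝ W]
    [NormedAddCommGroup W'] [NormedSpace ℝ W'] (f : W → W') (L : W → W')
    (hf : ∀ x v (t : ℝ), f (x + t • v) = f x + t • L v) (l : List W) (F : W' → ℂ) :
    (fun x => dirDeriv (l.map L) F (f x)) = dirDeriv l (fun x => F (f x)) := by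
  induction l with
  | nil => rfl
  | cons v l ih =>
    rw [List.map_cons, dirDeriv_cons, dirDeriv_cons, ← ih]
    funext x
    simp only [lineDeriv, hf]

theorem dirDeriv_const_mul {W : Type*} [NormedAddCommGroup W] [NormedSpace ℝ W] (c : ℂ)
    (l : List W) (F : W → ℂ) : dirDeriv l (fun x => c * F x) = fun x => c * dirDeriv l F x := by
  induction l with
  | nil => rfl
  | cons v l ih =>
    rw [dirDeriv_cons, ih]
    funext x
    exact deriv_const_mul_field c

theorem bracket_pos (x y : Rn d) : 0 < bracket x y := by
  unfold bracket
  positivity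

theorem bracket_le_bracket_two_smul (x y : Rn d) :
    bracket x y ≤ bracket ((2 : ℝ) • x) ((2 : ℝ) • y) := by
  unfold bracket
  apply Real.sqrt_le_sqrt
  simp only [norm_smul, Real.norm_ofNat]
  nlinarith [sq_nonneg ‖x‖, sq_nonneg ‖y‖]

theorem bracket_two_smul_le (x y : Rn d) :
    bracket ((2 : ℝ) • x) ((2 : ℝ) • y) ≤ 2 * bracket x y := by
  unfold bracket
  rw [Real.sqrt_le_left (by positivity), mul_pow, Real.sq_sqrt (by positivity)]
  simp only [norm_smul, Real.norm_ofNat]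
  nlinarith [sq_nonneg ‖x‖, sq_nonneg ‖y‖]

theorem rpow_le_mul_rpow {x y : ℝ} (hx : 0 < x) (h1 : x ≤ 2 * y) (h2 : y ≤ 2 * x) (s : ℝ) :
    x ^ s ≤ 2 ^ |s| * y ^ s := by
  have hy : 0 < y := by linarith
  rcases le_total 0 s with hs | hs
  · rw [abs_of_nonneg hs, ← Real.mul_rpow zero_le_two hy.le]
    exact Real.rpow_le_rpow hx.le h1 hs
  · rw [abs_of_nonpos hs, Real.rpow_neg zero_le_two, ← Real.inv_rpow zero_le_two,
      ← Real.mul_rpow (by norm_num) hy.le]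
    exact Real.rpow_le_rpow_of_nonpos (by positivity) (by linarith) hs

/-- For fixed `V`, moving `Q` moves `(z, ζ)` along `L`, so `∂_{z₁} + ∂_{z₂}` and `∂_{ζ₁} - ∂_{ζ₂}`
become `∂_{Q₁}` and `∂_{Q₂}`. The brackets become those of `2Q` and, up to order and sign, of `V`;
the factor `2` only changes constants. -/
theorem kernelEstimates_iff (ρ m : ℝ) (g : 𝓢(Rn d × Rn d, ℂ)) (K : 𝓢'(Rn d × Rn d, ℂ)) :
    KernelEstimates ρ m g K ↔
      StftEstimates ρ m (stft (weylSymbol K) (weylMap d (conjugate g))) := by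
  set F := stft (weylSymbol K) (weylMap d (conjugate g)) with hF
  set c : ℂ := ((((2 * Real.pi) ^ d : ℝ) : ℂ)⁻¹) ^ 2 with hc
  have hc0 : c ≠ 0 := pow_ne_zero _ (inv_ne_zero (two_pi_pow_ne_zero d))
  let L : Rn d × Rn d → (Rn d × Rn d) × (Rn d × Rn d) := fun v => ((v.1, v.1), (v.2, -v.2))
  have hL : ∀ V x v (t : ℝ), fbiPoint (x + t • v) V = fbiPoint x V + t • L v := by
    intro V x v t
    simp only [fbiPoint, L, Prod.fst_add, Prod.snd_add, Prod.smul_fst, Prod.smul_snd,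
      Prod.smul_mk, Prod.mk_add_mk]
    refine Prod.ext (Prod.ext ?_ ?_) (Prod.ext ?_ ?_) <;> simp only <;> module
  have hder : ∀ α β Q V, multiDeriv (fun j => ((basisVec j, basisVec j), (0, 0))) α
        (multiDeriv (fun j => ((0, 0), (basisVec j, -basisVec j))) β (fbiDelta g K))
        (fbiPoint Q V) = c * multiDeriv (fun j => (basisVec j, 0)) α
          (multiDeriv (fun j => (0, basisVec j)) β (fun Q => F Q V)) Q := by
    intro α β Q V
    have h1 := congrFun (dirDeriv_comp_affine (fun Q => fbiPoint Q V) L (hL V)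
      ((phaseWord α β).map (phaseBasis d)) (fbiDelta g K)) Q
    simp_rw [fbiDelta_fbiPoint] at h1
    rw [dirDeriv_const_mul, ← multiDeriv_multiDeriv_eq] at h1
    refine Eq.trans ?_ h1
    rw [multiDeriv_eq_dirDeriv, multiDeriv_eq_dirDeriv, ← dirDeriv_append, phaseWord]
    simp only [List.map_append, map_multiWord, phaseBasis_inl, phaseBasis_inr, L, neg_zero]
  have hpt : ∀ z₁ z₂ ζ₁ ζ₂ : Rn d, ((z₁, z₂), (ζ₁, ζ₂)) =
      fbiPoint ((1 / 2 : ℝ) • (z₁ + z₂), (1 / 2 : ℝ) • (ζ₁ - ζ₂)) (-(ζ₁ + ζ₂), z₁ - z₂) := by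
    intro z₁ z₂ ζ₁ ζ₂
    simp only [fbiPoint]
    refine Prod.ext (Prod.ext ?_ ?_) (Prod.ext ?_ ?_) <;> simp only <;> module
  have hb2 : ∀ x y : Rn d, bracket (-x) y = bracket y x := by
    intro x y
    simp only [bracket, norm_neg]
    congr 1
    ring
  have hcmp : ∀ (x y : Rn d) (s : ℝ),
      bracket x y ^ s ≤ 2 ^ |s| * bracket ((2 : ℝ) • x) ((2 : ℝ) • y) ^ s ∧
      bracket ((2 : ℝ) • x) ((2 : ℝ) • y) ^ s ≤ 2 ^ |s| * bracket x y ^ s := by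
    intro x y s
    have h1 := bracket_le_bracket_two_smul x y
    have h2 := bracket_two_smul_le x y
    have h3 := bracket_pos x y
    exact ⟨rpow_le_mul_rpow h3 (by linarith) h2 s,
      rpow_le_mul_rpow (by linarith) h2 (by linarith) s⟩
  constructor
  · intro h α β N
    obtain ⟨C, hC⟩ := h α β N
    set s := m - ρ * (multiLength (α + β) : ℝ)
    refine ⟨‖c‖⁻¹ * (|C| * 2 ^ |s|), fun Q V => ?_⟩
    have h1 := hC (fbiPoint Q V).1.1 (fbiPoint Q V).1.2 (fbiPoint Q V).2.1 (fbiPoint Q V).2.2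
    rw [show (((fbiPoint Q V).1.1, (fbiPoint Q V).1.2), ((fbiPoint Q V).2.1, (fbiPoint Q V).2.2))
      = fbiPoint Q V from rfl, hder, norm_mul] at h1
    have e1 : (fbiPoint Q V).1.1 + (fbiPoint Q V).1.2 = (2 : ℝ) • Q.1 := by
      simp only [fbiPoint]; module
    have e2 : (fbiPoint Q V).2.1 - (fbiPoint Q V).2.2 = (2 : ℝ) • Q.2 := by
      simp only [fbiPoint]; module
    have e3 : (fbiPoint Q V).1.1 - (fbiPoint Q V).1.2 = V.2 := by
      simp only [fbiPoint]; module
    have e4 : (fbiPoint Q V).2.1 + (fbiPoint Q V).2.2 = -V.1 := by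
      simp only [fbiPoint]; module
    have e5 : bracket V.2 (-V.1) = bracket V.1 V.2 := by rw [← hb2, neg_neg]
    rw [e1, e2, e3, e4, e5] at h1
    have hV : 0 ≤ bracket V.1 V.2 ^ (-(N : ℝ)) := Real.rpow_nonneg (bracket_pos _ _).le _
    have hQ : 0 ≤ bracket ((2 : ℝ) • Q.1) ((2 : ℝ) • Q.2) ^ s :=
      Real.rpow_nonneg (bracket_pos _ _).le _
    rw [mul_assoc, mul_assoc, ← mul_assoc, ← mul_assoc, mul_assoc, mul_assoc,
      le_inv_mul_iff₀ (norm_pos_iff.2 hc0)]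
    refine h1.trans ?_
    calc C * bracket ((2 : ℝ) • Q.1) ((2 : ℝ) • Q.2) ^ s * bracket V.1 V.2 ^ (-(N : ℝ))
        ≤ |C| * (2 ^ |s| * bracket Q.1 Q.2 ^ s) * bracket V.1 V.2 ^ (-(N : ℝ)) := by
          gcongr
          · exact le_abs_self C
          · exact (hcmp _ _ s).2
      _ = _ := by ring
  · intro h α β N
    obtain ⟨C, hC⟩ := h α β N
    set s := m - ρ * (multiLength (α + β) : ℝ)
    refine ⟨‖c‖ * (|C| * 2 ^ |s|), fun z₁ z₂ ζ₁ ζ₂ => ?_⟩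
    rw [hpt, hder, norm_mul]
    have h1 := hC ((1 / 2 : ℝ) • (z₁ + z₂), (1 / 2 : ℝ) • (ζ₁ - ζ₂)) (-(ζ₁ + ζ₂), z₁ - z₂)
    rw [hb2] at h1
    have h2 := (hcmp ((1 / 2 : ℝ) • (z₁ + z₂)) ((1 / 2 : ℝ) • (ζ₁ - ζ₂)) s).1
    have e1 : ∀ y : Rn d, (2 : ℝ) • (1 / 2 : ℝ) • y = y := fun y => by module
    rw [e1, e1] at h2
    have hV : 0 ≤ bracket (z₁ - z₂) (ζ₁ + ζ₂) ^ (-(N : ℝ)) :=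
      Real.rpow_nonneg (bracket_pos _ _).le _
    have hQ : 0 ≤ bracket ((1 / 2 : ℝ) • (z₁ + z₂)) ((1 / 2 : ℝ) • (ζ₁ - ζ₂)) ^ s :=
      Real.rpow_nonneg (bracket_pos _ _).le _
    calc _ ≤ ‖c‖ * (C * bracket ((1 / 2 : ℝ) • (z₁ + z₂)) ((1 / 2 : ℝ) • (ζ₁ - ζ₂)) ^ s *
            bracket (z₁ - z₂) (ζ₁ + ζ₂) ^ (-(N : ℝ))) := by gcongr
      _ ≤ ‖c‖ * (|C| * (2 ^ |s| * bracket (z₁ + z₂) (ζ₁ - ζ₂) ^ s) *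
            bracket (z₁ - z₂) (ζ₁ + ζ₂) ^ (-(N : ℝ))) := by
          gcongr
          exact le_abs_self C
      _ = _ := by ring

theorem weylMap_conjugate_ne_zero {g : 𝓢(Rn d × Rn d, ℂ)} (hg : g ≠ 0) :
    weylMap d (conjugate g) ≠ 0 := by
  intro h
  have h1 : conjugate g = 0 := weylMap_injective (by rw [h, map_zero])
  refine hg ?_
  ext y
  have h2 := DFunLike.congr_fun h1 y
  simpa [conjugate] using h2

end Weyl

end Shubin

namespace Shubin

open MeasureTheory

/-! ### Polynomial weights and equivalent forms of the estimates. -/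

section Weights

theorem one_add_norm_pos {E : Type*} [NormedAddCommGroup E] (x : E) : 0 < 1 + ‖x‖ := by positivity

theorem one_add_norm_rpow_nonneg {E : Type*} [NormedAddCommGroup E] (x : E) (s : ℝ) :
    0 ≤ (1 + ‖x‖) ^ s := Real.rpow_nonneg (one_add_norm_pos x).le s

theorem one_add_norm_add_le {E : Type*} [NormedAddCommGroup E] (x y : E) :
    1 + ‖x + y‖ ≤ (1 + ‖x‖) * (1 + ‖y‖) := by
  nlinarith [norm_add_le x y, norm_nonneg x, norm_nonneg y]

/-- Peetre's inequality. -/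
theorem one_add_norm_add_rpow_le {E : Type*} [NormedAddCommGroup E] (x y : E) (s : ℝ) :
    (1 + ‖x + y‖) ^ s ≤ (1 + ‖x‖) ^ s * (1 + ‖y‖) ^ |s| := by
  have hx := one_add_norm_pos x
  have hy := one_add_norm_pos y
  have hxy := one_add_norm_pos (x + y)
  rcases le_total 0 s with hs | hs
  · rw [abs_of_nonneg hs, ← Real.mul_rpow hx.le hy.le]
    exact Real.rpow_le_rpow hxy.le (one_add_norm_add_le x y) hs
  · have h := one_add_norm_add_le (x + y) (-y)
    rw [add_neg_cancel_right, norm_neg] at h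
    rw [abs_of_nonpos hs, Real.rpow_neg hy.le, ← div_eq_mul_inv, le_div_iff₀ (by positivity),
      ← Real.mul_rpow hxy.le hy.le]
    exact Real.rpow_le_rpow_of_nonpos hx h hs

theorem one_add_norm_rpow_mono {E : Type*} [NormedAddCommGroup E] (x : E) {s t : ℝ} (h : s ≤ t) :
    (1 + ‖x‖) ^ s ≤ (1 + ‖x‖) ^ t :=
  Real.rpow_le_rpow_of_exponent_le (by linarith [norm_nonneg x]) h

theorem one_add_norm_rpow_add {E : Type*} [NormedAddCommGroup E] (x : E) (s t : ℝ) :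
    (1 + ‖x‖) ^ (s + t) = (1 + ‖x‖) ^ s * (1 + ‖x‖) ^ t := Real.rpow_add (one_add_norm_pos x) s t

theorem exists_norm_iteratedFDeriv_le_rpow {E : Type*} [NormedAddCommGroup E] [NormedSpace ℝ E]
    (φ : 𝓢(E, ℂ)) (n : ℕ) (s : ℝ) :
    ∃ C, 0 ≤ C ∧ ∀ y, ‖iteratedFDeriv ℝ n φ y‖ ≤ C * (1 + ‖y‖) ^ s := by
  obtain ⟨k, hk⟩ := exists_nat_ge (-s)
  refine ⟨weightedSeminorm k n φ, weightedSeminorm_nonneg k n φ, fun y => ?_⟩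
  have hy := one_add_norm_pos y
  have h := one_add_norm_pow_mul_le k n φ y
  calc ‖iteratedFDeriv ℝ n φ y‖ ≤ weightedSeminorm k n φ * (1 + ‖y‖) ^ (-(k : ℝ)) := by
        rw [Real.rpow_neg hy.le, Real.rpow_natCast, ← div_eq_mul_inv, le_div_iff₀ (by positivity),
          mul_comm]
        exact h
    _ ≤ _ := by
        gcongr
        · exact weightedSeminorm_nonneg k n φ
        · linarith [norm_nonneg y]
        · linarith

theorem exists_norm_le_rpow {E : Type*} [NormedAddCommGroup E] [NormedSpace ℝ E]
    (φ : 𝓢(E, ℂ)) (s : ℝ) : ∃ C, 0 ≤ C ∧ ∀ y, ‖φ y‖ ≤ C * (1 + ‖y‖) ^ s := by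
  simpa only [norm_iteratedFDeriv_zero] using exists_norm_iteratedFDeriv_le_rpow φ 0 s

variable {d : ℕ}

instance isAddHaarMeasure_phase : (volume : Measure (Rn d × Rn d)).IsAddHaarMeasure :=
  Measure.prod.instIsAddHaarMeasure _ _

theorem finrank_phase (d : ℕ) : Module.finrank ℝ (Rn d × Rn d) = 2 * d := by
  rw [Module.finrank_prod, finrank_Rn]
  ring

theorem integrable_one_add_norm_rpow (d : ℕ) :
    Integrable fun x : Rn d × Rn d => (1 + ‖x‖) ^ (-((2 * d + 1 : ℕ) : ℝ)) :=
  integrable_one_add_norm (by rw [finrank_phase]; push_cast; linarith)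

theorem norm_sq_le_dot (x : Rn d × Rn d) : ‖x‖ ^ 2 ≤ dot x x := by
  rw [dot, real_inner_self_eq_norm_sq, real_inner_self_eq_norm_sq, Prod.norm_def]
  rcases le_total ‖x.1‖ ‖x.2‖ with h | h
  · rw [max_eq_right h]; nlinarith
  · rw [max_eq_left h]; nlinarith

theorem bracket_le_two_mul (x : Rn d × Rn d) : bracket x.1 x.2 ≤ 2 * (1 + ‖x‖) := by
  have h1 := norm_fst_le x
  have h2 := norm_snd_le x
  unfold bracket
  rw [Real.sqrt_le_left (by positivity)]
  nlinarith [norm_nonneg x.1, norm_nonneg x.2, norm_nonneg x]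

theorem one_add_norm_le_two_mul (x : Rn d × Rn d) : 1 + ‖x‖ ≤ 2 * bracket x.1 x.2 := by
  have h1 : 1 ≤ bracket x.1 x.2 := by
    unfold bracket
    rw [Real.one_le_sqrt]
    nlinarith [sq_nonneg ‖x.1‖, sq_nonneg ‖x.2‖]
  have h2 : ‖x‖ ≤ bracket x.1 x.2 := by
    unfold bracket
    refine Real.le_sqrt_of_sq_le ((norm_sq_le_dot x).trans ?_)
    rw [dot, real_inner_self_eq_norm_sq, real_inner_self_eq_norm_sq]
    linarith
  linarith

theorem bracket_rpow_le (x : Rn d × Rn d) (s : ℝ) :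
    bracket x.1 x.2 ^ s ≤ 2 ^ |s| * (1 + ‖x‖) ^ s :=
  rpow_le_mul_rpow (bracket_pos _ _) (bracket_le_two_mul x) (one_add_norm_le_two_mul x) s

theorem one_add_norm_rpow_le (x : Rn d × Rn d) (s : ℝ) :
    (1 + ‖x‖) ^ s ≤ 2 ^ |s| * bracket x.1 x.2 ^ s :=
  rpow_le_mul_rpow (one_add_norm_pos x) (one_add_norm_le_two_mul x) (bracket_le_two_mul x) s

theorem multiDeriv_estimates_iff {T : Type*} (F : T → Rn d × Rn d → ℂ)
    (hF : ∀ t, ContDiff ℝ ∞ (F t)) (g : ℕ → T → Rn d × Rn d → ℝ) :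
    (∀ α β : Fin d → ℕ, ∃ C : ℝ, ∀ t p, ‖multiDeriv (fun j => (basisVec j, 0)) α
        (multiDeriv (fun j => (0, basisVec j)) β (F t)) p‖ ≤ C * g (multiLength (α + β)) t p) ↔
      ∀ l : List (Fin d ⊕ Fin d), ∃ C : ℝ, ∀ t p,
        ‖dirDeriv (l.map (phaseBasis d)) (F t) p‖ ≤ C * g l.length t p := by
  constructor
  · intro h l
    obtain ⟨α, β, hl, hd⟩ := exists_multiDeriv_eq_dirDeriv l
    obtain ⟨C, hC⟩ := h α β
    refine ⟨C, fun t p => ?_⟩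
    rw [hd _ (hF t), ← hl]
    exact hC t p
  · intro h α β
    obtain ⟨C, hC⟩ := h (phaseWord α β)
    refine ⟨C, fun t p => ?_⟩
    rw [multiDeriv_multiDeriv_eq, ← length_phaseWord]
    exact hC t p

theorem exists_le_mul_congr {T : Type*} {u v w : T → ℝ} {c : ℝ} (hv : ∀ t, 0 ≤ v t)
    (h : ∀ t, v t ≤ c * w t) (hu : ∃ C, ∀ t, u t ≤ C * v t) : ∃ C, ∀ t, u t ≤ C * w t := by
  obtain ⟨C, hC⟩ := hu
  refine ⟨|C| * c, fun t => ?_⟩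
  calc u t ≤ C * v t := hC t
    _ ≤ |C| * v t := by
      gcongr
      · exact hv t
      · exact le_abs_self C
    _ ≤ |C| * (c * w t) := by gcongr; exact h t
    _ = _ := by ring

theorem isShubinSymbol_iff (ρ m : ℝ) (a : Rn d × Rn d → ℂ) :
    IsShubinSymbol ρ m a ↔ ContDiff ℝ ∞ a ∧ ∀ l : List (Fin d ⊕ Fin d), ∃ C : ℝ, ∀ q,
      ‖dirDeriv (l.map (phaseBasis d)) a q‖ ≤ C * (1 + ‖q‖) ^ (m - ρ * (l.length : ℝ)) := by
  refine and_congr_right fun ha => ?_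
  have h := multiDeriv_estimates_iff (fun _ : Unit => a) (fun _ => ha)
    (fun n _ p => bracket p.1 p.2 ^ (m - ρ * (n : ℝ)))
  simp only [forall_const] at h
  rw [h]
  refine forall_congr' fun l => ⟨fun h1 => ?_, fun h1 => ?_⟩
  · exact exists_le_mul_congr (fun q => Real.rpow_nonneg (bracket_pos _ _).le _)
      (fun q => bracket_rpow_le q _) h1
  · exact exists_le_mul_congr (fun q => one_add_norm_rpow_nonneg q _)
      (fun q => one_add_norm_rpow_le q _) h1

theorem stftEstimates_iff (ρ m : ℝ) (F : Rn d × Rn d → Rn d × Rn d → ℂ)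
    (hF : ∀ V, ContDiff ℝ ∞ fun Q => F Q V) :
    StftEstimates ρ m F ↔ ∀ (l : List (Fin d ⊕ Fin d)) (N : ℕ), ∃ C : ℝ, ∀ Q V,
      ‖dirDeriv (l.map (phaseBasis d)) (fun Q => F Q V) Q‖ ≤
        C * ((1 + ‖Q‖) ^ (m - ρ * (l.length : ℝ)) * (1 + ‖V‖) ^ (-(N : ℝ))) := by
  -- With `V` as the parameter of the family, the constants obtained are uniform in `V`.
  have h : ∀ N : ℕ, _ ↔ _ := fun N => multiDeriv_estimates_iff (fun V Q => F Q V) hF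
    (fun n V Q => bracket Q.1 Q.2 ^ (m - ρ * (n : ℝ)) * bracket V.1 V.2 ^ (-(N : ℝ)))
  have hswap : StftEstimates ρ m F ↔ ∀ N : ℕ, ∀ α β : Fin d → ℕ, ∃ C : ℝ, ∀ V Q,
      ‖multiDeriv (fun j => (basisVec j, 0)) α (multiDeriv (fun j => (0, basisVec j)) β
        (fun Q => F Q V)) Q‖ ≤ C * (bracket Q.1 Q.2 ^ (m - ρ * (multiLength (α + β) : ℝ)) *
          bracket V.1 V.2 ^ (-(N : ℝ))) :=
    ⟨fun h N α β => (h α β N).imp fun C hC V Q => by rw [← mul_assoc]; exact hC Q V,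
      fun h α β N => (h N α β).imp fun C hC Q V => by rw [mul_assoc]; exact hC V Q⟩
  rw [hswap]
  simp_rw [h]
  rw [forall_comm]
  refine forall_congr' fun l => forall_congr' fun N => ?_
  set s := m - ρ * (l.length : ℝ)
  have hb : ∀ x : Rn d × Rn d, ∀ t : ℝ, 0 ≤ bracket x.1 x.2 ^ t := fun x t =>
    Real.rpow_nonneg (bracket_pos _ _).le t
  constructor
  · intro h1
    have h2 := exists_le_mul_congr (T := (Rn d × Rn d) × (Rn d × Rn d))
      (u := fun p => ‖dirDeriv (l.map (phaseBasis d)) (fun Q => F Q p.2) p.1‖)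
      (w := fun p => (1 + ‖p.1‖) ^ s * (1 + ‖p.2‖) ^ (-(N : ℝ)))
      (c := 2 ^ |s| * 2 ^ |(-(N : ℝ))|)
      (fun p => mul_nonneg (hb p.1 s) (hb p.2 (-(N : ℝ)))) (fun p => ?_)
      (h1.imp fun C hC p => hC p.2 p.1)
    · exact h2.imp fun C hC Q V => hC (Q, V)
    · calc _ ≤ (2 ^ |s| * (1 + ‖p.1‖) ^ s) * (2 ^ |(-(N : ℝ))| * (1 + ‖p.2‖) ^ (-(N : ℝ))) :=
            mul_le_mul (bracket_rpow_le _ _) (bracket_rpow_le _ _) (hb _ _)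
              (mul_nonneg (by positivity) (one_add_norm_rpow_nonneg _ _))
        _ = _ := by ring
  · intro h1
    have h2 := exists_le_mul_congr (T := (Rn d × Rn d) × (Rn d × Rn d))
      (u := fun p => ‖dirDeriv (l.map (phaseBasis d)) (fun Q => F Q p.2) p.1‖)
      (w := fun p => bracket p.1.1 p.1.2 ^ s * bracket p.2.1 p.2.2 ^ (-(N : ℝ)))
      (c := 2 ^ |s| * 2 ^ |(-(N : ℝ))|)
      (fun p => mul_nonneg (one_add_norm_rpow_nonneg p.1 s)
        (one_add_norm_rpow_nonneg p.2 (-(N : ℝ)))) (fun p => ?_)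
      (h1.imp fun C hC p => hC p.1 p.2)
    · exact h2.imp fun C hC V Q => hC (Q, V)
    · calc _ ≤ (2 ^ |s| * bracket p.1.1 p.1.2 ^ s) *
            (2 ^ |(-(N : ℝ))| * bracket p.2.1 p.2.2 ^ (-(N : ℝ))) :=
            mul_le_mul (one_add_norm_rpow_le _ _) (one_add_norm_rpow_le _ _)
              (one_add_norm_rpow_nonneg _ _) (mul_nonneg (by positivity) (hb _ _))
        _ = _ := by ring

end Weights

/-! ### Decay of Fourier integrals. -/

section FourierDecay

variable {d : ℕ}

/-- The form `-(2π)⁻¹ ⟨v, w⟩` on `ℝ²ᵈ`. -/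
noncomputable def phaseForm (d : ℕ) : (Rn d × Rn d) →L[ℝ] (Rn d × Rn d) →L[ℝ] ℝ :=
  (-(2 * Real.pi)⁻¹ : ℝ) •
    ((innerSL ℝ).bilinearComp (ContinuousLinearMap.fst ℝ (Rn d) (Rn d))
        (ContinuousLinearMap.fst ℝ (Rn d) (Rn d)) +
      (innerSL ℝ).bilinearComp (ContinuousLinearMap.snd ℝ (Rn d) (Rn d))
        (ContinuousLinearMap.snd ℝ (Rn d) (Rn d)))

theorem phaseForm_apply (v w : Rn d × Rn d) : phaseForm d v w = -(2 * Real.pi)⁻¹ * dot v w := by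
  simp [phaseForm, dot]
  ring

/-- The factor `-(2π)⁻¹` in `phaseForm` cancels the `-2π` in the Fourier character. -/
theorem fourierIntegral_phaseForm (f : Rn d × Rn d → ℂ) (w : Rn d × Rn d) :
    VectorFourier.fourierIntegral Real.fourierChar volume (phaseForm d).toLinearMap₁₂ f w =
      ∫ v, expI (dot v w) * f v := by
  unfold VectorFourier.fourierIntegral
  refine integral_congr_ae (Filter.Eventually.of_forall fun v => ?_)
  change Real.fourierChar (-(phaseForm d v w)) • f v = _
  rw [phaseForm_apply, Circle.smul_def, smul_eq_mul, fourierChar_eq_expI]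
  congr 2
  have := Real.pi_ne_zero
  field_simp

/-- Integration by parts `n` times. The constant does not depend on `f`, since the bound is applied
to a family of functions indexed by `Q`. -/
theorem exists_norm_integral_expI_le (d n : ℕ) : ∃ C : ℝ, 0 ≤ C ∧ ∀ f : Rn d × Rn d → ℂ,
    ContDiff ℝ ∞ f → (∀ k, Integrable fun v => ‖iteratedFDeriv ℝ k f v‖) → ∀ w,
      ‖∫ v, expI (dot v w) * f v‖ ≤
        C * (∑ k ∈ Finset.range (n + 1), ∫ v, ‖iteratedFDeriv ℝ k f v‖) *
          (1 + ‖w‖) ^ (-(n : ℝ)) := by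
  refine ⟨2 ^ n * (1 + (4 * Real.pi) ^ n), by positivity, fun f hf hi w => ?_⟩
  set I := ‖∫ v, expI (dot v w) * f v‖ with hI
  set S := ∑ k ∈ Finset.range (n + 1), ∫ v, ‖iteratedFDeriv ℝ k f v‖ with hS
  have hS0 : 0 ≤ S := Finset.sum_nonneg fun k _ => integral_nonneg fun v => norm_nonneg _
  have h1 : I ≤ S := by
    have e : I ≤ ∫ v, ‖iteratedFDeriv ℝ 0 f v‖ := by
      refine (norm_integral_le_integral_norm _).trans (le_of_eq ?_)
      simp only [norm_expI_mul, norm_iteratedFDeriv_zero]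
    refine e.trans (Finset.single_le_sum (f := fun k => ∫ v, ‖iteratedFDeriv ℝ k f v‖)
      (fun k _ => integral_nonneg fun v => norm_nonneg _) (by simp))
  -- The form is evaluated at `(w, w)`, where its modulus is at least `‖w‖² / 2π`; one factor `‖w‖ ^
  -- n` is then cancelled, so `w = 0` is treated apart.
  have h2 : ‖w‖ ^ n * I ≤ (4 * Real.pi) ^ n * S := by
    have h := VectorFourier.pow_mul_norm_iteratedFDeriv_fourierIntegral_le (phaseForm d)
      (μ := volume) (K := 0) (N := (⊤ : ℕ∞)) (k := 0) (n := n) hf (fun k j hk _ => by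
        have : k = 0 := by simpa using hk
        subst this
        simpa using hi j) le_rfl le_top w w
    rw [norm_iteratedFDeriv_zero, fourierIntegral_phaseForm, phaseForm_apply] at h
    simp only [pow_zero, mul_one, zero_add, Finset.range_one, Finset.sum_product,
      Finset.sum_singleton, one_mul, CharP.cast_eq_zero, mul_zero] at h
    rw [← hI, ← hS] at h
    rcases (norm_nonneg w).eq_or_lt with hw | hw
    · rcases Nat.eq_zero_or_pos n with hn | hn
      · subst hn; simpa using h1
      · rw [← hw, zero_pow hn.ne', zero_mul]; positivity
    have hp : 0 < 2 * Real.pi := by positivity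
    have h3 : (‖w‖ ^ 2 / (2 * Real.pi)) ^ n ≤ |-(2 * Real.pi)⁻¹ * dot w w| ^ n := by
      gcongr
      rw [abs_mul, abs_neg, abs_inv, abs_of_pos hp, inv_mul_eq_div]
      gcongr
      exact (norm_sq_le_dot w).trans (le_abs_self _)
    have h4 : (‖w‖ ^ 2 / (2 * Real.pi)) ^ n * I ≤ ‖w‖ ^ n * 2 ^ n * S :=
      (mul_le_mul_of_nonneg_right h3 (norm_nonneg _)).trans h
    have e1 : (‖w‖ ^ 2 / (2 * Real.pi)) ^ n * I = ‖w‖ ^ n * (2 * Real.pi)⁻¹ ^ n * (‖w‖ ^ n * I) := by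
      rw [div_eq_mul_inv, mul_pow, ← pow_mul, mul_comm 2 n, pow_mul]; ring
    have e2 : ‖w‖ ^ n * 2 ^ n * S =
        ‖w‖ ^ n * (2 * Real.pi)⁻¹ ^ n * ((4 * Real.pi) ^ n * S) := by
      have : (2 : ℝ) ^ n = (2 * Real.pi)⁻¹ ^ n * (4 * Real.pi) ^ n := by
        rw [← mul_pow]
        congr 1
        field_simp
        norm_num
      rw [this]; ring
    rw [e1, e2] at h4
    exact le_of_mul_le_mul_left h4 (by positivity)
  rw [Real.rpow_neg (one_add_norm_pos w).le, Real.rpow_natCast, ← div_eq_mul_inv,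
    le_div_iff₀ (by have := one_add_norm_pos w; positivity)]
  have h3 : (1 + ‖w‖) ^ n ≤ 2 ^ n * (1 + ‖w‖ ^ n) := by
    have h5 : 1 + ‖w‖ ≤ 2 * max 1 ‖w‖ := by linarith [le_max_left 1 ‖w‖, le_max_right 1 ‖w‖]
    refine (pow_le_pow_left₀ (one_add_norm_pos w).le h5 n).trans ?_
    rw [mul_pow]
    gcongr
    rcases le_total 1 ‖w‖ with h | h
    · rw [max_eq_right h]; linarith
    · rw [max_eq_left h, one_pow]; linarith [pow_nonneg (norm_nonneg w) n]
  calc I * (1 + ‖w‖) ^ n ≤ I * (2 ^ n * (1 + ‖w‖ ^ n)) := by gcongr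
    _ = 2 ^ n * (I + ‖w‖ ^ n * I) := by ring
    _ ≤ 2 ^ n * (S + (4 * Real.pi) ^ n * S) := by gcongr
    _ = _ := by ring

end FourierDecay

end Shubin

namespace Shubin

open MeasureTheory

/-! ### From symbols to estimates. -/

section SymbolToEstimates

variable {d : ℕ}

/-- Smooth functions all of whose derivatives are `O((1 + |q|)^s)`. -/
def HasOrder (s : ℝ) (b : Rn d × Rn d → ℂ) : Prop :=
  ContDiff ℝ ∞ b ∧ ∀ k, ∃ C, 0 ≤ C ∧ ∀ q, ‖iteratedFDeriv ℝ k b q‖ ≤ C * (1 + ‖q‖) ^ s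

theorem HasOrder.lineDeriv {s : ℝ} {b : Rn d × Rn d → ℂ} (hb : HasOrder s b) (e : Rn d × Rn d) :
    HasOrder s fun q => lineDeriv ℝ b q e := by
  refine ⟨contDiff_lineDeriv hb.1 e, fun k => ?_⟩
  obtain ⟨C, hC0, hC⟩ := hb.2 (k + 1)
  refine ⟨‖e‖ * C, by positivity, fun q => ?_⟩
  have h1 : (fun q => _root_.lineDeriv ℝ b q e) = fun q => fderiv ℝ b q e :=
    lineDeriv_eq_fderiv_of_contDiff hb.1 e
  rw [h1]
  have h2 : ContDiff ℝ ∞ (fderiv ℝ b) := hb.1.fderiv_right (by simp)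
  refine (norm_iteratedFDeriv_clm_apply_const (h2.contDiffAt) (by exact_mod_cast le_top)).trans ?_
  rw [norm_iteratedFDeriv_fderiv, mul_assoc]
  gcongr
  exact hC q

theorem HasOrder.dirDeriv {s : ℝ} {b : Rn d × Rn d → ℂ} (hb : HasOrder s b)
    (l : List (Rn d × Rn d)) : HasOrder s (dirDeriv l b) := by
  induction l with
  | nil => exact hb
  | cons v l ih => exact ih.lineDeriv v

theorem HasOrder.norm_le {s : ℝ} {b : Rn d × Rn d → ℂ} (hb : HasOrder s b) :
    ∃ C, 0 ≤ C ∧ ∀ q, ‖b q‖ ≤ C * (1 + ‖q‖) ^ s := by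
  simpa only [norm_iteratedFDeriv_zero] using hb.2 0

/-- Since `ρ ≥ 0`, further derivatives do not raise the order. Their gain is discarded: they arise
only from integration by parts in `R`, where boundedness by the same weight suffices. -/
theorem IsShubinSymbol.hasOrder_dirDeriv {ρ m : ℝ} (hρ : 0 ≤ ρ) {a : Rn d × Rn d → ℂ}
    (ha : IsShubinSymbol ρ m a) (w : List (Fin d ⊕ Fin d)) :
    HasOrder (m - ρ * (w.length : ℝ)) (dirDeriv (w.map (phaseBasis d)) a) := by
  rw [isShubinSymbol_iff] at ha
  refine ⟨contDiff_dirDeriv ha.1 _, fun k => ?_⟩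
  obtain ⟨C, hC⟩ := exists_norm_iteratedFDeriv_le (phaseBasis d) (T := Unit)
    (fun _ q => (1 + ‖q‖) ^ (m - ρ * (w.length : ℝ))) k
    (fun _ => Shubin.dirDeriv (w.map (phaseBasis d)) a) (fun _ => contDiff_dirDeriv ha.1 _)
    (fun l _ => by
      obtain ⟨C, hC⟩ := ha.2 (l ++ w)
      refine ⟨|C|, fun _ q => ?_⟩
      rw [← dirDeriv_append, ← List.map_append]
      refine (hC q).trans ?_
      refine mul_le_mul (le_abs_self C) (one_add_norm_rpow_mono q ?_)
        (one_add_norm_rpow_nonneg q _) (abs_nonneg C)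
      rw [List.length_append]
      push_cast
      nlinarith [mul_nonneg hρ (Nat.cast_nonneg (α := ℝ) l.length)])
  refine ⟨|C|, abs_nonneg C, fun q => (hC () q).trans ?_⟩
  gcongr
  exact le_abs_self C

theorem exists_norm_iteratedFDeriv_mul_le {s : ℝ} {b : Rn d × Rn d → ℂ} (hb : HasOrder s b)
    (H : 𝓢(Rn d × Rn d, ℂ)) (k : ℕ) : ∃ C, 0 ≤ C ∧ ∀ Q R,
      ‖iteratedFDeriv ℝ k (fun R => b (Q + R) * H R) R‖ ≤
        C * (1 + ‖Q‖) ^ s * (1 + ‖R‖) ^ (-((2 * d + 1 : ℕ) : ℝ)) := by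
  choose C hC0 hC using hb.2
  -- The part `-|s|` of the exponent pays for Peetre's inequality; the part `-(2d + 1)` lies below
  -- minus the dimension `2d` and gives integrability.
  choose D hD0 hD using fun n =>
    exists_norm_iteratedFDeriv_le_rpow H n (-|s| + -((2 * d + 1 : ℕ) : ℝ))
  refine ⟨∑ i ∈ Finset.range (k + 1), (k.choose i : ℝ) * C i * D (k - i),
    Finset.sum_nonneg fun i _ => by have := hC0 i; have := hD0 (k - i); positivity,
    fun Q R => ?_⟩
  have hbQ : ContDiff ℝ ∞ fun R => b (Q + R) := hb.1.comp (contDiff_const.add contDiff_id)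
  refine (norm_iteratedFDeriv_mul_le hbQ (H.smooth ⊤) R (n := k)
    (by exact_mod_cast le_top)).trans ?_
  rw [Finset.sum_mul, Finset.sum_mul]
  refine Finset.sum_le_sum fun i _ => ?_
  have h1 : ‖iteratedFDeriv ℝ i (fun R => b (Q + R)) R‖ ≤
      C i * ((1 + ‖Q‖) ^ s * (1 + ‖R‖) ^ |s|) := by
    rw [iteratedFDeriv_comp_add_left]
    refine (hC i _).trans ?_
    have := hC0 i
    gcongr
    exact one_add_norm_add_rpow_le Q R s
  have h2 := hD (k - i) R
  have h3 : (1 + ‖R‖) ^ |s| * (1 + ‖R‖) ^ (-|s| + -((2 * d + 1 : ℕ) : ℝ)) =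
      (1 + ‖R‖) ^ (-((2 * d + 1 : ℕ) : ℝ)) := by
    rw [← one_add_norm_rpow_add]
    congr 1
    ring
  have hQ := one_add_norm_rpow_nonneg Q s
  have hR := one_add_norm_rpow_nonneg R |s|
  have hCi := hC0 i
  calc _ ≤ (k.choose i : ℝ) * (C i * ((1 + ‖Q‖) ^ s * (1 + ‖R‖) ^ |s|)) *
        (D (k - i) * (1 + ‖R‖) ^ (-|s| + -((2 * d + 1 : ℕ) : ℝ))) := by gcongr
    _ = (k.choose i : ℝ) * C i * D (k - i) * (1 + ‖Q‖) ^ s * ((1 + ‖R‖) ^ |s| *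
        (1 + ‖R‖) ^ (-|s| + -((2 * d + 1 : ℕ) : ℝ))) := by ring
    _ = _ := by rw [h3]

theorem exists_norm_integral_expI_symbol_le {s : ℝ} {b : Rn d × Rn d → ℂ} (hb : HasOrder s b)
    (H : 𝓢(Rn d × Rn d, ℂ)) (N : ℕ) : ∃ C : ℝ, ∀ Q V,
      ‖∫ R, expI (dot R V) * (b (Q + R) * H R)‖ ≤
        C * ((1 + ‖Q‖) ^ s * (1 + ‖V‖) ^ (-(N : ℝ))) := by
  obtain ⟨C, hC0, hC⟩ := exists_norm_integral_expI_le d N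
  choose D hD0 hD using exists_norm_iteratedFDeriv_mul_le hb H
  set J := ∫ R : Rn d × Rn d, (1 + ‖R‖) ^ (-((2 * d + 1 : ℕ) : ℝ))
  refine ⟨C * ∑ k ∈ Finset.range (N + 1), D k * J, fun Q V => ?_⟩
  have hs : ContDiff ℝ ∞ fun R => b (Q + R) * H R :=
    (hb.1.comp (contDiff_const.add contDiff_id)).mul (H.smooth ⊤)
  have hi : ∀ k, Integrable fun R => ‖iteratedFDeriv ℝ k (fun R => b (Q + R) * H R) R‖ := fun k =>
    ((integrable_one_add_norm_rpow d).const_mul _).mono'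
      (hs.continuous_iteratedFDeriv (by exact_mod_cast le_top)).norm.aestronglyMeasurable
      (Filter.Eventually.of_forall fun R => by rw [norm_norm]; exact hD k Q R)
  refine (hC _ hs hi V).trans ?_
  rw [← mul_assoc]
  refine mul_le_mul_of_nonneg_right ?_ (one_add_norm_rpow_nonneg V _)
  rw [mul_assoc, Finset.sum_mul]
  refine mul_le_mul_of_nonneg_left (Finset.sum_le_sum fun k _ => ?_) hC0
  calc _ ≤ ∫ R : Rn d × Rn d, D k * (1 + ‖Q‖) ^ s * (1 + ‖R‖) ^ (-((2 * d + 1 : ℕ) : ℝ)) :=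
        integral_mono (hi k) ((integrable_one_add_norm_rpow d).const_mul _) (hD k Q)
    _ = _ := by rw [integral_const_mul]; ring

theorem lineDeriv_integral_symbol {s : ℝ} {b : Rn d × Rn d → ℂ} (hb : HasOrder s b)
    (φ : 𝓢(Rn d × Rn d, ℂ)) (Q e : Rn d × Rn d) :
    lineDeriv ℝ (fun Q => ∫ R, b (Q + R) * φ R) Q e = ∫ R, lineDeriv ℝ b (Q + R) e * φ R := by
  obtain ⟨C, hC0, hC⟩ := hb.norm_le
  obtain ⟨C', hC0', hC'⟩ := (hb.lineDeriv e).norm_le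
  obtain ⟨D, hD0, hD⟩ := exists_norm_le_rpow φ (-|s| + -((2 * d + 1 : ℕ) : ℝ))
  have hm : ∀ {c : Rn d × Rn d → ℂ} {B : ℝ}, 0 ≤ B → (∀ q, ‖c q‖ ≤ B * (1 + ‖q‖) ^ s) →
      ∀ {P R : Rn d × Rn d}, ‖c (P + R) * φ R‖ ≤
        B * D * (1 + ‖P‖) ^ s * (1 + ‖R‖) ^ (-((2 * d + 1 : ℕ) : ℝ)) := by
    intro c B hB hc P R
    rw [norm_mul]
    have h3 : (1 + ‖R‖) ^ |s| * (1 + ‖R‖) ^ (-|s| + -((2 * d + 1 : ℕ) : ℝ)) =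
        (1 + ‖R‖) ^ (-((2 * d + 1 : ℕ) : ℝ)) := by
      rw [← one_add_norm_rpow_add]
      congr 1
      ring
    have hP := one_add_norm_rpow_nonneg P s
    have hR := one_add_norm_rpow_nonneg R |s|
    calc _ ≤ (B * ((1 + ‖P‖) ^ s * (1 + ‖R‖) ^ |s|)) *
          (D * (1 + ‖R‖) ^ (-|s| + -((2 * d + 1 : ℕ) : ℝ))) := by
          gcongr
          · exact (hc _).trans (by gcongr; exact one_add_norm_add_rpow_le P R s)
          · exact hD R
      _ = B * D * (1 + ‖P‖) ^ s * ((1 + ‖R‖) ^ |s| *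
          (1 + ‖R‖) ^ (-|s| + -((2 * d + 1 : ℕ) : ℝ))) := by ring
      _ = _ := by rw [h3]
  have hcb : Continuous b := hb.1.continuous
  have hcb' : Continuous fun q => lineDeriv ℝ b q e := (hb.lineDeriv e).1.continuous
  have hint := integrable_one_add_norm_rpow d
  refine ((hasDerivAt_integral_of_dominated_loc_of_deriv_le (μ := volume) (𝕜 := ℝ)
    (F := fun t R => b (Q + t • e + R) * φ R)
    (F' := fun t R => lineDeriv ℝ b (Q + t • e + R) e * φ R) (x₀ := 0)
    -- Only `|t| < 1` matters, which bounds the weight at `Q + t e` by the one at `Q` uniformly in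
    -- `t`.
    (s := Metric.ball 0 1)
    (bound := fun R => C' * D * ((1 + ‖Q‖) ^ s * (1 + ‖e‖) ^ |s|) *
      (1 + ‖R‖) ^ (-((2 * d + 1 : ℕ) : ℝ)))
    (Metric.ball_mem_nhds _ one_pos) ?_ ?_ ?_ ?_ (hint.const_mul _) ?_).2.deriv).trans ?_
  · exact Filter.Eventually.of_forall fun t =>
      ((hcb.comp (continuous_const.add continuous_id)).mul φ.continuous).aestronglyMeasurable
  · exact (hint.const_mul _).mono'
      ((hcb.comp (continuous_const.add continuous_id)).mul φ.continuous).aestronglyMeasurable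
      (Filter.Eventually.of_forall fun R => hm hC0 hC)
  · exact ((hcb'.comp (continuous_const.add continuous_id)).mul φ.continuous).aestronglyMeasurable
  · refine Filter.Eventually.of_forall fun R t ht => (hm hC0' hC').trans ?_
    have ht1 : |t| ≤ 1 := by
      rw [mem_ball_zero_iff, Real.norm_eq_abs] at ht
      exact ht.le
    have hte : ‖t • e‖ ≤ ‖e‖ := by
      rw [norm_smul, Real.norm_eq_abs]
      exact mul_le_of_le_one_left (norm_nonneg e) ht1
    refine mul_le_mul_of_nonneg_right (mul_le_mul_of_nonneg_left ?_ (by positivity))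
      (one_add_norm_rpow_nonneg R _)
    refine (one_add_norm_add_rpow_le Q (t • e) s).trans ?_
    have hQ := one_add_norm_rpow_nonneg Q s
    gcongr
  · refine Filter.Eventually.of_forall fun R t _ => ?_
    have h1 : HasFDerivAt b (fderiv ℝ b (Q + t • e + R)) (Q + t • e + R) :=
      (hb.1.differentiable (by simp) _).hasFDerivAt
    have h2 : HasDerivAt (fun t : ℝ => Q + t • e + R) e t := by
      simpa using (((hasDerivAt_id t).smul_const e).const_add Q).add_const R
    have h3 := (h1.comp_hasDerivAt t h2).mul_const (φ R)
    rw [congrFun (lineDeriv_eq_fderiv_of_contDiff hb.1 e) (Q + t • e + R)]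
    exact h3
  · simp only [zero_smul, add_zero]

theorem dirDeriv_integral_symbol {s : ℝ} {b : Rn d × Rn d → ℂ} (hb : HasOrder s b)
    (φ : 𝓢(Rn d × Rn d, ℂ)) (l : List (Rn d × Rn d)) :
    dirDeriv l (fun Q => ∫ R, b (Q + R) * φ R) = fun Q => ∫ R, dirDeriv l b (Q + R) * φ R := by
  induction l with
  | nil => rfl
  | cons v l ih =>
    rw [dirDeriv_cons, ih]
    exact funext fun Q => lineDeriv_integral_symbol (hb.dirDeriv l) φ Q v

theorem contDiff_stft (A : 𝓢(Rn d × Rn d, ℂ) →L[ℂ] ℂ) (H : 𝓢(Rn d × Rn d, ℂ)) (V : Rn d × Rn d) :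
    ContDiff ℝ ∞ fun Q => stft A H Q V :=
  contDiff_apply_compSubConstCLM A (modulate V H)

/-- After translating the integration variable, `Q` occurs only in `a(Q + R)`. Each `∂_Q` therefore
falls on `a` and gains `ρ`, and the remaining oscillatory integral decays in `V`. -/
theorem stftEstimates_of_isShubinSymbol {ρ m : ℝ} (hρ : 0 ≤ ρ) {a : Rn d × Rn d → ℂ}
    (ha : IsShubinSymbol ρ m a) (A : 𝓢(Rn d × Rn d, ℂ) →L[ℂ] ℂ)
    (hA : ∀ ψ, A ψ = ∫ q, a q * ψ q) (H : 𝓢(Rn d × Rn d, ℂ)) :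
    StftEstimates ρ m (stft A H) := by
  rw [stftEstimates_iff ρ m _ (contDiff_stft A H)]
  intro l N
  obtain ⟨C, hC⟩ := exists_norm_integral_expI_symbol_le (ha.hasOrder_dirDeriv hρ l) H N
  refine ⟨C, fun Q V => ?_⟩
  have h0 : HasOrder (m - ρ * (([] : List (Fin d ⊕ Fin d)).length : ℝ)) a :=
    ha.hasOrder_dirDeriv hρ []
  have h1 : (fun Q => stft A H Q V) = fun Q => ∫ R, a (Q + R) * modulate V H R := by
    funext Q
    rw [stft, hA, ← integral_add_left_eq_self _ Q]
    refine integral_congr_ae (Filter.Eventually.of_forall fun R => ?_)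
    simp only [translate_apply, add_sub_cancel_left]
  rw [h1, dirDeriv_integral_symbol h0]
  refine le_of_eq_of_le ?_ (hC Q V)
  congr 1
  refine integral_congr_ae (Filter.Eventually.of_forall fun R => ?_)
  simp only [modulate_apply]
  ring

end SymbolToEstimates

end Shubin

namespace Shubin

open MeasureTheory
open scoped LineDeriv

/-! ### Differentiation of parameter integrals. -/

section SmoothFamily

variable {E : Type*} [NormedAddCommGroup E] [NormedSpace ℝ E] {ι : Type*}

theorem lineDeriv_eq_sum_repr [Fintype ι] (b : Module.Basis ι ℝ E) {F : E → ℂ} (hF : ContDiff ℝ ∞ F) (x v : E) :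
    lineDeriv ℝ F x v = ∑ j, b.repr v j • lineDeriv ℝ F x (b j) := by
  have h : ∀ w, lineDeriv ℝ F x w = fderiv ℝ F x w := fun w =>
    congrFun (lineDeriv_eq_fderiv_of_contDiff hF w) x
  simp_rw [h]
  conv_lhs => rw [← b.sum_repr v, map_sum]
  simp only [map_smul]

/-- Differentiation under the integral sign for a family of smooth functions with polynomially
bounded derivatives. -/
theorem contDiff_integral_family [FiniteDimensional ℝ E] [Fintype ι] {Ω : Type*}
    [MeasurableSpace Ω] {μ : Measure Ω}
    (b : Module.Basis ι ℝ E) {Φ : Ω → E → ℂ} (hΦ : ∀ z, ContDiff ℝ ∞ (Φ z))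
    (hm : ∀ (l : List ι) x, AEStronglyMeasurable (fun z => dirDeriv (l.map b) (Φ z) x) μ)
    (s : List ι → ℝ) (g : List ι → Ω → ℝ) (hg : ∀ l, Integrable (g l) μ)
    (h : ∀ l z x, ‖dirDeriv (l.map b) (Φ z) x‖ ≤ g l z * (1 + ‖x‖) ^ s l) :
    ContDiff ℝ ∞ (fun x => ∫ z, Φ z x ∂μ) ∧ ∀ l : List ι,
      dirDeriv (l.map b) (fun x => ∫ z, Φ z x ∂μ) = fun x => ∫ z, dirDeriv (l.map b) (Φ z) x ∂μ := by
  have hs : ∀ (l : List ι) z, ContDiff ℝ ∞ (dirDeriv (l.map b) (Φ z)) := fun l z => contDiff_dirDeriv (hΦ z) _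
  -- At `x = 0` the weight equals `1`, so the bound itself forces nonnegativity.
  have hg0 : ∀ l z, 0 ≤ g l z := fun l z => by
    have := (norm_nonneg _).trans (h l z 0)
    simpa using this
  have hi : ∀ (l : List ι) x, Integrable (fun z => dirDeriv (l.map b) (Φ z) x) μ := fun l x =>
    ((hg l).mul_const _).mono' (hm l x) (Filter.Eventually.of_forall fun z => h l z x)
  have hi' : ∀ (l : List ι) x (c : ℝ), Integrable (fun z => c • dirDeriv (l.map b) (Φ z) x) μ :=
    fun l x c => (hi l x).smul c
  have hloc : ∀ (l : List ι) z (x y v : E), ‖y - x‖ ≤ ‖v‖ → ‖dirDeriv (l.map b) (Φ z) y‖ ≤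
      g l z * ((1 + ‖x‖) ^ s l * (1 + ‖v‖) ^ |s l|) := fun l z x y v hy => by
    refine (h l z y).trans (mul_le_mul_of_nonneg_left ?_ (hg0 l z))
    have h1 := one_add_norm_add_rpow_le x (y - x) (s l)
    rw [add_sub_cancel] at h1
    refine h1.trans (mul_le_mul_of_nonneg_left ?_ (one_add_norm_rpow_nonneg x _))
    exact Real.rpow_le_rpow (one_add_norm_pos _).le (by linarith) (abs_nonneg _)
  have hd : ∀ (l : List ι) x v, HasLineDerivAt ℝ (fun x => ∫ z, dirDeriv (l.map b) (Φ z) x ∂μ)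
      (∑ j, b.repr v j • ∫ z, dirDeriv ((j :: l).map b) (Φ z) x ∂μ) x v := by
    intro l x v
    have key := (hasDerivAt_integral_of_dominated_loc_of_deriv_le (μ := μ) (𝕜 := ℝ)
      (F := fun t z => dirDeriv (l.map b) (Φ z) (x + t • v))
      (F' := fun t z => ∑ j, b.repr v j • dirDeriv ((j :: l).map b) (Φ z) (x + t • v)) (x₀ := 0)
      (s := Metric.ball 0 1)
      (bound := fun z => ∑ j, |b.repr v j| * (g (j :: l) z *
        ((1 + ‖x‖) ^ s (j :: l) * (1 + ‖v‖) ^ |s (j :: l)|)))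
      (Metric.ball_mem_nhds _ one_pos) (Filter.Eventually.of_forall fun t => hm l _) (hi l _)
      ?_ ?_ ?_ ?_).2
    · simp only [zero_smul, add_zero] at key
      rw [integral_finsetSum _ (fun j _ => hi' (j :: l) x (b.repr v j))] at key
      simp only [integral_smul] at key
      exact key
    · exact (integrable_finsetSum _ fun j _ =>
        hi' (j :: l) (x + (0 : ℝ) • v) (b.repr v j)).aestronglyMeasurable
    · refine Filter.Eventually.of_forall fun z t ht => (norm_sum_le _ _).trans ?_
      refine Finset.sum_le_sum fun j _ => ?_
      rw [norm_smul, Real.norm_eq_abs]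
      refine mul_le_mul_of_nonneg_left (hloc _ _ _ _ _ ?_) (abs_nonneg _)
      rw [add_sub_cancel_left, norm_smul]
      rw [mem_ball_zero_iff] at ht
      exact mul_le_of_le_one_left (norm_nonneg v) ht.le
    · exact integrable_finsetSum _ fun j _ => ((hg (j :: l)).mul_const _).const_mul _
    · refine Filter.Eventually.of_forall fun z t _ => ?_
      have h1 := ((hs l z).differentiable (by simp) (x + t • v)).hasFDerivAt
      have h2 : HasDerivAt (fun t : ℝ => x + t • v) v t := by
        simpa using ((hasDerivAt_id t).smul_const v).const_add x
      have h3 := h1.comp_hasDerivAt t h2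
      have h4 := lineDeriv_eq_sum_repr b (hs l z) (x + t • v) v
      rw [congrFun (lineDeriv_eq_fderiv_of_contDiff (hs l z) v) (x + t • v)] at h4
      rw [h4] at h3
      exact h3
  have hc : ∀ l : List ι, Continuous fun x => ∫ z, dirDeriv (l.map b) (Φ z) x ∂μ := fun l => by
    refine continuous_iff_continuousAt.2 fun x => ?_
    refine continuousAt_of_dominated (F := fun x z => dirDeriv (l.map b) (Φ z) x)
      (bound := fun z => g l z * ((1 + ‖x‖) ^ s l * 2 ^ |s l|))
      (Filter.Eventually.of_forall fun y => hm l y) ?_ ?_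
      (Filter.Eventually.of_forall fun z => (hs l z).continuous.continuousAt)
    · filter_upwards [Metric.ball_mem_nhds x one_pos] with y hy
      refine Filter.Eventually.of_forall fun z => ?_
      refine (h l z y).trans (mul_le_mul_of_nonneg_left ?_ (hg0 l z))
      have h1 := one_add_norm_add_rpow_le x (y - x) (s l)
      rw [add_sub_cancel] at h1
      refine h1.trans (mul_le_mul_of_nonneg_left ?_ (one_add_norm_rpow_nonneg x _))
      refine Real.rpow_le_rpow (one_add_norm_pos _).le ?_ (abs_nonneg _)
      rw [mem_ball_iff_norm] at hy
      linarith
    · exact (hg l).mul_const _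
  refine ⟨contDiff_of_hasLineDerivAt b (fun l x => ∫ z, dirDeriv (l.map b) (Φ z) x ∂μ) hc hd [],
    fun l => ?_⟩
  induction l with
  | nil => rfl
  | cons i l ih =>
    rw [List.map_cons, dirDeriv_cons, ih]
    funext x
    rw [(hd l x (b i)).lineDeriv, Finset.sum_eq_single i]
    · simp
    · intro j _ hj
      simp [Finsupp.single_eq_of_ne hj]
    · simp

theorem exists_wordDeriv_clm (b : Module.Basis ι ℝ E) (l : List ι) :
    ∃ W : 𝓢(E, ℂ) →L[ℂ] 𝓢(E, ℂ), ∀ φ, W φ = wordDeriv b l φ := by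
  induction l with
  | nil => exact ⟨ContinuousLinearMap.id ℂ _, fun φ => rfl⟩
  | cons j l ih =>
    obtain ⟨W, hW⟩ := ih
    exact ⟨-((LineDeriv.lineDerivOpCLM ℂ 𝓢(E, ℂ) (b j)).comp W), fun φ => by
      simp [hW, wordDeriv]⟩

end SmoothFamily

/-! ### Derivatives and measurability of the short-time Fourier transform. -/

section Stft

variable {d : ℕ}

theorem dirDeriv_stft (A : 𝓢(Rn d × Rn d, ℂ) →L[ℂ] ℂ) (H : 𝓢(Rn d × Rn d, ℂ))
    (V : Rn d × Rn d) (l : List (Fin d ⊕ Fin d)) :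
    dirDeriv (l.map (phaseBasis d)) (fun Q => stft A H Q V) =
      fun Q => A (translate Q (wordDeriv (phaseBasis d) l (modulate V H))) := by
  induction l with
  | nil => rfl
  | cons i l ih =>
    rw [List.map_cons, dirDeriv_cons, ih]
    exact funext fun Q => (hasLineDerivAt_apply_compSubConstCLM A _ Q _).lineDeriv

/-- Continuity in `Q` for each `V` together with measurability in `V` for each `Q` gives joint
measurability, so joint continuity is never needed. -/
theorem stronglyMeasurable_dirDeriv_stft (A : 𝓢(Rn d × Rn d, ℂ) →L[ℂ] ℂ) (H : 𝓢(Rn d × Rn d, ℂ))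
    (l : List (Fin d ⊕ Fin d)) :
    StronglyMeasurable fun p : (Rn d × Rn d) × (Rn d × Rn d) =>
      dirDeriv (l.map (phaseBasis d)) (fun Q => stft A H Q p.2) p.1 := by
  obtain ⟨W, hW⟩ := exists_wordDeriv_clm (phaseBasis d) l
  refine stronglyMeasurable_uncurry_of_continuous_of_stronglyMeasurable
    (u := fun Q V => dirDeriv (l.map (phaseBasis d)) (fun Q => stft A H Q V) Q) (fun V => ?_)
    (fun Q => Continuous.stronglyMeasurable ?_)
  · exact (contDiff_dirDeriv (contDiff_stft A H V) _).continuous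
  · simp_rw [dirDeriv_stft, ← hW]
    exact continuous_apply_modulate ((A.comp (SchwartzMap.compSubConstCLM ℂ Q)).comp W) H

end Stft

end Shubin

namespace Shubin

open MeasureTheory

/-! ### Correlations and the transfer identity. -/

section Correlation

variable {d : ℕ}

instance isNegInvariant_phase : (volume : Measure (Rn d × Rn d)).IsNegInvariant :=
  Measure.IsAddHaarMeasure.isNegInvariant_of_regular _

/-- The correlation `∫ f(R) g(x + R) dR`. -/
noncomputable def correlation (f g : 𝓢(Rn d × Rn d, ℂ)) (x : Rn d × Rn d) : ℂ :=
  ∫ R, f R * g (x + R)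

theorem exists_norm_mul_shift_le (f g : 𝓢(Rn d × Rn d, ℂ)) (s : ℝ) : ∃ C, 0 ≤ C ∧
    ∀ x R, ‖f R * g (x + R)‖ ≤ C * (1 + ‖x‖) ^ s * (1 + ‖R‖) ^ (-((2 * d + 1 : ℕ) : ℝ)) := by
  obtain ⟨D, hD0, hD⟩ := exists_norm_le_rpow f (-|s| + -((2 * d + 1 : ℕ) : ℝ))
  obtain ⟨D', hD0', hD'⟩ := exists_norm_le_rpow g s
  refine ⟨D * D', by positivity, fun x R => ?_⟩
  have hx := one_add_norm_rpow_nonneg x s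
  have hR := one_add_norm_rpow_nonneg R |s|
  rw [norm_mul]
  calc _ ≤ (D * (1 + ‖R‖) ^ (-|s| + -((2 * d + 1 : ℕ) : ℝ))) *
        (D' * ((1 + ‖x‖) ^ s * (1 + ‖R‖) ^ |s|)) := by
        gcongr
        · exact hD R
        · exact (hD' _).trans (by gcongr; exact one_add_norm_add_rpow_le x R s)
    _ = D * D' * (1 + ‖x‖) ^ s *
        ((1 + ‖R‖) ^ |s| * (1 + ‖R‖) ^ (-|s| + -((2 * d + 1 : ℕ) : ℝ))) := by ring
    _ = _ := by
        rw [← one_add_norm_rpow_add]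
        congr 2
        ring

theorem continuous_mul_shift (f g : 𝓢(Rn d × Rn d, ℂ)) :
    Continuous fun p : (Rn d × Rn d) × (Rn d × Rn d) => f p.2 * g (p.1 + p.2) :=
  (f.continuous.comp continuous_snd).mul
    (g.continuous.comp (continuous_fst.add continuous_snd))

theorem continuous_correlation (f g : 𝓢(Rn d × Rn d, ℂ)) : Continuous (correlation f g) := by
  obtain ⟨C, hC0, hC⟩ := exists_norm_mul_shift_le f g 0
  refine continuous_of_dominated (bound := fun R => C * (1 + ‖R‖) ^ (-((2 * d + 1 : ℕ) : ℝ)))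
    (fun x => ((continuous_mul_shift f g).comp (Continuous.prodMk_right x)).aestronglyMeasurable)
    (fun x => Filter.Eventually.of_forall fun R => ?_)
    ((integrable_one_add_norm_rpow d).const_mul _)
    (Filter.Eventually.of_forall fun R => (continuous_mul_shift f g).comp (Continuous.prodMk_left R))
  simpa using hC x R

theorem exists_norm_correlation_le (f g : 𝓢(Rn d × Rn d, ℂ)) (s : ℝ) :
    ∃ C, 0 ≤ C ∧ ∀ x, ‖correlation f g x‖ ≤ C * (1 + ‖x‖) ^ s := by
  obtain ⟨C, hC0, hC⟩ := exists_norm_mul_shift_le f g s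
  refine ⟨C * ∫ R : Rn d × Rn d, (1 + ‖R‖) ^ (-((2 * d + 1 : ℕ) : ℝ)), mul_nonneg hC0
    (integral_nonneg fun R => one_add_norm_rpow_nonneg R _), fun x => ?_⟩
  refine (norm_integral_le_of_norm_le ((integrable_one_add_norm_rpow d).const_mul _)
    (Filter.Eventually.of_forall fun R => hC x R)).trans (le_of_eq ?_)
  rw [integral_const_mul]
  ring

theorem integrableFamily_smul_translate {c : Rn d × Rn d → ℂ} (hc : Continuous c)
    (hd : ∀ s : ℝ, ∃ C, 0 ≤ C ∧ ∀ x, ‖c x‖ ≤ C * (1 + ‖x‖) ^ s) (φ : 𝓢(Rn d × Rn d, ℂ)) :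
    IntegrableFamily (fun x => c x • translate x φ) volume := by
  refine ⟨hc.smul (continuous_compSubConstCLM φ), fun k n => ?_⟩
  -- The power `k` absorbs the growth of the seminorms of translates, and `2d + 1` makes the
  -- remainder integrable.
  obtain ⟨C, hC0, hC⟩ := hd (-((2 * d + 1 : ℕ) : ℝ) + -(k : ℝ))
  refine ⟨fun x => C * weightedSeminorm k n φ * (1 + ‖x‖) ^ (-((2 * d + 1 : ℕ) : ℝ)),
    (integrable_one_add_norm_rpow d).const_mul _, fun x => ?_⟩
  have hx := one_add_norm_pos x
  rw [map_smul_eq_mul]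
  calc _ ≤ (C * (1 + ‖x‖) ^ (-((2 * d + 1 : ℕ) : ℝ) + -(k : ℝ))) *
        ((1 + ‖x‖) ^ k * weightedSeminorm k n φ) :=
        mul_le_mul (hC x) (seminorm_compSubConstCLM_le k n φ x) (apply_nonneg _ _)
          (mul_nonneg hC0 (one_add_norm_rpow_nonneg x _))
    _ = _ := by
        rw [one_add_norm_rpow_add, Real.rpow_neg hx.le (k : ℝ), Real.rpow_natCast]
        field_simp

theorem IntegrableFamily.sub {E X : Type*} [NormedAddCommGroup E] [NormedSpace ℝ E]
    [TopologicalSpace X] [SecondCountableTopology X] [MeasurableSpace X] [OpensMeasurableSpace X]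
    {μ : Measure X} {Φ Ψ : X → 𝓢(E, ℂ)} (hΦ : IntegrableFamily Φ μ) (hΨ : IntegrableFamily Ψ μ) :
    IntegrableFamily (fun x => Φ x - Ψ x) μ := by
  refine ⟨hΦ.cont.sub hΨ.cont, fun k n => ?_⟩
  obtain ⟨g, hg, h⟩ := hΦ.bound k n
  obtain ⟨g', hg', h'⟩ := hΨ.bound k n
  exact ⟨fun x => g x + g' x, hg.add hg', fun x =>
    (map_sub_le_add _ _ _).trans (add_le_add (h x) (h' x))⟩

theorem conjugate_apply (H : 𝓢(Rn d × Rn d, ℂ)) (x : Rn d × Rn d) :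
    conjugate H x = (starRingEnd ℂ) (H x) := by simp [conjugate]

/-- For fixed `R` the reflection `x ↦ y - R - x` exchanges the roles of `φ` and `M`; Fubini does the
rest. -/
theorem integral_correlation_mul (f φ M : 𝓢(Rn d × Rn d, ℂ)) (y : Rn d × Rn d) :
    ∫ x, correlation f φ x * M (y - x) = ∫ x, correlation f M x * φ (y - x) := by
  have hint : ∀ φ M : 𝓢(Rn d × Rn d, ℂ), Integrable
      (fun p : (Rn d × Rn d) × (Rn d × Rn d) => f p.2 * φ (p.1 + p.2) * M (y - p.1))
      (volume.prod volume) := by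
    intro φ M
    obtain ⟨D, hD0, hD⟩ := exists_norm_le_rpow φ 0
    have h1 := ((M.integrable (μ := volume)).comp_sub_left y).mul_prod (f.integrable (μ := volume))
    refine (h1.norm.const_mul D).mono' (((continuous_mul_shift f φ).mul
      (M.continuous.comp (continuous_const.sub continuous_fst))).aestronglyMeasurable)
      (Filter.Eventually.of_forall fun p => ?_)
    have h2 := hD (p.1 + p.2)
    rw [Real.rpow_zero, mul_one] at h2
    rw [norm_mul, norm_mul, norm_mul]
    calc _ ≤ ‖f p.2‖ * D * ‖M (y - p.1)‖ := by gcongr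
      _ = _ := by ring
  calc ∫ x, correlation f φ x * M (y - x)
      = ∫ x, ∫ R, f R * φ (x + R) * M (y - x) := by
        simp only [correlation, ← integral_mul_const]
    _ = ∫ R, ∫ x, f R * φ (x + R) * M (y - x) := integral_integral_swap (hint φ M)
    _ = ∫ R, ∫ x, f R * M (x + R) * φ (y - x) := by
        refine integral_congr_ae (Filter.Eventually.of_forall fun R => ?_)
        simp only
        rw [← integral_sub_left_eq_self (fun x => f R * φ (x + R) * M (y - x)) volume (y - R)]
        refine integral_congr_ae (Filter.Eventually.of_forall fun x => ?_)
        simp only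
        rw [show y - R - x + R = y - x by abel, show y - (y - R - x) = x + R by abel]
        ring
    _ = ∫ x, ∫ R, f R * M (x + R) * φ (y - x) := (integral_integral_swap (hint M φ)).symm
    _ = _ := by simp only [correlation, ← integral_mul_const]

theorem modulate_neg_mul_modulate (f g : 𝓢(Rn d × Rn d, ℂ)) (V x R : Rn d × Rn d) :
    modulate (-V) f R * modulate V g (x + R) = expI (dot x V) * (f R * g (x + R)) := by
  rw [modulate_apply, modulate_apply, mul_mul_mul_comm, ← expI_add]
  congr 2
  simp only [dot, Prod.fst_neg, Prod.snd_neg, inner_neg_right, Prod.fst_add, Prod.snd_add,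
    inner_add_left]
  ring

/-- The characters in `R` cancel, so all dependence on `V` is one character in `x`, ready for
Fourier inversion. -/
theorem correlation_modulate (f g : 𝓢(Rn d × Rn d, ℂ)) (V x : Rn d × Rn d) :
    correlation (modulate (-V) f) (modulate V g) x = expI (dot x V) * correlation f g x := by
  simp only [correlation, modulate_neg_mul_modulate, integral_const_mul]

theorem integrable_correlation_mul_apply (f g φ : 𝓢(Rn d × Rn d, ℂ))
    (A : 𝓢(Rn d × Rn d, ℂ) →L[ℂ] ℂ) :
    Integrable fun x => correlation f g x * A (translate x φ) := by
  simpa only [map_smul, smul_eq_mul] using (integrableFamily_smul_translate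
    (continuous_correlation f g) (exists_norm_correlation_le f g) φ).integrable_apply A

/-- Transfer of a functional through the pairing of its translates with correlations. -/
theorem integral_correlation_mul_apply (f φ M : 𝓢(Rn d × Rn d, ℂ))
    (A : 𝓢(Rn d × Rn d, ℂ) →L[ℂ] ℂ) :
    ∫ x, correlation f φ x * A (translate x M) = ∫ x, correlation f M x * A (translate x φ) := by
  have h1 := integrableFamily_smul_translate (continuous_correlation f φ)
    (exists_norm_correlation_le f φ) M
  have h2 := integrableFamily_smul_translate (continuous_correlation f M)
    (exists_norm_correlation_le f M) φ
  have hpt : ∀ (f φ M : 𝓢(Rn d × Rn d, ℂ)) (y : Rn d × Rn d),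
      Integrable fun x => correlation f φ x * M (y - x) := fun f φ M y =>
    -- Pointwise integrability is the case of the functional `δ_y`.
    integrable_correlation_mul_apply f φ M (TemperedDistribution.delta y)
  have h3 := (h1.sub h2).integral_apply_eq_zero (fun y => by
    simp only [sub_apply, smul_apply, translate_apply, smul_eq_mul]
    rw [integral_sub (hpt f φ M y) (hpt f M φ y), integral_correlation_mul, sub_self]) A
  simp only [map_sub, map_smul, smul_eq_mul] at h3
  rwa [integral_sub (integrable_correlation_mul_apply f φ M A)
    (integrable_correlation_mul_apply f M φ A), sub_eq_zero] at h3

/-- The value is `∫ |H|²`, which is positive because the support of a nonzero continuous function is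
open and nonempty. -/
theorem correlation_conjugate_zero_ne_zero {H : 𝓢(Rn d × Rn d, ℂ)} (hH : H ≠ 0) :
    correlation (conjugate H) H 0 ≠ 0 := by
  have h1 : correlation (conjugate H) H 0 = ((∫ R, ‖H R‖ ^ 2 : ℝ) : ℂ) := by
    rw [correlation, ← integral_complex_ofReal]
    refine integral_congr_ae (Filter.Eventually.of_forall fun R => ?_)
    simp only [zero_add, conjugate_apply]
    rw [mul_comm, Complex.mul_conj, Complex.normSq_eq_norm_sq]
  have hi : Integrable fun R => ‖H R‖ ^ 2 := by
    obtain ⟨C, hC0, hC⟩ := exists_norm_mul_shift_le H H 0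
    refine ((integrable_one_add_norm_rpow d).const_mul C).mono'
      (H.continuous.norm.pow 2).aestronglyMeasurable (Filter.Eventually.of_forall fun R => ?_)
    simpa [sq] using hC 0 R
  rw [h1, Complex.ofReal_ne_zero]
  refine (integral_pos_iff_support_of_nonneg (fun R => sq_nonneg _) hi).2 ?_ |>.ne'
  refine (H.continuous.norm.pow 2).isOpen_support.measure_pos volume ?_
  by_contra h
  refine hH (SchwartzMap.ext fun R => ?_)
  have h2 : (fun R => ‖H R‖ ^ 2) = 0 := Function.support_eq_empty_iff.1
    (Set.not_nonempty_iff_eq_empty.1 h)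
  simpa using congrFun h2 R

end Correlation

end Shubin

namespace Shubin

open MeasureTheory

/-! ### From estimates to symbols: the inversion formula. -/

section EstimatesToSymbol

variable {d : ℕ}

theorem continuous_modulate_neg (f : 𝓢(Rn d × Rn d, ℂ)) :
    Continuous fun p : (Rn d × Rn d) × (Rn d × Rn d) => modulate (-p.1) f p.2 := by
  simp_rw [modulate_apply]
  exact (continuous_expI.comp (continuous_dot.comp
    (continuous_snd.prodMk continuous_fst.neg))).mul (f.continuous.comp continuous_snd)

theorem norm_modulate_apply (V : Rn d × Rn d) (f : 𝓢(Rn d × Rn d, ℂ)) (R : Rn d × Rn d) :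
    ‖modulate V f R‖ = ‖f R‖ := by
  rw [modulate_apply, norm_expI_mul]

/-- The integrand `F(q - R, V) e^{-i⟨R, V⟩} conj H(R)` of the inversion formula, where
`F` is the short-time Fourier transform of `A` with window `H` and `p = (V, R)`. -/
noncomputable def inversionFamily (A : 𝓢(Rn d × Rn d, ℂ) →L[ℂ] ℂ) (H : 𝓢(Rn d × Rn d, ℂ))
    (p : (Rn d × Rn d) × (Rn d × Rn d)) (q : Rn d × Rn d) : ℂ :=
  modulate (-p.1) (conjugate H) p.2 * stft A H (q - p.2) p.1

theorem dirDeriv_inversionFamily (A : 𝓢(Rn d × Rn d, ℂ) →L[ℂ] ℂ) (H : 𝓢(Rn d × Rn d, ℂ))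
    (p : (Rn d × Rn d) × (Rn d × Rn d)) (l : List (Rn d × Rn d)) (q : Rn d × Rn d) :
    dirDeriv l (inversionFamily A H p) q =
      modulate (-p.1) (conjugate H) p.2 * dirDeriv l (fun Q => stft A H Q p.1) (q - p.2) := by
  have h1 := congrFun (dirDeriv_comp_affine (fun x : Rn d × Rn d => x - p.2) id
    (fun x v t => by simp only [id]; abel) l (fun Q => stft A H Q p.1)) q
  rw [List.map_id] at h1
  rw [h1, ← congrFun (dirDeriv_const_mul _ l _) q]
  rfl

theorem contDiff_inversionFamily (A : 𝓢(Rn d × Rn d, ℂ) →L[ℂ] ℂ) (H : 𝓢(Rn d × Rn d, ℂ))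
    (p : (Rn d × Rn d) × (Rn d × Rn d)) : ContDiff ℝ ∞ (inversionFamily A H p) :=
  contDiff_const.mul ((contDiff_stft A H p.1).comp (contDiff_id.sub contDiff_const))

theorem stronglyMeasurable_comp_sub_prod {E : Type*} [NormedAddCommGroup E] [MeasurableSpace E]
    [BorelSpace E] [SecondCountableTopology E] {u : E × E → ℂ} (hu : StronglyMeasurable u) :
    StronglyMeasurable fun z : E × (E × E) => u (z.1 - z.2.2, z.2.1) :=
  hu.comp_measurable (by fun_prop)

theorem stronglyMeasurable_dirDeriv_inversionFamily (A : 𝓢(Rn d × Rn d, ℂ) →L[ℂ] ℂ)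
    (H : 𝓢(Rn d × Rn d, ℂ)) (l : List (Fin d ⊕ Fin d)) :
    StronglyMeasurable fun z : (Rn d × Rn d) × ((Rn d × Rn d) × (Rn d × Rn d)) =>
      dirDeriv (l.map (phaseBasis d)) (inversionFamily A H z.2) z.1 := by
  simp_rw [dirDeriv_inversionFamily]
  refine StronglyMeasurable.mul ?_ ?_
  · have hc := continuous_modulate_neg (conjugate H)
    exact (hc.comp (continuous_snd (X := Rn d × Rn d))).stronglyMeasurable
  · exact stronglyMeasurable_comp_sub_prod (stronglyMeasurable_dirDeriv_stft A H l)

/-- The integrable majorant `(1 + |V|)^(-2d-1) (1 + |R|)^(-2d-1)`. -/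
noncomputable def majorant (p : (Rn d × Rn d) × (Rn d × Rn d)) : ℝ :=
  (1 + ‖p.1‖) ^ (-((2 * d + 1 : ℕ) : ℝ)) * (1 + ‖p.2‖) ^ (-((2 * d + 1 : ℕ) : ℝ))

theorem integrable_majorant : Integrable (majorant (d := d)) (volume.prod volume) :=
  (integrable_one_add_norm_rpow d).mul_prod (integrable_one_add_norm_rpow d)

theorem exists_norm_dirDeriv_inversionFamily_le {ρ m : ℝ} (A : 𝓢(Rn d × Rn d, ℂ) →L[ℂ] ℂ)
    (H : 𝓢(Rn d × Rn d, ℂ)) (hF : StftEstimates ρ m (stft A H)) (l : List (Fin d ⊕ Fin d)) :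
    ∃ C, ∀ p q, ‖dirDeriv (l.map (phaseBasis d)) (inversionFamily A H p) q‖ ≤
      C * majorant p * (1 + ‖q‖) ^ (m - ρ * (l.length : ℝ)) := by
  rw [stftEstimates_iff ρ m _ (contDiff_stft A H)] at hF
  -- The choice `N = 2d + 1` makes the bound integrable in `V`; integrability in `R` comes from the
  -- window, which also pays for Peetre's inequality at `q - R`.
  obtain ⟨C, hC⟩ := hF l (2 * d + 1)
  set s := m - ρ * (l.length : ℝ)
  obtain ⟨D, hD0, hD⟩ := exists_norm_le_rpow (conjugate H) (-|s| + -((2 * d + 1 : ℕ) : ℝ))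
  refine ⟨D * |C|, fun p q => ?_⟩
  have hq := one_add_norm_rpow_nonneg q s
  have hV := one_add_norm_rpow_nonneg p.1 (-((2 * d + 1 : ℕ) : ℝ))
  have hR := one_add_norm_rpow_nonneg p.2 (-|s| + -((2 * d + 1 : ℕ) : ℝ))
  have hP := one_add_norm_add_rpow_le q (-p.2) s
  rw [← sub_eq_add_neg, norm_neg] at hP
  have h2 : ‖dirDeriv (l.map (phaseBasis d)) (fun Q => stft A H Q p.1) (q - p.2)‖ ≤
      |C| * (((1 + ‖q‖) ^ s * (1 + ‖p.2‖) ^ |s|) * (1 + ‖p.1‖) ^ (-((2 * d + 1 : ℕ) : ℝ))) := by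
    refine (hC (q - p.2) p.1).trans (mul_le_mul (le_abs_self C) ?_ ?_ (abs_nonneg C))
    · exact mul_le_mul_of_nonneg_right hP hV
    · exact mul_nonneg (one_add_norm_rpow_nonneg _ _) hV
  rw [dirDeriv_inversionFamily, norm_mul, norm_modulate_apply]
  calc _ ≤ (D * (1 + ‖p.2‖) ^ (-|s| + -((2 * d + 1 : ℕ) : ℝ))) *
        (|C| * (((1 + ‖q‖) ^ s * (1 + ‖p.2‖) ^ |s|) *
          (1 + ‖p.1‖) ^ (-((2 * d + 1 : ℕ) : ℝ)))) :=
        mul_le_mul (hD _) h2 (norm_nonneg _) (mul_nonneg hD0 hR)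
    _ = D * |C| * (1 + ‖p.1‖) ^ (-((2 * d + 1 : ℕ) : ℝ)) * ((1 + ‖p.2‖) ^ |s| *
          (1 + ‖p.2‖) ^ (-|s| + -((2 * d + 1 : ℕ) : ℝ))) * (1 + ‖q‖) ^ s := by ring
    _ = _ := by
        rw [← one_add_norm_rpow_add, add_neg_cancel_left, majorant]
        ring

/-- In the inversion integrand `q` enters only through `F(q - R, V)`, so its derivatives inherit the
orders of `F`, and the majorant integrates out `V` and `R`. -/
theorem isShubinSymbol_integral_inversionFamily {ρ m : ℝ} (A : 𝓢(Rn d × Rn d, ℂ) →L[ℂ] ℂ)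
    (H : 𝓢(Rn d × Rn d, ℂ)) (hF : StftEstimates ρ m (stft A H)) (c : ℂ) :
    IsShubinSymbol ρ m fun q => c * ∫ p, inversionFamily A H p q ∂(volume.prod volume) := by
  choose C hC using exists_norm_dirDeriv_inversionFamily_le A H hF
  obtain ⟨h1, h2⟩ := contDiff_integral_family (μ := volume.prod volume) (phaseBasis d)
    (contDiff_inversionFamily A H)
    (fun l q => ((stronglyMeasurable_dirDeriv_inversionFamily A H l).comp_measurable
      measurable_prodMk_left).aestronglyMeasurable) (fun l => m - ρ * (l.length : ℝ))
    (fun l p => C l * majorant p) (fun l => integrable_majorant.const_mul _) hC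
  rw [isShubinSymbol_iff]
  refine ⟨contDiff_const.mul h1, fun l => ⟨‖c‖ * ∫ p, C l * majorant (d := d) p ∂(volume.prod volume),
    fun q => ?_⟩⟩
  rw [dirDeriv_const_mul, h2, norm_mul, mul_assoc, ← integral_mul_const]
  refine mul_le_mul_of_nonneg_left (norm_integral_le_of_norm_le
    ((integrable_majorant.const_mul _).mul_const _)
    (Filter.Eventually.of_forall fun p => hC l p q)) (norm_nonneg c)

theorem integrable_inversionFamily_mul {ρ m : ℝ} (A : 𝓢(Rn d × Rn d, ℂ) →L[ℂ] ℂ)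
    (H : 𝓢(Rn d × Rn d, ℂ)) (hF : StftEstimates ρ m (stft A H)) (φ : 𝓢(Rn d × Rn d, ℂ)) :
    Integrable (fun z : (Rn d × Rn d) × ((Rn d × Rn d) × (Rn d × Rn d)) =>
      inversionFamily A H z.2 z.1 * φ z.1) (volume.prod (volume.prod volume)) := by
  obtain ⟨C, hC⟩ := exists_norm_dirDeriv_inversionFamily_le A H hF []
  simp only [List.map_nil, dirDeriv_nil, List.length_nil, CharP.cast_eq_zero, mul_zero,
    sub_zero] at hC
  obtain ⟨D, hD0, hD⟩ := exists_norm_le_rpow φ (-m + -((2 * d + 1 : ℕ) : ℝ))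
  have hm : StronglyMeasurable fun z : (Rn d × Rn d) × ((Rn d × Rn d) × (Rn d × Rn d)) =>
      inversionFamily A H z.2 z.1 * φ z.1 :=
    (stronglyMeasurable_dirDeriv_inversionFamily A H []).mul
      (φ.continuous.comp continuous_fst).stronglyMeasurable
  refine (((integrable_one_add_norm_rpow d).const_mul D).mul_prod
    (integrable_majorant.const_mul C)).mono' hm.aestronglyMeasurable
    (Filter.Eventually.of_forall fun z => ?_)
  rw [norm_mul]
  calc _ ≤ (C * majorant z.2 * (1 + ‖z.1‖) ^ m) *
        (D * (1 + ‖z.1‖) ^ (-m + -((2 * d + 1 : ℕ) : ℝ))) :=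
        mul_le_mul (hC _ _) (hD _) (norm_nonneg _) ((norm_nonneg _).trans (hC _ _))
    _ = D * ((1 + ‖z.1‖) ^ m * (1 + ‖z.1‖) ^ (-m + -((2 * d + 1 : ℕ) : ℝ))) *
        (C * majorant z.2) := by ring
    _ = _ := by rw [← one_add_norm_rpow_add, add_neg_cancel_left]

/-- With `x = q - R` the left side pairs `A(T_x M_V H)` with a correlation of `φ`. The transfer
identity puts `φ` inside `A` and the window into the correlation, where the modulations collapse to
a character. -/
theorem integral_inversionFamily_mul {ρ m : ℝ} (A : 𝓢(Rn d × Rn d, ℂ) →L[ℂ] ℂ)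
    (H : 𝓢(Rn d × Rn d, ℂ)) (hF : StftEstimates ρ m (stft A H)) (φ : 𝓢(Rn d × Rn d, ℂ))
    (V : Rn d × Rn d) :
    ∫ R, ∫ q, inversionFamily A H (V, R) q * φ q =
      ∫ x, expI (dot x V) * (correlation (conjugate H) H x * A (translate x φ)) := by
  set f := modulate (-V) (conjugate H) with hf
  -- Here `V` is fixed, so no decay in `V` is needed and `N = 0` suffices.
  obtain ⟨C, hC⟩ := (stftEstimates_iff ρ m _ (contDiff_stft A H)).1 hF [] 0
  simp only [List.map_nil, dirDeriv_nil, List.length_nil, CharP.cast_eq_zero, mul_zero,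
    sub_zero, neg_zero, Real.rpow_zero, mul_one] at hC
  obtain ⟨D, hD0, hD⟩ := exists_norm_mul_shift_le f φ (-m + -((2 * d + 1 : ℕ) : ℝ))
  have hint : Integrable (fun p : (Rn d × Rn d) × (Rn d × Rn d) =>
      f p.2 * φ (p.1 + p.2) * stft A H p.1 V) (volume.prod volume) := by
    refine ((((integrable_one_add_norm_rpow d).const_mul (D * |C|)).mul_prod
      (integrable_one_add_norm_rpow d))).mono'
      ((continuous_mul_shift f φ).mul
        ((contDiff_stft A H V).continuous.comp continuous_fst)).aestronglyMeasurable
      (Filter.Eventually.of_forall fun p => ?_)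
    have h1 := one_add_norm_rpow_nonneg p.1 (-m + -((2 * d + 1 : ℕ) : ℝ))
    have h2 := one_add_norm_rpow_nonneg p.2 (-((2 * d + 1 : ℕ) : ℝ))
    have h3 := one_add_norm_rpow_nonneg p.1 m
    rw [norm_mul]
    calc _ ≤ (D * (1 + ‖p.1‖) ^ (-m + -((2 * d + 1 : ℕ) : ℝ)) *
            (1 + ‖p.2‖) ^ (-((2 * d + 1 : ℕ) : ℝ))) * (|C| * (1 + ‖p.1‖) ^ m) :=
          mul_le_mul (hD _ _) ((hC _ _).trans (mul_le_mul_of_nonneg_right (le_abs_self C) h3))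
            (norm_nonneg _) (by positivity)
      _ = D * |C| * ((1 + ‖p.1‖) ^ m * (1 + ‖p.1‖) ^ (-m + -((2 * d + 1 : ℕ) : ℝ))) *
            (1 + ‖p.2‖) ^ (-((2 * d + 1 : ℕ) : ℝ)) := by ring
      _ = _ := by rw [← one_add_norm_rpow_add, add_neg_cancel_left]
  calc ∫ R, ∫ q, inversionFamily A H (V, R) q * φ q
      = ∫ R, ∫ x, f R * φ (x + R) * stft A H x V := by
        refine integral_congr_ae (Filter.Eventually.of_forall fun R => ?_)
        simp only
        rw [← integral_sub_right_eq_self (fun x => f R * φ (x + R) * stft A H x V) R]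
        refine integral_congr_ae (Filter.Eventually.of_forall fun q => ?_)
        simp only [inversionFamily, sub_add_cancel, hf]
        ring
    _ = ∫ x, ∫ R, f R * φ (x + R) * stft A H x V := (integral_integral_swap hint).symm
    _ = ∫ x, correlation f φ x * A (translate x (modulate V H)) := by
        simp only [correlation, ← integral_mul_const, stft]
    _ = _ := by
        rw [integral_correlation_mul_apply]
        simp only [hf, correlation_modulate, mul_assoc]

/-- Integrating in `V` last leaves the integral of the Fourier transform of `x ↦ (correlation at x)
· A(T_x φ)`, which inversion evaluates at `x = 0`. -/
theorem integral_symbol_mul {ρ m : ℝ} (A : 𝓢(Rn d × Rn d, ℂ) →L[ℂ] ℂ)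
    (H : 𝓢(Rn d × Rn d, ℂ)) (hF : StftEstimates ρ m (stft A H)) (φ : 𝓢(Rn d × Rn d, ℂ)) :
    ∫ q, (∫ p, inversionFamily A H p q ∂(volume.prod volume)) * φ q =
      ((2 * Real.pi) ^ (2 * d) : ℝ) * (correlation (conjugate H) H 0 * A φ) := by
  have hG := integrable_inversionFamily_mul A H hF φ
  have hG1 := hG.swap.integral_prod_left
  have hG2 := hG1.integral_prod_left
  simp only [Function.comp_apply, Prod.fst_swap, Prod.snd_swap] at hG1 hG2
  -- Fubini's integrability in `V` is exactly the integrability of the Fourier transform required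
  -- for inversion.
  simp_rw [integral_inversionFamily_mul A H hF φ] at hG2
  have h0 : translate 0 φ = φ := by ext x; simp [translate_apply]
  calc ∫ q, (∫ p, inversionFamily A H p q ∂(volume.prod volume)) * φ q
      = ∫ q, ∫ p, inversionFamily A H p q * φ q ∂(volume.prod volume) := by
        simp only [integral_mul_const]
    _ = ∫ p, ∫ q, inversionFamily A H p q * φ q ∂(volume.prod volume) :=
        integral_integral_swap hG
    _ = ∫ V, ∫ R, ∫ q, inversionFamily A H (V, R) q * φ q := integral_prod _ hG1
    _ = ∫ V, ∫ x, expI (dot x V) * (correlation (conjugate H) H x * A (translate x φ)) := by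
        simp only [integral_inversionFamily_mul A H hF φ]
    _ = _ := by
        rw [integral_integral_expI_dot
          (f := fun x => correlation (conjugate H) H x * A (translate x φ))
          ((continuous_correlation _ _).mul (contDiff_apply_compSubConstCLM A φ).continuous)
          (integrable_correlation_mul_apply _ _ _ _) hG2, h0]

theorem exists_isShubinSymbol_of_stftEstimates {ρ m : ℝ} (A : 𝓢(Rn d × Rn d, ℂ) →L[ℂ] ℂ)
    {H : 𝓢(Rn d × Rn d, ℂ)} (hH : H ≠ 0) (hF : StftEstimates ρ m (stft A H)) :
    ∃ a, IsShubinSymbol ρ m a ∧ ∀ φ, A φ = ∫ q, a q * φ q := by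
  set c : ℂ := ((2 * Real.pi) ^ (2 * d) : ℝ) * correlation (conjugate H) H 0 with hc
  have hc0 : c ≠ 0 := mul_ne_zero (two_pi_pow_ne_zero (2 * d))
    (correlation_conjugate_zero_ne_zero hH)
  refine ⟨_, isShubinSymbol_integral_inversionFamily A H hF c⁻¹, fun φ => ?_⟩
  simp only [mul_assoc, integral_const_mul]
  rw [integral_symbol_mul A H hF φ, ← mul_assoc, ← mul_assoc, mul_assoc c⁻¹, ← hc,
    inv_mul_cancel₀ hc0, one_mul]

theorem exists_schwartz_ne_zero (d : ℕ) : ∃ g : 𝓢(Rn d × Rn d, ℂ), g ≠ 0 := by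
  obtain ⟨f, hsupp, hcomp, hsmooth, -, hf⟩ := exists_contDiff_tsupport_subset (n := ⊤)
    (E := Rn d × Rn d) (s := Set.univ) (x := 0) Filter.univ_mem
  refine ⟨(hcomp.comp_left (g := Complex.ofReal) Complex.ofReal_zero).toSchwartzMap
    (Complex.ofRealCLM.contDiff.comp hsmooth), fun h => ?_⟩
  have h1 : (f 0 : ℂ) = 0 := DFunLike.congr_fun h 0
  simp [hf] at h1

end EstimatesToSymbol

end Shubin
-- The characterization of Weyl kernels.
theorem mainTheorem2 (d : ℕ) (ρ m : ℝ) (hρ0 : 0 ≤ ρ) (hρ1 : ρ ≤ 1)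
    (K : 𝓢'(Shubin.Rn d × Shubin.Rn d, ℂ)) :
    ((∃ a : Shubin.Rn d × Shubin.Rn d → ℂ,
        Shubin.IsShubinSymbol ρ m a ∧ Shubin.IsWeylKernel a K) ↔
      ∀ g : 𝓢(Shubin.Rn d × Shubin.Rn d, ℂ), g ≠ 0 → Shubin.KernelEstimates ρ m g K) ∧
    ((∃ a : Shubin.Rn d × Shubin.Rn d → ℂ,
        Shubin.IsShubinSymbol ρ m a ∧ Shubin.IsWeylKernel a K) ↔
      ∃ g : 𝓢(Shubin.Rn d × Shubin.Rn d, ℂ), g ≠ 0 ∧ Shubin.KernelEstimates ρ m g K) := by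
  have forward : (∃ a : Shubin.Rn d × Shubin.Rn d → ℂ,
      Shubin.IsShubinSymbol ρ m a ∧ Shubin.IsWeylKernel a K) →
      ∀ g : 𝓢(Shubin.Rn d × Shubin.Rn d, ℂ), g ≠ 0 → Shubin.KernelEstimates ρ m g K := by
    rintro ⟨a, ha, hK⟩ g -
    rw [Shubin.kernelEstimates_iff]
    exact Shubin.stftEstimates_of_isShubinSymbol hρ0 ha _ ((Shubin.isWeylKernel_iff a K).1 hK) _
  have backward : (∃ g : 𝓢(Shubin.Rn d × Shubin.Rn d, ℂ),
      g ≠ 0 ∧ Shubin.KernelEstimates ρ m g K) →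
      ∃ a : Shubin.Rn d × Shubin.Rn d → ℂ,
        Shubin.IsShubinSymbol ρ m a ∧ Shubin.IsWeylKernel a K := by
    rintro ⟨g, hg, h⟩
    rw [Shubin.kernelEstimates_iff] at h
    obtain ⟨a, ha, hA⟩ := Shubin.exists_isShubinSymbol_of_stftEstimates _
      (Shubin.weylMap_conjugate_ne_zero hg) h
    exact ⟨a, ha, (Shubin.isWeylKernel_iff a K).2 hA⟩
  -- A nonzero window exists, so estimates for every window imply estimates for some window, and the
  -- two equivalences close up.
  obtain ⟨g₀, hg₀⟩ := Shubin.exists_schwartz_ne_zero d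
  exact ⟨⟨forward, fun h => backward ⟨g₀, hg₀, h g₀ hg₀⟩⟩,
    fun h => ⟨g₀, hg₀, forward h g₀ hg₀⟩, backward⟩
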